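/- **Notation.** For $0\le m\le n$ let $P_n^m(x)=\frac{(-1)^m}{2^n n!}(1-x^2)^{m/2}\frac{d^{m+n}}{dx^{m+n}}(x^2-1)^n$, and for $m\in\mathbb Z$, $|m|\le n$, let $$Q_n^m(\theta)=\Big(\tfrac{2n+1}{2}\tfrac{(n-|m|)!}{(n+|m|)!}\Big)^{1/2}P_n^{|m|}(\cos\theta),\quad e_m(\phi)=\tfrac{1}{\sqrt{2\pi}}e^{im\phi},\quad Y_n^m(\theta,\phi)=(-1)^{(m+|m|)/2}Q_n^m(\theta)e_m(\phi).$$ For $s\ge 0$, $\mathcal H^s$ is the space of measurable $F:\mathbb R^2\to\mathbb C$ with the symmetries $$F(\theta,\phi)=F(\theta+2\pi,\phi)=F(\theta,\phi+2\pi)=F(-\theta,\phi+\pi)\quad\text{for almost every }(\theta,\phi),\tag{1}$$ with $\int_0^\pi\int_0^{2\pi}|F|^2\sin\theta\,d\phi\,d\theta<\infty$, and with $$\|F\|_{\mathcal H^s}^2:=\sum_{m\in\mathbb Z}\sum_{n\ge|m|}(n+\tfrac12)^{2s}|\widehat F_{n,m}|^2<\infty,\qquad \widehat F_{n,m}=\int_0^\pi\int_0^{2\pi}F\,\overline{Y_n^m}\,\sin\theta\,d\phi\,d\theta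 .$$ For $m\in\mathbb Z$, $W_m^s$ is the space of $f\in L^1_{\rm loc}(\mathbb R)$ (complex valued) such that $f\otimes e_m:(\theta,\phi)\mapsto f(\theta)e_m(\phi)$ belongs to $\mathcal H^s$, with $\|f\|_{W_m^s}:=\|f\otimes e_m\|_{\mathcal H^s}$. For $r\ge0$, $H^r_\#$ is the space of $2\pi$-periodic $f\in L^2_{\rm loc}(\mathbb R)$ with $$\|f\|_{H^r_\#}^2:=|\widehat f(0)|^2+\sum_{k\ne0}|k|^{2r}|\widehat f(k)|^2<\infty,\qquad \widehat f(k)=\frac1{2\pi}\int_0^{2\pi}f(\theta)e^{-ik\theta}\,d\theta .$$ **Proposition 3.2.** 1. For every $r>0$ there is $C_r>0$ such that for all $m\in\mathbb Z$ and all $f\in W_m^{r+1/2}$ one has $f\in H^r_\#$ and $\|f\|_{H^r_\#}\le C_r\|f\|_{W_m^{r+1/2}}$. 2. For all $m\in\mathbb Z$ and all $f\in H^0_\#$ such that $f\otimes e_m$ satisfies (1), one has $f\in W_m^0$ and $\|f\|_{W_m^0}\le\sqrt{\pi}\,\|f\|_{H^0_\#}$. 3. There is $C>0$ such that for all $m\in\mathbb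 Z$ and all $f\in W_m^1\cap H^1_\#$ one has $\|f\|_{W_m^1}\le C(1+|m|)\|f\|_{H^1_\#}$. -/

import Mathlib

open MeasureTheory

noncomputable section

namespace SphereSobolev

/-- The associated Legendre function
`P_n^m(x) = (-1)^m / (2^n n!) (1 - x^2)^(m/2) (d/dx)^(m+n) (x^2 - 1)^n` for `m ≥ 0`, `|x| ≤ 1`. -/
def assocLegendre (n m : ℕ) (x : ℝ) : ℝ :=
  (-1) ^ m / (2 ^ n * (n.factorial : ℝ)) * Real.sqrt (1 - x ^ 2) ^ m *
    ((Polynomial.derivative^[m + n]) ((Polynomial.X ^ 2 - 1 : Polynomial ℝ) ^ n)).eval x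

/-- The normalized function `Q_n^m(θ)`, for integer `m` with `|m| ≤ n`; `Q_n^{-m} = Q_n^m`. It is
only ever integrated over `θ ∈ [0, π]`, and only used for `|m| ≤ n`. -/
def Q (n : ℕ) (m : ℤ) (θ : ℝ) : ℝ :=
  Real.sqrt ((2 * (n : ℝ) + 1) / 2 *
      (((n - m.natAbs).factorial : ℝ) / ((n + m.natAbs).factorial : ℝ))) *
    assocLegendre n m.natAbs (Real.cos θ)

/-- `e_m(φ) = exp(i m φ) / √(2π)`. -/
def e (m : ℤ) (φ : ℝ) : ℂ :=
  1 / (Real.sqrt (2 * Real.pi) : ℂ) * Complex.exp (Complex.I * (m : ℂ) * (φ : ℂ))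

/-- The spherical harmonic `Y_n^m(θ, φ) = (-1)^((m+|m|)/2) Q_n^m(θ) e_m(φ)`, `|m| ≤ n`
(the integer division is exact). -/
def Y (n : ℕ) (m : ℤ) (θ φ : ℝ) : ℂ :=
  (-1) ^ ((m + |m|) / 2) * (Q n m θ : ℂ) * e m φ

/-- The symmetries of a function `F = F° ∘ p` that comes from a function `F°` on the sphere through
`p(θ, φ) = (sin θ cos φ, sin θ sin φ, cos θ)`. As usual for elements of `L²`, they are required
almost everywhere. -/
def SphereSymm (F : ℝ × ℝ → ℂ) : Prop :=
  ∀ᵐ p : ℝ × ℝ, F p = F (p.1 + 2 * Real.pi, p.2) ∧ F p = F (p.1, p.2 + 2 * Real.pi) ∧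
    F p = F (-p.1, p.2 + Real.pi)

/-- The space `𝓗⁰` of square integrable functions on the sphere, in spherical coordinates. -/
def MemL2Sphere (F : ℝ × ℝ → ℂ) : Prop :=
  AEStronglyMeasurable F volume ∧ SphereSymm F ∧
    IntegrableOn (fun p : ℝ × ℝ => ‖F p‖ ^ 2 * Real.sin p.1)
      (Set.Icc 0 Real.pi ×ˢ Set.Icc 0 (2 * Real.pi)) volume

/-- The coefficient of `F` with respect to `Y_n^m`. -/
def sphereCoeff (F : ℝ × ℝ → ℂ) (n : ℕ) (m : ℤ) : ℂ :=
  ∫ θ in (0 : ℝ)..Real.pi, ∫ φ in (0 : ℝ)..(2 * Real.pi),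
    F (θ, φ) * (starRingEnd ℂ) (Y n m θ φ) * (Real.sin θ : ℂ)

/-- The term of index `(m, n)`, `|m| ≤ n`, of the squared `𝓗^s` norm. -/
def sphereTerm (s : ℝ) (F : ℝ × ℝ → ℂ) (p : ℤ × ℕ) : ℝ :=
  if p.1.natAbs ≤ p.2 then
    ((p.2 : ℝ) + 1 / 2) ^ (2 * s) * ‖sphereCoeff F p.2 p.1‖ ^ 2
  else 0

/-- The Sobolev space `𝓗^s` on the sphere, for `s ≥ 0`. -/
def MemHSphere (s : ℝ) (F : ℝ × ℝ → ℂ) : Prop :=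
  MemL2Sphere F ∧ Summable (sphereTerm s F)

/-- The norm of `𝓗^s`. -/
def normHSphere (s : ℝ) (F : ℝ × ℝ → ℂ) : ℝ :=
  Real.sqrt (∑' p : ℤ × ℕ, sphereTerm s F p)

/-- `(f ⊗ e_m)(θ, φ) = f(θ) e_m(φ)`. -/
def tensorE (f : ℝ → ℂ) (m : ℤ) (p : ℝ × ℝ) : ℂ := f p.1 * e m p.2

/-- The space `W_m^s` of the locally integrable `f` with `f ⊗ e_m ∈ 𝓗^s`, for `s ≥ 0`. -/
def MemW (m : ℤ) (s : ℝ) (f : ℝ → ℂ) : Prop :=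
  LocallyIntegrable f volume ∧ MemHSphere s (tensorE f m)

/-- The norm of `W_m^s`, the image of the norm of `𝓗^s`. -/
def normW (m : ℤ) (s : ℝ) (f : ℝ → ℂ) : ℝ := normHSphere s (tensorE f m)

/-- The Fourier coefficient `(1/2π) ∫_0^{2π} f(θ) exp(-i k θ) dθ`. -/
def fourierCoef (f : ℝ → ℂ) (k : ℤ) : ℂ :=
  1 / (2 * (Real.pi : ℂ)) *
    ∫ θ in (0 : ℝ)..(2 * Real.pi), f θ * Complex.exp (-(Complex.I * (k : ℂ) * (θ : ℂ)))

/-- The term of index `k` of the squared norm of the periodic Sobolev space of order `r`. -/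
def periodicTerm (r : ℝ) (f : ℝ → ℂ) (k : ℤ) : ℝ :=
  if k = 0 then ‖fourierCoef f 0‖ ^ 2 else |(k : ℝ)| ^ (2 * r) * ‖fourierCoef f k‖ ^ 2

/-- The `2π`-periodic Sobolev space `H^r_#`, for `r ≥ 0`. -/
def MemH (r : ℝ) (f : ℝ → ℂ) : Prop :=
  MemLp f 2 (volume.restrict (Set.Ioc 0 (2 * Real.pi))) ∧
    (∀ᵐ θ : ℝ, f (θ + 2 * Real.pi) = f θ) ∧ Summable (periodicTerm r f)

/-- The norm of `H^r_#`. -/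
def normH (r : ℝ) (f : ℝ → ℂ) : ℝ := Real.sqrt (∑' k : ℤ, periodicTerm r f k)

end SphereSobolev

end

noncomputable section

open MeasureTheory

namespace SphereSobolev

/-! The function f ⊗ e_m has only coefficients of order m, so everything takes place on the meridian
(0, π), in the functions q_n = (-1)^m Q_n^m (order |m|, n ≥ |m|), which are orthonormal and complete
for the weight sin θ. They are multiples of the trigonometric polynomials T_m(θ) = sin^m θ ·
P_n^{(m)}(cos θ), so their Fourier coefficients on the full circle make sense.

Trace estimate. Uniformity in m comes from the addition formula on a great circle, ∑_m w_m T_m(x)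
T_m(y) = P_n(cos(x - y)) (`legendre_addition`). Taking Fourier coefficients in both variables shows
that the columns of the matrix √w_m · T̂_m(k) are orthogonal, with squared lengths p_n(k) ≥ 0, the
Fourier coefficients of P_n(cos θ). Bessel's inequality then bounds its rows: w_m ∑_k |T̂_m(k)|² /
p_n(k) ≤ 1 (`sum_sq_legendreCoef_div_le`). By Cauchy-Schwarz in n, the estimate is reduced to ∑_n (n
+ 1/2)^(-2r) p_n(k) ≤ C max(1, |k|^(2r))⁻¹ (`exists_sum_legendreCoefZero_le`). This follows from the
explicit products of central binomial coefficients, which give p_n(k) ≤ 2 / √((n + 1)² - k²).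
Completeness carries the bound from finite sums to all functions.

Order zero. This is Bessel's inequality on the meridian, where sin ≤ 1, together with Parseval's
identity: by symmetry the half circle carries half of the square integral.

Order one. The Legendre operator factors through d/dθ + ε m / sin θ with ε = ±1. Bessel's inequality
for the images of the q_n bounds ∑ n(n + 1)|c_n|² by the integral of |√sin · g' + m g / √sin|², and
a Hardy inequality controls the second term when g vanishes at the poles
(`sum_eigenvalue_mul_sq_meridianCoef_le`). For m ≠ 0, membership in W_m^1 forces this vanishing: the
series for ε = 1 and ε = -1 both converge, and their difference puts f / √sin in L², whereas 1/θ is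
not integrable at 0. Finally f is approximated by its Fourier partial sums, corrected by affine
functions of cos θ so as to vanish at the poles; the corrections tend to zero. -/

open Polynomial in
/-- The `m`-th derivative of the Legendre polynomial `P_n`, through Rodrigues' formula. -/
def legendreDeriv (n m : ℕ) : Polynomial ℝ :=
  C (1 / (2 ^ n * (n.factorial : ℝ))) * derivative^[m + n] ((X ^ 2 - 1) ^ n)

/-! ### Legendre polynomials: differential equation, value at 1, parity -/

section LegendrePolynomial
open Polynomial

lemma derivative_iterate_derivative (p : ℝ[X]) (j : ℕ) :
    derivative (derivative^[j] p) = derivative^[j + 1] p :=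
  (Function.iterate_succ_apply' derivative j p).symm

lemma derivative_legendreDeriv (n m : ℕ) :
    derivative (legendreDeriv n m) = legendreDeriv n (m + 1) := by
  unfold legendreDeriv
  rw [derivative_C_mul, derivative_iterate_derivative, show m + n + 1 = m + 1 + n by omega]

lemma derivative_X_sq_sub_one : derivative (X ^ 2 - 1 : ℝ[X]) = 2 * X := by
  simp
  norm_num

/-- With u = (X² - 1)^n one has (X² - 1) u' = 2n X u. Differentiating once gives the case j = 0, and
each further differentiation raises j by one. -/
lemma rodrigues_ode (n j : ℕ) :
    (X ^ 2 - 1 : ℝ[X]) * derivative^[j + 2] ((X ^ 2 - 1) ^ n) +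
      2 * ((j : ℝ[X]) + 1) * X * derivative^[j + 1] ((X ^ 2 - 1) ^ n) +
      ((j : ℝ[X]) + 1) * (j : ℝ[X]) * derivative^[j] ((X ^ 2 - 1) ^ n) =
    2 * (n : ℝ[X]) * X * derivative^[j + 1] ((X ^ 2 - 1) ^ n) +
      2 * (n : ℝ[X]) * ((j : ℝ[X]) + 1) * derivative^[j] ((X ^ 2 - 1) ^ n) := by
  induction j with
  | zero =>
    have h : (X ^ 2 - 1 : ℝ[X]) * derivative^[1] ((X ^ 2 - 1 : ℝ[X]) ^ n) =
        2 * (n : ℝ[X]) * X * derivative^[0] ((X ^ 2 - 1) ^ n) := by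
      cases n with
      | zero => simp
      | succ n =>
        rw [Function.iterate_one, Function.iterate_zero_apply, derivative_pow,
          derivative_X_sq_sub_one]
        simp
        ring
    have h2 := congrArg derivative h
    simp only [derivative_mul, derivative_X_sq_sub_one, derivative_X, derivative_natCast,
      derivative_ofNat, derivative_iterate_derivative] at h2
    push_cast
    linear_combination h2
  | succ j ih =>
    have h2 := congrArg derivative ih
    simp only [derivative_mul, derivative_add, derivative_X_sq_sub_one, derivative_X,
      derivative_one, derivative_natCast, derivative_ofNat, derivative_iterate_derivative] at h2
    push_cast
    linear_combination h2

lemma legendreDeriv_ode (n m : ℕ) (x : ℝ) :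
    (1 - x ^ 2) * (legendreDeriv n (m + 2)).eval x =
      2 * (m + 1) * x * (legendreDeriv n (m + 1)).eval x -
        ((n : ℝ) - m) * (n + m + 1) * (legendreDeriv n m).eval x := by
  have h := congrArg (eval x) (rodrigues_ode n (m + n))
  simp only [eval_add, eval_mul, eval_sub, eval_pow, eval_X, eval_one, eval_natCast,
    eval_ofNat] at h
  simp only [legendreDeriv, eval_mul, eval_C]
  rw [show m + 2 + n = m + n + 2 by ring, show m + 1 + n = m + n + 1 by ring]
  push_cast at h
  linear_combination (-(1 / (2 ^ n * (n.factorial : ℝ)))) * h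

lemma legendreDeriv_eq_zero {n m : ℕ} (h : n < m) : legendreDeriv n m = 0 := by
  unfold legendreDeriv
  rw [iterate_derivative_eq_zero, mul_zero]
  have h1 : ((X ^ 2 - 1 : ℝ[X]) ^ n).natDegree ≤ n * 2 := by
    refine natDegree_pow_le_of_le n ?_
    compute_degree
  omega

/-- Each differentiation takes one factor X - a off and replaces the cofactor q by one whose value
at a is a multiple of q(a); hence the induction over all q. -/
lemma eval_iterate_derivative_X_sub_pow_mul (a : ℝ) (n : ℕ) (q : ℝ[X]) :
    (derivative^[n] ((X - C a) ^ n * q)).eval a = n.factorial * q.eval a := by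
  induction n generalizing q with
  | zero => simp
  | succ n ih =>
    rw [Function.iterate_succ_apply]
    have : derivative ((X - C a) ^ (n + 1) * q) =
        (X - C a) ^ n * (((n : ℝ[X]) + 1) * q + (X - C a) * derivative q) := by
      rw [derivative_mul, derivative_pow]
      simp
      ring
    rw [this, ih]
    simp [Nat.factorial_succ]
    ring

lemma legendreDeriv_zero_eval_one (n : ℕ) : (legendreDeriv n 0).eval 1 = 1 := by
  have h : (X ^ 2 - 1 : ℝ[X]) ^ n = (X - C 1) ^ n * (X + 1) ^ n := by
    rw [← mul_pow]; congr 1; simp; ring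
  unfold legendreDeriv
  rw [h, zero_add, eval_mul, eval_iterate_derivative_X_sub_pow_mul]
  have : (n.factorial : ℝ) ≠ 0 := by positivity
  simp
  norm_num
  field_simp

lemma legendreDeriv_eval_neg (n m : ℕ) (x : ℝ) :
    (legendreDeriv n m).eval (-x) = (-1) ^ (m + n) * (legendreDeriv n m).eval x := by
  have key : ∀ j : ℕ, (derivative^[j] ((X ^ 2 - 1 : ℝ[X]) ^ n)).comp (-X) =
      (-1) ^ j * derivative^[j] ((X ^ 2 - 1 : ℝ[X]) ^ n) := by
    intro j
    induction j with
    | zero => simp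
    | succ j ih =>
      have h := congrArg derivative ih
      rw [derivative_comp] at h
      have h3 : derivative ((-1 : ℝ[X]) ^ j) = 0 := by
        rcases neg_one_pow_eq_or ℝ[X] j with h | h <;> simp [h]
      rw [derivative_mul, h3, derivative_neg, derivative_X] at h
      rw [← derivative_iterate_derivative, pow_succ (-1 : ℝ[X]) j]
      linear_combination -h
  have h := congrArg (eval x) (key (m + n))
  simp only [eval_comp, eval_neg, eval_X, eval_mul, eval_pow, eval_one] at h
  simp only [legendreDeriv, eval_mul, eval_C, h]
  ring

end LegendrePolynomial

/-! ### Ladder relations and the addition formula -/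

/-- `sin^m θ · P_n^{(m)}(cos θ)`, the trigonometric polynomial proportional to `Q_n^m`. -/
def trigLegendre (n m : ℕ) (θ : ℝ) : ℝ :=
  Real.sin θ ^ m * (legendreDeriv n m).eval (Real.cos θ)

lemma trigLegendre_eq_zero {n m : ℕ} (h : n < m) (θ : ℝ) : trigLegendre n m θ = 0 := by
  simp [trigLegendre, legendreDeriv_eq_zero h]

lemma hasDerivAt_legendreDeriv_cos (n m : ℕ) (θ : ℝ) :
    HasDerivAt (fun θ => (legendreDeriv n m).eval (Real.cos θ))
      (-Real.sin θ * (legendreDeriv n (m + 1)).eval (Real.cos θ)) θ := by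
  have h := ((legendreDeriv n m).hasDerivAt (Real.cos θ)).comp θ (Real.hasDerivAt_cos θ)
  rw [derivative_legendreDeriv] at h
  exact h.congr_deriv (by ring)

/-- The derivative of `trigLegendre n m`. -/
def trigLegendreDeriv (n m : ℕ) (θ : ℝ) : ℝ :=
  m * Real.sin θ ^ (m - 1) * Real.cos θ * (legendreDeriv n m).eval (Real.cos θ) -
    Real.sin θ ^ (m + 1) * (legendreDeriv n (m + 1)).eval (Real.cos θ)

lemma hasDerivAt_trigLegendre (n m : ℕ) (θ : ℝ) :
    HasDerivAt (trigLegendre n m) (trigLegendreDeriv n m θ) θ := by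
  have h := ((Real.hasDerivAt_sin θ).pow m).mul (hasDerivAt_legendreDeriv_cos n m θ)
  exact h.congr_deriv (by simp only [trigLegendreDeriv, Pi.pow_apply]; ring)

lemma trigLegendreDeriv_zero (n : ℕ) (θ : ℝ) :
    trigLegendreDeriv n 0 θ = -trigLegendre n 1 θ := by
  simp [trigLegendreDeriv, trigLegendre]

/-- The Legendre equation removes the factor cos θ and leaves a lowering and a raising term. In this
form the derivative of the addition formula telescopes. -/
lemma trigLegendreDeriv_succ (n m : ℕ) (θ : ℝ) :
    trigLegendreDeriv n (m + 1) θ =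
      (((n : ℝ) - m) * (n + m + 1) * trigLegendre n m θ - trigLegendre n (m + 2) θ) / 2 := by
  have h := legendreDeriv_ode n m (Real.cos θ)
  have h2 : 1 - Real.cos θ ^ 2 = Real.sin θ ^ 2 := by rw [Real.sin_sq]
  rw [h2] at h
  simp only [trigLegendreDeriv, trigLegendre, Nat.add_sub_cancel]
  push_cast
  linear_combination (-(1/2) * Real.sin θ ^ m) * h

lemma continuous_trigLegendre (n m : ℕ) : Continuous (trigLegendre n m) := by
  unfold trigLegendre; fun_prop

lemma continuous_trigLegendreDeriv (n m : ℕ) : Continuous (trigLegendreDeriv n m) := by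
  unfold trigLegendreDeriv; fun_prop

/-- The weight `(n - m)! / (n + m)!`, doubled for `m ≠ 0`. -/
def addWeight (n m : ℕ) : ℝ :=
  (if m = 0 then 1 else 2) * (((n - m).factorial : ℝ) / ((n + m).factorial : ℝ))

lemma addWeight_pos (n m : ℕ) : 0 < addWeight n m := by
  unfold addWeight; split_ifs <;> positivity

lemma factorial_ratio_succ {n m : ℕ} (h : m < n) :
    ((n - m).factorial : ℝ) / ((n + m).factorial : ℝ) =
      ((n : ℝ) - m) * (n + m + 1) *
        (((n - (m + 1)).factorial : ℝ) / ((n + (m + 1)).factorial : ℝ)) := by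
  obtain ⟨d, rfl⟩ : ∃ d, n = m + 1 + d := ⟨n - (m + 1), by omega⟩
  rw [show m + 1 + d - m = d + 1 by omega, show m + 1 + d - (m + 1) = d by omega,
    show m + 1 + d + (m + 1) = (m + 1 + d + m) + 1 by ring, Nat.factorial_succ, Nat.factorial_succ]
  have : ((m + 1 + d + m).factorial : ℝ) ≠ 0 := by positivity
  have h3 : ((m : ℝ) + 1 + d + m + 1) ≠ 0 := by positivity
  push_cast
  field_simp
  ring

/-- The derivative of the partial sums of the addition formula along the diagonal telescopes. -/
lemma addition_telescope (n : ℕ) (x y : ℝ) (N : ℕ) (hN : N ≤ n) :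
    ∑ m ∈ Finset.range (N + 1), addWeight n m *
        (trigLegendreDeriv n m x * trigLegendre n m y +
          trigLegendre n m x * trigLegendreDeriv n m y) =
      -((n - N).factorial : ℝ) / ((n + N).factorial : ℝ) *
        (trigLegendre n (N + 1) x * trigLegendre n N y +
          trigLegendre n N x * trigLegendre n (N + 1) y) := by
  induction N with
  | zero =>
    simp [addWeight, trigLegendreDeriv_zero]
    have : (n.factorial : ℝ) ≠ 0 := by positivity
    field_simp
    ring
  | succ N ih =>
    rw [Finset.sum_range_succ, ih (by omega)]
    have h := factorial_ratio_succ (n := n) (m := N) (by omega)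
    -- The doubled weight absorbs the 1/2 of the ladder relation. The lowering terms cancel the
    -- previous remainder, and the raising terms form the new one.
    rw [neg_div, neg_div, h, trigLegendreDeriv_succ, trigLegendreDeriv_succ, addWeight,
      if_neg (by omega)]
    ring

/-- The addition formula for the Legendre polynomials, restricted to a great circle. -/
theorem legendre_addition (n : ℕ) (x y : ℝ) :
    ∑ m ∈ Finset.range (n + 1), addWeight n m * (trigLegendre n m x * trigLegendre n m y) =
      trigLegendre n 0 (x - y) := by
  -- The sum is invariant under simultaneous translation of x and y: the telescoped derivative ends
  -- in T_{n+1} = 0.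
  let G : ℝ → ℝ := fun t => ∑ m ∈ Finset.range (n + 1),
    addWeight n m * (trigLegendre n m (x + t) * trigLegendre n m (y + t))
  have hG : ∀ t, HasDerivAt G 0 t := by
    intro t
    have h : HasDerivAt G (∑ m ∈ Finset.range (n + 1), addWeight n m *
        (trigLegendreDeriv n m (x + t) * trigLegendre n m (y + t) +
          trigLegendre n m (x + t) * trigLegendreDeriv n m (y + t))) t := by
      refine HasDerivAt.fun_sum fun m _ => HasDerivAt.const_mul _ ?_
      exact ((hasDerivAt_trigLegendre n m (x + t)).comp_const_add x t).mul
        ((hasDerivAt_trigLegendre n m (y + t)).comp_const_add y t)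
    rw [addition_telescope n _ _ n le_rfl, trigLegendre_eq_zero (Nat.lt_succ_self n),
      trigLegendre_eq_zero (Nat.lt_succ_self n)] at h
    simpa using h
  -- Translation by -y moves the second point to the pole, where only m = 0 survives and P_n(1) = 1.
  have hc : G 0 = G (-y) := is_const_of_deriv_eq_zero (fun t => (hG t).differentiableAt)
    (fun t => (hG t).deriv) 0 (-y)
  simp only [G, add_zero, add_neg_cancel] at hc
  rw [hc, Finset.sum_eq_single 0]
  · have : (n.factorial : ℝ) ≠ 0 := by positivity
    simp [addWeight, trigLegendre, legendreDeriv_zero_eval_one, this, sub_eq_add_neg]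
  · intro m _ hm
    simp [trigLegendre, hm]
  · simp

/-! ### The factorized Legendre operator, orthogonality and normalization -/

/-- `m · sin^{m-1} θ · P_n^{(m)}(cos θ)`, that is `m / sin θ` times `trigLegendre n m θ`. -/
def trigLegendreQuot (n m : ℕ) (θ : ℝ) : ℝ :=
  m * Real.sin θ ^ (m - 1) * (legendreDeriv n m).eval (Real.cos θ)

lemma sin_mul_trigLegendreQuot (n m : ℕ) (θ : ℝ) :
    Real.sin θ * trigLegendreQuot n m θ = m * trigLegendre n m θ := by
  unfold trigLegendreQuot trigLegendre
  cases m with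
  | zero => simp
  | succ m => rw [Nat.add_sub_cancel]; ring

lemma continuous_trigLegendreQuot (n m : ℕ) : Continuous (trigLegendreQuot n m) := by
  unfold trigLegendreQuot; fun_prop

lemma hasDerivAt_sin_mul_trigLegendreDeriv (n m : ℕ) (θ : ℝ) :
    HasDerivAt (fun θ => Real.sin θ * trigLegendreDeriv n m θ)
      (m * trigLegendreQuot n m θ - n * (n + 1) * (Real.sin θ * trigLegendre n m θ)) θ := by
  have hfun : (fun θ => Real.sin θ * trigLegendreDeriv n m θ) = fun θ =>
      m * (Real.sin θ ^ m * (Real.cos θ * (legendreDeriv n m).eval (Real.cos θ))) -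
        Real.sin θ ^ (m + 2) * (legendreDeriv n (m + 1)).eval (Real.cos θ) := by
    funext θ
    have h := sin_mul_trigLegendreQuot n m θ
    unfold trigLegendreQuot trigLegendre at h
    unfold trigLegendreDeriv
    linear_combination Real.cos θ * h
  rw [hfun]
  have h1 := ((((Real.hasDerivAt_sin θ).pow m).mul ((Real.hasDerivAt_cos θ).mul
    (hasDerivAt_legendreDeriv_cos n m θ))).const_mul (m : ℝ)).sub
    (((Real.hasDerivAt_sin θ).pow (m + 2)).mul (hasDerivAt_legendreDeriv_cos n (m + 1) θ))
  refine h1.congr_deriv ?_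
  have ode := legendreDeriv_ode n m (Real.cos θ)
  have h2 : Real.cos θ ^ 2 = 1 - Real.sin θ ^ 2 := by rw [Real.cos_sq']
  have h3 : (1 - Real.cos θ ^ 2) = Real.sin θ ^ 2 := by rw [h2]; ring
  rw [h3] at ode
  have hq := sin_mul_trigLegendreQuot n m θ
  unfold trigLegendreQuot trigLegendre at hq
  simp only [trigLegendreQuot, trigLegendre, Pi.pow_apply, Pi.mul_apply]
  rw [show m + 2 - 1 = m + 1 by omega]
  push_cast
  linear_combination (Real.sin θ ^ (m + 1)) * ode +
    (m * (m * Real.sin θ ^ (m - 1)) * (legendreDeriv n m).eval (Real.cos θ)) * h2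
    - m * Real.sin θ * hq

/-- Green's formula for the factorized Legendre operator. -/
theorem integral_factorized_pairing (n m : ℕ) {ε : ℝ} (hε : ε ^ 2 = 1) {g g' : ℝ → ℂ}
    (hg : ∀ θ, HasDerivAt g (g' θ) θ) (hg' : Continuous g')
    (h0 : m = 0 ∨ (g 0 = 0 ∧ g Real.pi = 0)) :
    ∫ θ in (0 : ℝ)..Real.pi, ((Real.sin θ : ℂ) * g' θ + (ε : ℂ) * m * g θ) *
        ((trigLegendreDeriv n m θ + ε * trigLegendreQuot n m θ : ℝ) : ℂ) =
      (n * (n + 1) : ℂ) *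
        ∫ θ in (0 : ℝ)..Real.pi, g θ * ((trigLegendre n m θ * Real.sin θ : ℝ) : ℂ) := by
  have hgc : Continuous g := continuous_iff_continuousAt.2 fun θ => (hg θ).continuousAt
  have c1 := continuous_trigLegendre n m
  have c2 := continuous_trigLegendreDeriv n m
  have c3 := continuous_trigLegendreQuot n m
  rw [← intervalIntegral.integral_const_mul, ← sub_eq_zero, ← intervalIntegral.integral_sub]
  rotate_left
  · exact Continuous.intervalIntegrable (by fun_prop) _ _
  · exact Continuous.intervalIntegrable (by fun_prop) _ _
  -- The integrands differ by the exact derivative of g · (sin T' + ε m T). The cross terms combine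
  -- into ε m (gT)', and ε² = 1 produces the potential m²/sin. At the poles sin vanishes, and so
  -- does m or g.
  have hd : ∀ θ : ℝ, HasDerivAt (fun θ : ℝ => g θ *
      ((Real.sin θ * trigLegendreDeriv n m θ + ε * m * trigLegendre n m θ : ℝ) : ℂ))
      (((Real.sin θ : ℂ) * g' θ + (ε : ℂ) * m * g θ) *
        ((trigLegendreDeriv n m θ + ε * trigLegendreQuot n m θ : ℝ) : ℂ) -
        (n * (n + 1) : ℂ) * (g θ * ((trigLegendre n m θ * Real.sin θ : ℝ) : ℂ))) θ := by
    intro θ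
    have h1 := ((hasDerivAt_sin_mul_trigLegendreDeriv n m θ).add
      ((hasDerivAt_trigLegendre n m θ).const_mul (ε * m))).ofReal_comp
    refine ((hg θ).mul h1).congr_deriv ?_
    have hq : (Real.sin θ : ℂ) * (trigLegendreQuot n m θ : ℂ) = m * trigLegendre n m θ := by
      exact_mod_cast sin_mul_trigLegendreQuot n m θ
    have he : (ε : ℂ) ^ 2 = 1 := by exact_mod_cast hε
    simp only [Pi.add_apply]
    push_cast at hq ⊢
    linear_combination (-(ε : ℂ) * g' θ) * hq - (m * g θ * trigLegendreQuot n m θ) * he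
  rw [intervalIntegral.integral_eq_sub_of_hasDerivAt (fun θ _ => hd θ)
    (Continuous.intervalIntegrable (by fun_prop) _ _)]
  rcases h0 with h0 | ⟨h0, h1⟩
  · simp [h0]
  · simp [h0, h1]

lemma trigLegendre_boundary (n m : ℕ) :
    m = 0 ∨ (((trigLegendre n m 0 : ℝ) : ℂ) = 0 ∧ ((trigLegendre n m Real.pi : ℝ) : ℂ) = 0) := by
  rcases Nat.eq_zero_or_pos m with h | h
  · exact Or.inl h
  · right; simp [trigLegendre, h.ne']

/-- Green's formula for g = T of degree n'. The left side is symmetric in n and n', which makes the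
eigenfunctions orthogonal. -/
lemma integral_factorized_trigLegendre (n n' m : ℕ) {ε : ℝ} (hε : ε ^ 2 = 1) :
    ∫ θ in (0 : ℝ)..Real.pi, Real.sin θ *
        (trigLegendreDeriv n' m θ + ε * trigLegendreQuot n' m θ) *
        (trigLegendreDeriv n m θ + ε * trigLegendreQuot n m θ) =
      n * (n + 1) *
        ∫ θ in (0 : ℝ)..Real.pi, trigLegendre n' m θ * trigLegendre n m θ * Real.sin θ := by
  have h := integral_factorized_pairing n m hε
    (fun θ => (hasDerivAt_trigLegendre n' m θ).ofReal_comp)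
    (Complex.continuous_ofReal.comp (continuous_trigLegendreDeriv n' m))
    (trigLegendre_boundary n' m)
  have e1 : ∀ θ : ℝ, ((Real.sin θ : ℂ) * (trigLegendreDeriv n' m θ : ℂ) +
      (ε : ℂ) * m * (trigLegendre n' m θ : ℂ)) *
        ((trigLegendreDeriv n m θ + ε * trigLegendreQuot n m θ : ℝ) : ℂ) =
      ((Real.sin θ * (trigLegendreDeriv n' m θ + ε * trigLegendreQuot n' m θ) *
        (trigLegendreDeriv n m θ + ε * trigLegendreQuot n m θ) : ℝ) : ℂ) := by
    intro θ
    have hq : (Real.sin θ : ℂ) * (trigLegendreQuot n' m θ : ℂ) = m * trigLegendre n' m θ := by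
      exact_mod_cast sin_mul_trigLegendreQuot n' m θ
    push_cast at hq ⊢
    linear_combination (-(ε : ℂ) *
      ((trigLegendreDeriv n m θ : ℂ) + ε * trigLegendreQuot n m θ)) * hq
  have e2 : ∀ θ : ℝ, (trigLegendre n' m θ : ℂ) * ((trigLegendre n m θ * Real.sin θ : ℝ) : ℂ) =
      ((trigLegendre n' m θ * trigLegendre n m θ * Real.sin θ : ℝ) : ℂ) := by
    intro θ; push_cast; ring
  simp only [e1, e2] at h
  rw [intervalIntegral.integral_ofReal, intervalIntegral.integral_ofReal] at h
  exact_mod_cast h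

/-- The symmetric form is evaluated with either eigenvalue, and n(n + 1) ≠ n'(n' + 1). -/
theorem integral_trigLegendre_mul_of_ne {n n' : ℕ} (h : n ≠ n') (m : ℕ) :
    ∫ θ in (0 : ℝ)..Real.pi, trigLegendre n m θ * trigLegendre n' m θ * Real.sin θ = 0 := by
  have h1 := integral_factorized_trigLegendre n n' m (ε := 1) (by norm_num)
  have h2 := integral_factorized_trigLegendre n' n m (ε := 1) (by norm_num)
  have e1 : ∀ θ : ℝ, trigLegendre n' m θ * trigLegendre n m θ * Real.sin θ =
      trigLegendre n m θ * trigLegendre n' m θ * Real.sin θ := fun θ => by ring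
  have e2 : ∀ θ : ℝ, Real.sin θ *
        (trigLegendreDeriv n' m θ + 1 * trigLegendreQuot n' m θ) *
        (trigLegendreDeriv n m θ + 1 * trigLegendreQuot n m θ) =
      Real.sin θ *
        (trigLegendreDeriv n m θ + 1 * trigLegendreQuot n m θ) *
        (trigLegendreDeriv n' m θ + 1 * trigLegendreQuot n' m θ) := fun θ => by ring
  simp only [e1] at h1
  simp only [e2] at h1
  rw [h2, ← sub_eq_zero, ← sub_mul] at h1
  refine (mul_eq_zero.1 h1).resolve_left ?_
  have : ((n' : ℝ) * (n' + 1) - n * (n + 1)) = (n' - n) * (n + n' + 1) := by ring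
  rw [this]
  refine mul_ne_zero ?_ (by positivity)
  rw [sub_ne_zero]
  exact_mod_cast h.symm

/-- The function sin · T_m · T_{m+1} vanishes at both poles, and by the Legendre equation its
derivative is the difference of the two integrands. -/
lemma integral_trigLegendre_sq_succ (n m : ℕ) :
    ∫ θ in (0 : ℝ)..Real.pi, trigLegendre n (m + 1) θ ^ 2 * Real.sin θ =
      ((n : ℝ) - m) * (n + m + 1) *
        ∫ θ in (0 : ℝ)..Real.pi, trigLegendre n m θ ^ 2 * Real.sin θ := by
  have c1 := continuous_trigLegendre n m
  have c2 := continuous_trigLegendre n (m + 1)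
  rw [← intervalIntegral.integral_const_mul, eq_comm, ← sub_eq_zero,
    ← intervalIntegral.integral_sub]
  rotate_left
  · exact Continuous.intervalIntegrable (by fun_prop) _ _
  · exact Continuous.intervalIntegrable (by fun_prop) _ _
  have hd : ∀ θ : ℝ, HasDerivAt (fun θ : ℝ => Real.sin θ ^ (2 * m + 2) *
      ((legendreDeriv n m).eval (Real.cos θ) * (legendreDeriv n (m + 1)).eval (Real.cos θ)))
      (((n : ℝ) - m) * (n + m + 1) * (trigLegendre n m θ ^ 2 * Real.sin θ) -
        trigLegendre n (m + 1) θ ^ 2 * Real.sin θ) θ := by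
    intro θ
    refine (((Real.hasDerivAt_sin θ).pow (2 * m + 2)).mul ((hasDerivAt_legendreDeriv_cos n m θ).mul
      (hasDerivAt_legendreDeriv_cos n (m + 1) θ))).congr_deriv ?_
    have ode := legendreDeriv_ode n m (Real.cos θ)
    have h3 : (1 - Real.cos θ ^ 2) = Real.sin θ ^ 2 := by rw [Real.sin_sq]
    rw [h3] at ode
    simp only [trigLegendre, Pi.pow_apply, Pi.mul_apply]
    rw [show 2 * m + 2 - 1 = 2 * m + 1 by omega]
    push_cast
    linear_combination (-Real.sin θ ^ (2 * m + 1) * (legendreDeriv n m).eval (Real.cos θ)) * ode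
  rw [intervalIntegral.integral_eq_sub_of_hasDerivAt (fun θ _ => hd θ)
    (Continuous.intervalIntegrable (by fun_prop) _ _)]
  simp

lemma factorial_ratio_mul_integral_sq (n m : ℕ) (hm : m ≤ n) :
    ((n - m).factorial : ℝ) / ((n + m).factorial : ℝ) *
        ∫ θ in (0 : ℝ)..Real.pi, trigLegendre n m θ ^ 2 * Real.sin θ =
      ∫ θ in (0 : ℝ)..Real.pi, trigLegendre n 0 θ ^ 2 * Real.sin θ := by
  induction m with
  | zero =>
    have : (n.factorial : ℝ) ≠ 0 := by positivity
    simp [this]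
  | succ m ih =>
    rw [← ih (by omega), integral_trigLegendre_sq_succ, factorial_ratio_succ (by omega : m < n)]
    ring

/-- On the diagonal the addition formula reads ∑ w_m T_m² = 1. Integrated against sin it gives 2 on
the right. On the left, m = 0 contributes ∫ P_n² once and each of the n other orders contributes it
twice, 2n + 1 times in all. -/
lemma integral_trigLegendre_zero_sq (n : ℕ) :
    (2 * (n : ℝ) + 1) / 2 *
      ∫ θ in (0 : ℝ)..Real.pi, trigLegendre n 0 θ ^ 2 * Real.sin θ = 1 := by
  have h : ∫ θ in (0 : ℝ)..Real.pi, ∑ m ∈ Finset.range (n + 1),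
      addWeight n m * (trigLegendre n m θ ^ 2 * Real.sin θ) = 2 := by
    have : ∀ θ : ℝ, ∑ m ∈ Finset.range (n + 1),
        addWeight n m * (trigLegendre n m θ ^ 2 * Real.sin θ) = Real.sin θ := by
      intro θ
      have h := legendre_addition n θ θ
      rw [sub_self] at h
      have h1 : trigLegendre n 0 0 = 1 := by simp [trigLegendre, legendreDeriv_zero_eval_one]
      rw [h1] at h
      calc _ = (∑ m ∈ Finset.range (n + 1),
            addWeight n m * (trigLegendre n m θ * trigLegendre n m θ)) * Real.sin θ := by
            rw [Finset.sum_mul]; refine Finset.sum_congr rfl fun m _ => by ring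
        _ = Real.sin θ := by rw [h, one_mul]
    simp only [this, integral_sin]
    norm_num
  have c := continuous_trigLegendre n
  rw [intervalIntegral.integral_finsetSum] at h
  rotate_left
  · intro m _
    have := c m
    exact Continuous.intervalIntegrable (by fun_prop) _ _
  have h2 : ∀ m ∈ Finset.range (n + 1),
      (∫ θ in (0 : ℝ)..Real.pi, addWeight n m * (trigLegendre n m θ ^ 2 * Real.sin θ)) =
      (if m = 0 then 1 else 2) *
        ∫ θ in (0 : ℝ)..Real.pi, trigLegendre n 0 θ ^ 2 * Real.sin θ := by
    intro m hm
    rw [intervalIntegral.integral_const_mul, addWeight, mul_assoc,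
      factorial_ratio_mul_integral_sq n m (by simpa [Nat.lt_succ_iff] using hm)]
  rw [Finset.sum_congr rfl h2, ← Finset.sum_mul, Finset.sum_range_succ'] at h
  simp at h
  linarith

/-- The normalization constant of `Q_n^m`. -/
def legendreNorm (n m : ℕ) : ℝ :=
  Real.sqrt ((2 * (n : ℝ) + 1) / 2 * (((n - m).factorial : ℝ) / ((n + m).factorial : ℝ)))

lemma legendreNorm_sq (n m : ℕ) : legendreNorm n m ^ 2 =
    (2 * (n : ℝ) + 1) / 2 * (((n - m).factorial : ℝ) / ((n + m).factorial : ℝ)) :=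
  Real.sq_sqrt (by positivity)

/-- `(-1)^m Q_n^m`, continued from `[0, π]` to the real line as a trigonometric polynomial. -/
def trigQ (n m : ℕ) (θ : ℝ) : ℝ := legendreNorm n m * trigLegendre n m θ

lemma continuous_trigQ (n m : ℕ) : Continuous (trigQ n m) :=
  continuous_const.mul (continuous_trigLegendre n m)

lemma Q_eq_trigQ (n : ℕ) (m : ℤ) {θ : ℝ} (hθ : θ ∈ Set.Icc 0 Real.pi) :
    Q n m θ = (-1) ^ m.natAbs * trigQ n m.natAbs θ := by
  have h : Real.sqrt (1 - Real.cos θ ^ 2) = Real.sin θ := by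
    rw [← Real.sin_sq, Real.sqrt_sq (Real.sin_nonneg_of_nonneg_of_le_pi hθ.1 hθ.2)]
  simp only [Q, assocLegendre, trigQ, legendreNorm, trigLegendre, legendreDeriv, h,
    Polynomial.eval_mul, Polynomial.eval_C]
  ring

theorem integral_trigQ_mul {n n' m : ℕ} (hn : m ≤ n) :
    ∫ θ in (0 : ℝ)..Real.pi, trigQ n m θ * trigQ n' m θ * Real.sin θ =
      if n = n' then 1 else 0 := by
  have e : ∀ θ : ℝ, trigQ n m θ * trigQ n' m θ * Real.sin θ =
      legendreNorm n m * legendreNorm n' m *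
        (trigLegendre n m θ * trigLegendre n' m θ * Real.sin θ) := by
    intro θ; simp only [trigQ]; ring
  simp only [e]
  rw [intervalIntegral.integral_const_mul]
  split_ifs with h
  · subst h
    simp only [← sq]
    rw [legendreNorm_sq, mul_assoc, factorial_ratio_mul_integral_sq n m hn,
      integral_trigLegendre_zero_sq]
  · rw [integral_trigLegendre_mul_of_ne h, mul_zero]

/-- `√sin` times the image of `trigQ n m` under `d/dθ + ε m / sin θ`. -/
def factorQ (ε : ℝ) (n m : ℕ) (θ : ℝ) : ℝ :=
  Real.sqrt (Real.sin θ) *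
    (legendreNorm n m * (trigLegendreDeriv n m θ + ε * trigLegendreQuot n m θ))

lemma continuous_factorQ (ε : ℝ) (n m : ℕ) : Continuous (factorQ ε n m) := by
  have c2 := continuous_trigLegendreDeriv n m
  have c3 := continuous_trigLegendreQuot n m
  unfold factorQ; fun_prop

theorem integral_factorQ_mul {n n' m : ℕ} (hn : m ≤ n) {ε : ℝ} (hε : ε ^ 2 = 1) :
    ∫ θ in (0 : ℝ)..Real.pi, factorQ ε n m θ * factorQ ε n' m θ =
      if n = n' then (n : ℝ) * (n + 1) else 0 := by
  have e : Set.EqOn (fun θ => factorQ ε n m θ * factorQ ε n' m θ)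
      (fun θ => legendreNorm n m * legendreNorm n' m * (Real.sin θ *
        (trigLegendreDeriv n m θ + ε * trigLegendreQuot n m θ) *
        (trigLegendreDeriv n' m θ + ε * trigLegendreQuot n' m θ))) (Set.uIcc 0 Real.pi) := by
    intro θ hθ
    rw [Set.uIcc_of_le Real.pi_pos.le] at hθ
    have h := Real.mul_self_sqrt (Real.sin_nonneg_of_nonneg_of_le_pi hθ.1 hθ.2)
    simp only [factorQ]
    linear_combination (legendreNorm n m * legendreNorm n' m *
        (trigLegendreDeriv n m θ + ε * trigLegendreQuot n m θ) *
        (trigLegendreDeriv n' m θ + ε * trigLegendreQuot n' m θ)) * h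
  have h2 := integral_trigQ_mul (n := n) (n' := n') (m := m) hn
  have e' : ∀ θ : ℝ, trigQ n m θ * trigQ n' m θ * Real.sin θ =
      legendreNorm n m * legendreNorm n' m *
        (trigLegendre n m θ * trigLegendre n' m θ * Real.sin θ) := by
    intro θ; simp only [trigQ]; ring
  simp only [e'] at h2
  rw [intervalIntegral.integral_const_mul] at h2
  rw [intervalIntegral.integral_congr e, intervalIntegral.integral_const_mul,
    integral_factorized_trigLegendre n' n m hε]
  split_ifs at h2 ⊢ with h
  · subst h; linear_combination ((n : ℝ) * (n + 1)) * h2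
  · linear_combination ((n' : ℝ) * (n' + 1)) * h2

/-- Green's formula: testing against `factorQ` multiplies the coefficient by `n (n + 1)`. -/
theorem integral_pairing_factorQ (n m : ℕ) {ε : ℝ} (hε : ε ^ 2 = 1) {g g' : ℝ → ℂ}
    (hg : ∀ θ, HasDerivAt g (g' θ) θ) (hg' : Continuous g')
    (h0 : m = 0 ∨ (g 0 = 0 ∧ g Real.pi = 0)) :
    ∫ θ in (0 : ℝ)..Real.pi, ((Real.sqrt (Real.sin θ) : ℂ) * g' θ +
        (ε : ℂ) * m * (g θ / (Real.sqrt (Real.sin θ) : ℂ))) * (factorQ ε n m θ : ℂ) =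
      (n * (n + 1) : ℂ) *
        ∫ θ in (0 : ℝ)..Real.pi, g θ * ((trigQ n m θ * Real.sin θ : ℝ) : ℂ) := by
  have h := integral_factorized_pairing n m hε hg hg' h0
  have e : ∀ θ : ℝ, g θ * ((trigQ n m θ * Real.sin θ : ℝ) : ℂ) = (legendreNorm n m : ℂ) *
      (g θ * ((trigLegendre n m θ * Real.sin θ : ℝ) : ℂ)) := by
    intro θ; simp only [trigQ]; push_cast; ring
  simp only [e]
  rw [intervalIntegral.integral_const_mul, mul_left_comm, ← h,
    ← intervalIntegral.integral_const_mul]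
  -- The open interval is needed: the division by √sin is genuine only where sin > 0.
  rw [intervalIntegral.integral_of_le Real.pi_pos.le, intervalIntegral.integral_of_le
    Real.pi_pos.le, integral_Ioc_eq_integral_Ioo, integral_Ioc_eq_integral_Ioo]
  refine setIntegral_congr_fun measurableSet_Ioo fun θ hθ => ?_
  have hs := Real.sin_pos_of_pos_of_lt_pi hθ.1 hθ.2
  have h1 : ((Real.sqrt (Real.sin θ) : ℝ) : ℂ) * (Real.sqrt (Real.sin θ) : ℝ) =
      (Real.sin θ : ℝ) := by
    exact_mod_cast Real.mul_self_sqrt hs.le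
  have h2 : ((Real.sqrt (Real.sin θ) : ℝ) : ℂ) ≠ 0 := by
    exact_mod_cast (Real.sqrt_pos.2 hs).ne'
  simp only [factorQ]
  rw [← h1]
  push_cast
  field_simp

/-! ### Bessel's inequality -/

section Bessel
variable {E ι : Type*} [NormedAddCommGroup E] [InnerProductSpace ℂ E] [DecidableEq ι]

/-- Bessel's inequality for an orthogonal family that need not be normalized. -/
theorem bessel_of_orthogonal {v : ι → E} {lam : ι → ℝ}
    (hv : ∀ i j, inner ℂ (v i) (v j) = if i = j then (lam i : ℂ) else 0) (u : E) (I : Finset ι) :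
    ∑ i ∈ I, ‖inner ℂ (v i) u‖ ^ 2 / lam i ≤ ‖u‖ ^ 2 := by
  set B : ℝ := ∑ i ∈ I, ‖inner ℂ (v i) u‖ ^ 2 / lam i with hB
  -- The projection of u on the span. Indices with lam i = 0 drop out, since division by zero gives
  -- zero on both sides.
  let s : E := ∑ i ∈ I, (inner ℂ (v i) u / lam i : ℂ) • v i
  have h1 : inner ℂ u s = (B : ℂ) := by
    simp only [s, inner_sum, inner_smul_right, hB, Complex.ofReal_sum]
    refine Finset.sum_congr rfl fun i _ => ?_
    rw [← inner_conj_symm u (v i), div_mul_eq_mul_div, Complex.mul_conj, Complex.normSq_eq_norm_sq]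
    push_cast
    rfl
  have h2 : inner ℂ s s = (B : ℂ) := by
    have : ∀ i ∈ I, inner ℂ (v i) s = inner ℂ (v i) u * (lam i / lam i) := by
      intro i hi
      simp only [s, inner_sum, inner_smul_right, hv]
      rw [Finset.sum_eq_single i]
      · simp only [if_true]; ring
      · intro j _ hj; rw [if_neg hj.symm, mul_zero]
      · exact fun h => absurd hi h
    calc inner ℂ s s = ∑ i ∈ I, (starRingEnd ℂ) (inner ℂ (v i) u / lam i : ℂ) *
          inner ℂ (v i) s := by
          conv_lhs => rw [show s = ∑ i ∈ I, (inner ℂ (v i) u / lam i : ℂ) • v i from rfl]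
          rw [sum_inner]
          refine Finset.sum_congr rfl fun i _ => ?_
          rw [inner_smul_left]
      _ = (B : ℂ) := by
          rw [hB, Complex.ofReal_sum]
          refine Finset.sum_congr rfl fun i hi => ?_
          rw [this i hi, map_div₀, Complex.conj_ofReal]
          have h3 := Complex.conj_mul' (inner ℂ (v i) u)
          push_cast
          by_cases hl : (lam i : ℂ) = 0
          · simp [hl]
          · rw [div_self hl, mul_one, div_mul_eq_mul_div, h3]
  have h3 := norm_sub_sq (𝕜 := ℂ) u s
  rw [h1] at h3
  have h4 : ‖s‖ ^ 2 = B := by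
    have := inner_self_eq_norm_sq_to_K (𝕜 := ℂ) s
    rw [h2] at this
    have h5 : ((‖s‖ ^ 2 : ℝ) : ℂ) = B := by push_cast; exact this.symm
    exact Complex.ofReal_injective h5
  rw [h4] at h3
  simp at h3
  nlinarith [sq_nonneg ‖u - s‖]

end Bessel

/-! ### Rules for Fourier coefficients -/

section FourierCoef

lemma fourierCoef_eq_fourierCoeffOn (f : ℝ → ℂ) (k : ℤ) :
    fourierCoef f k = fourierCoeffOn Real.two_pi_pos f k := by
  rw [fourierCoeffOn_eq_integral, fourierCoef, sub_zero, Complex.real_smul]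
  push_cast
  congr 1
  refine intervalIntegral.integral_congr fun θ _ => ?_
  simp only [smul_eq_mul]
  rw [fourier_coe_apply, mul_comm]
  congr 2
  have : (Real.pi : ℂ) ≠ 0 := by exact_mod_cast Real.pi_ne_zero
  push_cast
  field_simp

/-- Parseval's identity. -/
theorem hasSum_sq_fourierCoef {f : ℝ → ℂ}
    (hf : MemLp f 2 (volume.restrict (Set.Ioc 0 (2 * Real.pi)))) :
    HasSum (fun k => ‖fourierCoef f k‖ ^ 2)
      ((2 * Real.pi)⁻¹ * ∫ θ in (0 : ℝ)..(2 * Real.pi), ‖f θ‖ ^ 2) := by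
  have h := hasSum_sq_fourierCoeffOn Real.two_pi_pos hf
  simpa [fourierCoef_eq_fourierCoeffOn] using h

lemma Continuous.memLp_two_restrict {f : ℝ → ℂ} (hf : Continuous f) (a b : ℝ) :
    MemLp f 2 (volume.restrict (Set.Ioc a b)) := by
  obtain ⟨C, hC⟩ := (isCompact_Icc (a := a) (b := b)).exists_bound_of_continuousOn hf.continuousOn
  refine MemLp.of_bound hf.aestronglyMeasurable C ?_
  filter_upwards [ae_restrict_mem measurableSet_Ioc] with x hx
  exact hC x (Set.Ioc_subset_Icc_self hx)

lemma exp_neg_int_two_pi (k : ℤ) :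
    Complex.exp (-(Complex.I * (k : ℂ) * ((2 * Real.pi : ℝ) : ℂ))) = 1 := by
  rw [Complex.exp_eq_one_iff]
  exact ⟨-k, by push_cast; ring⟩

lemma periodic_exp_int (k : ℤ) : Function.Periodic
    (fun θ : ℝ => Complex.exp (-(Complex.I * (k : ℂ) * (θ : ℂ)))) (2 * Real.pi) := by
  intro θ
  have := exp_neg_int_two_pi k
  simp only
  rw [Complex.ofReal_add, mul_add, neg_add, Complex.exp_add, this, mul_one]

lemma hasDerivAt_exp_int (c : ℂ) (θ : ℝ) :
    HasDerivAt (fun θ : ℝ => Complex.exp (c * (θ : ℂ))) (c * Complex.exp (c * θ)) θ := by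
  have h := ((Complex.ofRealCLM.hasDerivAt (x := θ)).const_mul c).cexp
  simp at h
  exact h.congr_deriv (by ring)

lemma fourierCoef_add {f g : ℝ → ℂ} (hf : Continuous f) (hg : Continuous g) (k : ℤ) :
    fourierCoef (fun θ => f θ + g θ) k = fourierCoef f k + fourierCoef g k := by
  simp only [fourierCoef, add_mul]
  rw [intervalIntegral.integral_add, mul_add] <;>
  exact Continuous.intervalIntegrable (by fun_prop) _ _

lemma fourierCoef_const_mul (c : ℂ) (f : ℝ → ℂ) (k : ℤ) :
    fourierCoef (fun θ => c * f θ) k = c * fourierCoef f k := by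
  simp only [fourierCoef, mul_assoc]
  rw [intervalIntegral.integral_const_mul]
  ring

lemma fourierCoef_finset_sum {ι : Type*} (s : Finset ι) (c : ι → ℂ) {f : ι → ℝ → ℂ}
    (hf : ∀ i, Continuous (f i)) (k : ℤ) :
    fourierCoef (fun θ => ∑ i ∈ s, c i * f i θ) k = ∑ i ∈ s, c i * fourierCoef (f i) k := by
  simp only [← fourierCoef_const_mul]
  simp only [fourierCoef, Finset.sum_mul]
  rw [intervalIntegral.integral_finsetSum, Finset.mul_sum]
  intro i _
  have := hf i
  exact Continuous.intervalIntegrable (by fun_prop) _ _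

lemma fourierCoef_exp_mul (f : ℝ → ℂ) (j k : ℤ) :
    fourierCoef (fun θ => Complex.exp (Complex.I * (j : ℂ) * (θ : ℂ)) * f θ) k =
      fourierCoef f (k - j) := by
  simp only [fourierCoef]
  congr 1
  refine intervalIntegral.integral_congr fun θ _ => ?_
  rw [mul_comm (Complex.exp _), mul_assoc, ← Complex.exp_add]
  congr 2
  push_cast
  ring

lemma fourierCoef_deriv {f f' : ℝ → ℂ} (hf : ∀ θ, HasDerivAt f (f' θ) θ) (hf' : Continuous f')
    (hp : f (2 * Real.pi) = f 0) (k : ℤ) :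
    fourierCoef f' k = Complex.I * k * fourierCoef f k := by
  have hfc : Continuous f := continuous_iff_continuousAt.2 fun θ => (hf θ).continuousAt
  have h := intervalIntegral.integral_eq_sub_of_hasDerivAt (a := 0) (b := 2 * Real.pi)
    (f := fun θ : ℝ => f θ * Complex.exp (-(Complex.I * (k : ℂ)) * (θ : ℂ)))
    (fun θ _ => (hf θ).mul (hasDerivAt_exp_int _ θ))
    (Continuous.intervalIntegrable (by fun_prop) _ _)
  have e := exp_neg_int_two_pi k
  rw [← neg_mul] at e
  rw [e, hp] at h
  simp only [Complex.ofReal_zero, mul_zero, Complex.exp_zero, sub_self] at h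
  rw [intervalIntegral.integral_add (Continuous.intervalIntegrable (by fun_prop) _ _)
    (Continuous.intervalIntegrable (by fun_prop) _ _)] at h
  have e2 : ∀ θ : ℝ, f θ * (-(Complex.I * (k : ℂ)) * Complex.exp (-(Complex.I * (k : ℂ)) * θ)) =
      -(Complex.I * (k : ℂ)) * (f θ * Complex.exp (-(Complex.I * (k : ℂ)) * θ)) :=
    fun θ => by ring
  simp only [e2] at h
  rw [intervalIntegral.integral_const_mul] at h
  simp only [fourierCoef, ← neg_mul (Complex.I * (k : ℂ))]
  linear_combination (1 / (2 * (Real.pi : ℂ))) * h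

lemma fourierCoef_sin_mul {f : ℝ → ℂ} (hf : Continuous f) (k : ℤ) :
    fourierCoef (fun θ => (Real.sin θ : ℂ) * f θ) k =
      (fourierCoef f (k - 1) - fourierCoef f (k + 1)) / (2 * Complex.I) := by
  have e : ∀ θ : ℝ, (Real.sin θ : ℂ) * f θ =
      (1 / (2 * Complex.I)) * (Complex.exp (Complex.I * ((1 : ℤ) : ℂ) * (θ : ℂ)) * f θ) +
      (-1 / (2 * Complex.I)) * (Complex.exp (Complex.I * ((-1 : ℤ) : ℂ) * (θ : ℂ)) * f θ) := by
    intro θ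
    have hI := Complex.I_ne_zero
    rw [Complex.ofReal_sin, Complex.sin]
    push_cast
    rw [show Complex.I * 1 * (θ : ℂ) = θ * Complex.I by ring,
      show Complex.I * -1 * (θ : ℂ) = -θ * Complex.I by ring]
    field_simp
    rw [Complex.I_sq]
    ring
  simp only [e]
  rw [fourierCoef_add (by fun_prop) (by fun_prop), fourierCoef_const_mul, fourierCoef_const_mul,
    fourierCoef_exp_mul, fourierCoef_exp_mul, sub_neg_eq_add]
  ring

lemma fourierCoef_shift {f : ℝ → ℂ} (hp : Function.Periodic f (2 * Real.pi)) (a : ℝ)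
    (k : ℤ) :
    fourierCoef (fun θ => f (θ + a)) k =
      Complex.exp (Complex.I * k * a) * fourierCoef f k := by
  simp only [fourierCoef]
  have e : ∀ θ : ℝ, f (θ + a) * Complex.exp (-(Complex.I * (k : ℂ) * (θ : ℂ))) =
      (fun t : ℝ => Complex.exp (Complex.I * k * a) *
        (f t * Complex.exp (-(Complex.I * (k : ℂ) * (t : ℂ))))) (θ + a) := by
    intro θ
    simp only
    rw [mul_left_comm, ← Complex.exp_add]
    congr 2
    push_cast
    ring
  simp only [e]
  rw [intervalIntegral.integral_comp_add_right (fun t : ℝ => Complex.exp (Complex.I * k * a) *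
        (f t * Complex.exp (-(Complex.I * (k : ℂ) * (t : ℂ))))),
    intervalIntegral.integral_const_mul]
  have h2 : Function.Periodic (fun t : ℝ => f t * Complex.exp (-(Complex.I * (k : ℂ) * (t : ℂ))))
      (2 * Real.pi) := hp.mul (periodic_exp_int k)
  have h3 := h2.intervalIntegral_add_eq a 0
  rw [zero_add, add_comm (2 * Real.pi) a, h3, zero_add]
  ring

lemma fourierCoef_ofReal_neg (f : ℝ → ℝ) (k : ℤ) :
    fourierCoef (fun θ => (f θ : ℂ)) (-k) =
      (starRingEnd ℂ) (fourierCoef (fun θ => (f θ : ℂ)) k) := by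
  simp only [fourierCoef, map_mul]
  congr 1
  · simp [Complex.conj_ofNat]
  · rw [intervalIntegral.integral_of_le Real.two_pi_pos.le,
      intervalIntegral.integral_of_le Real.two_pi_pos.le, ← integral_conj]
    refine integral_congr_ae (ae_of_all _ fun θ => ?_)
    simp [← Complex.exp_conj]

lemma fourierCoef_exp (j k : ℤ) :
    fourierCoef (fun θ => Complex.exp (Complex.I * (j : ℂ) * (θ : ℂ))) k =
      if j = k then 1 else 0 := by
  have hpi : (Real.pi : ℂ) ≠ 0 := by exact_mod_cast Real.pi_ne_zero
  split_ifs with h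
  · subst h
    simp only [fourierCoef, ← Complex.exp_add, add_neg_cancel, Complex.exp_zero]
    simp
    field_simp
  -- Differentiation multiplies the exponential by i j and its k-th coefficient by i k; for j ≠ k
  -- this forces the coefficient to vanish.
  · have h1 := fourierCoef_deriv (k := k)
      (fun θ => hasDerivAt_exp_int (Complex.I * (j : ℂ)) θ) (by fun_prop)
      (by
        have := exp_neg_int_two_pi (-j)
        push_cast at this ⊢
        simp only [mul_neg, neg_mul, neg_neg] at this
        rw [this]; simp)
    rw [fourierCoef_const_mul] at h1
    have h2 : (Complex.I * ((j : ℂ) - k)) * fourierCoef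
        (fun θ => Complex.exp (Complex.I * (j : ℂ) * (θ : ℂ))) k = 0 := by
      linear_combination h1
    refine (mul_eq_zero.1 h2).resolve_left (mul_ne_zero Complex.I_ne_zero ?_)
    rw [sub_ne_zero]
    exact_mod_cast h

/-- Pointwise Fourier inversion for a continuous periodic function with summable coefficients. -/
theorem hasSum_fourierCoef_of_continuous {f : ℝ → ℂ} (hf : Continuous f)
    (hp : Function.Periodic f (2 * Real.pi)) (hs : Summable (fourierCoef f)) (θ : ℝ) :
    HasSum (fun k : ℤ => fourierCoef f k * Complex.exp (Complex.I * k * θ)) (f θ) := by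
  have : Fact (0 < 2 * Real.pi) := ⟨Real.two_pi_pos⟩
  let F : C(AddCircle (2 * Real.pi), ℂ) := ⟨hp.lift, continuous_coinduced_dom.2 hf⟩
  have hcoef : ∀ k, fourierCoeff F k = fourierCoef f k := by
    intro k
    rw [fourierCoeff_eq_intervalIntegral F k 0, fourierCoef, zero_add, Complex.real_smul]
    push_cast
    congr 1
    refine intervalIntegral.integral_congr fun θ _ => ?_
    simp only [smul_eq_mul, F, ContinuousMap.coe_mk, Function.Periodic.lift_coe]
    rw [fourier_coe_apply, mul_comm]
    congr 2
    have : (Real.pi : ℂ) ≠ 0 := by exact_mod_cast Real.pi_ne_zero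
    push_cast
    field_simp
  have h := has_pointwise_sum_fourier_series_of_summable (f := F)
    (by rw [show fourierCoeff F = fourierCoef f from funext hcoef]; exact hs) (θ : AddCircle _)
  simp only [hcoef, smul_eq_mul] at h
  have e : ∀ k : ℤ, fourier k (θ : AddCircle (2 * Real.pi)) = Complex.exp (Complex.I * k * θ) := by
    intro k
    rw [fourier_coe_apply]
    congr 1
    have : (Real.pi : ℂ) ≠ 0 := by exact_mod_cast Real.pi_ne_zero
    push_cast
    field_simp
  simpa only [e, F, ContinuousMap.coe_mk, Function.Periodic.lift_coe] using h

end FourierCoef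

/-! ### The Fourier coefficients of P_n(cos θ) -/

/-- `C(2j, j) / 4^j`. -/
def binomRatio (j : ℕ) : ℝ := (j.centralBinom : ℝ) / 4 ^ j

lemma binomRatio_zero : binomRatio 0 = 1 := by simp [binomRatio]

lemma binomRatio_pos (j : ℕ) : 0 < binomRatio j := by
  have := Nat.centralBinom_pos j
  unfold binomRatio; positivity

lemma binomRatio_succ (j : ℕ) :
    (2 * (j : ℝ) + 2) * binomRatio (j + 1) = (2 * j + 1) * binomRatio j := by
  have h : ((j : ℝ) + 1) * ((j + 1).centralBinom : ℝ) = 2 * (2 * j + 1) * (j.centralBinom : ℝ) := by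
    exact_mod_cast Nat.succ_mul_centralBinom_succ j
  unfold binomRatio
  rw [pow_succ]
  field_simp
  linear_combination 2 * h

/-- Rational substitutes for Wallis' asymptotics. They pass through the induction because the
squared ratio ((2j + 1)/(2j + 2))² lies between (4j + 1)/(4j + 5) and (2j + 1)/(2j + 3). -/
lemma binomRatio_sq_bounds (j : ℕ) :
    1 / (4 * (j : ℝ) + 1) ≤ binomRatio j ^ 2 ∧ binomRatio j ^ 2 ≤ 1 / (2 * (j : ℝ) + 1) := by
  induction j with
  | zero => simp [binomRatio_zero]
  | succ j ih =>
    have h := binomRatio_succ j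
    have h1 : binomRatio (j + 1) = (2 * j + 1) / (2 * j + 2) * binomRatio j := by
      field_simp; linear_combination h
    have hj : (0 : ℝ) ≤ j := Nat.cast_nonneg j
    rw [h1, mul_pow]
    push_cast
    constructor
    · calc 1 / (4 * ((j : ℝ) + 1) + 1) ≤ ((2 * j + 1) / (2 * j + 2)) ^ 2 * (1 / (4 * j + 1)) := by
            rw [div_pow, div_mul_div_comm, div_le_div_iff₀ (by positivity) (by positivity)]
            nlinarith
        _ ≤ _ := by gcongr; exact ih.1
    · calc _ ≤ ((2 * (j : ℝ) + 1) / (2 * j + 2)) ^ 2 * (1 / (2 * j + 1)) := by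
            gcongr; exact ih.2
        _ ≤ _ := by
            rw [div_pow, div_mul_div_comm, div_le_div_iff₀ (by positivity) (by positivity)]
            nlinarith

/-- `∑_{j ≤ n} C(2j, j) C(2(n-j), n-j) / 4^n`. -/
def binomRatioConv (n : ℕ) : ℝ := ∑ j ∈ Finset.range (n + 1), binomRatio j * binomRatio (n - j)

/-- The sum is classically equal to 1, but a lower bound is enough. By the mean inequality (4j +
1)(4(n - j) + 1) ≤ (2n + 1)², so each of the n + 1 terms is at least 1/(2n + 1). -/
lemma half_le_binomRatioConv (n : ℕ) : 1 / 2 ≤ binomRatioConv n := by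
  have h : ∀ j ∈ Finset.range (n + 1), 1 / (2 * (n : ℝ) + 1) ≤
      binomRatio j * binomRatio (n - j) := by
    intro j hj
    have hj' : j ≤ n := by simpa [Nat.lt_succ_iff] using hj
    have hc : ((n - j : ℕ) : ℝ) = n - j := by push_cast [hj']; ring
    have h1 := (binomRatio_sq_bounds j).1
    have h2 := (binomRatio_sq_bounds (n - j)).1
    rw [hc] at h2
    have hjn : (j : ℝ) ≤ n := by exact_mod_cast hj'
    have hj0 : (0 : ℝ) ≤ j := Nat.cast_nonneg j
    have p1 := binomRatio_pos j
    have p2 := binomRatio_pos (n - j)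
    refine le_of_sq_le_sq ?_ (by positivity)
    calc (1 / (2 * (n : ℝ) + 1)) ^ 2 ≤ 1 / (4 * j + 1) * (1 / (4 * (n - j) + 1)) := by
          rw [div_pow, div_mul_div_comm, one_pow, one_mul]
          have : 0 < 4 * ((n : ℝ) - j) + 1 := by linarith
          apply one_div_le_one_div_of_le (by positivity)
          nlinarith [sq_nonneg ((n : ℝ) - 2 * j)]
      _ ≤ binomRatio j ^ 2 * binomRatio (n - j) ^ 2 := by
          have : 0 < 4 * ((n : ℝ) - j) + 1 := by linarith
          gcongr
      _ = _ := by ring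
  calc (1 : ℝ) / 2 ≤ ((n : ℝ) + 1) * (1 / (2 * n + 1)) := by
        rw [mul_one_div, div_le_div_iff₀ (by positivity) (by positivity)]
        linarith
    _ ≤ _ := by
        have := Finset.card_nsmul_le_sum _ _ _ h
        simpa [binomRatioConv] using this

lemma trigLegendre_add_pi (n m : ℕ) (θ : ℝ) :
    trigLegendre n m (θ + Real.pi) = (-1) ^ n * trigLegendre n m θ := by
  simp only [trigLegendre, Real.sin_add_pi, Real.cos_add_pi, legendreDeriv_eval_neg]
  rw [neg_pow, pow_add]
  have : ((-1 : ℝ) ^ m) * (-1) ^ m = 1 := by rw [← mul_pow]; simp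
  linear_combination (Real.sin θ ^ m * (-1) ^ n *
    (legendreDeriv n m).eval (Real.cos θ)) * this

lemma trigLegendre_neg (n m : ℕ) (θ : ℝ) :
    trigLegendre n m (-θ) = (-1) ^ m * trigLegendre n m θ := by
  simp only [trigLegendre, Real.sin_neg, Real.cos_neg]
  rw [neg_pow]
  ring

lemma periodic_trigLegendre (n m : ℕ) : Function.Periodic (trigLegendre n m) (2 * Real.pi) := by
  intro θ; simp [trigLegendre]

/-- The Fourier coefficients of `trigLegendre n m`. -/
def legendreCoef (n m : ℕ) (k : ℤ) : ℂ := fourierCoef (fun θ => (trigLegendre n m θ : ℂ)) k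

lemma continuous_ofReal_trigLegendre (n m : ℕ) :
    Continuous fun θ : ℝ => (trigLegendre n m θ : ℂ) :=
  Complex.continuous_ofReal.comp (continuous_trigLegendre n m)

lemma legendreCoef_neg (n m : ℕ) (k : ℤ) :
    legendreCoef n m (-k) = (starRingEnd ℂ) (legendreCoef n m k) :=
  fourierCoef_ofReal_neg _ k

/-- Coefficient of order k + 1 in the equation (sin T')' = -n(n + 1) sin T. Multiplication by sin
couples the orders k and k + 2 only. -/
lemma legendreCoef_recurrence (n : ℕ) (k : ℤ) :
    ((n : ℂ) - k) * (n + k + 1) * legendreCoef n 0 k =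
      ((n : ℂ) - k - 1) * (n + k + 2) * legendreCoef n 0 (k + 2) := by
  have c1 := continuous_trigLegendreDeriv n 0
  have c2 := continuous_trigLegendreQuot n 0
  have c3 := continuous_trigLegendre n 0
  have c0 := continuous_ofReal_trigLegendre n 0
  have h1 : ∀ l, fourierCoef (fun θ => (trigLegendreDeriv n 0 θ : ℂ)) l =
      Complex.I * l * legendreCoef n 0 l := fun l =>
    fourierCoef_deriv (fun θ => (hasDerivAt_trigLegendre n 0 θ).ofReal_comp) (by fun_prop)
      (by simp [trigLegendre]) l
  have h2 := fourierCoef_deriv (k := k + 1)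
    (fun θ => (hasDerivAt_sin_mul_trigLegendreDeriv n 0 θ).ofReal_comp) (by fun_prop) (by simp)
  have e1 : ∀ θ : ℝ, (((0 : ℕ) * trigLegendreQuot n 0 θ -
      n * (n + 1) * (Real.sin θ * trigLegendre n 0 θ) : ℝ) : ℂ) =
      (-((n : ℂ) * (n + 1))) * ((Real.sin θ : ℂ) * (trigLegendre n 0 θ : ℂ)) := by
    intro θ; push_cast; ring
  have e2 : ∀ θ : ℝ, ((Real.sin θ * trigLegendreDeriv n 0 θ : ℝ) : ℂ) =
      (Real.sin θ : ℂ) * (trigLegendreDeriv n 0 θ : ℂ) := by intro θ; push_cast; ring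
  simp only [e1, e2] at h2
  rw [fourierCoef_const_mul, fourierCoef_sin_mul c0, fourierCoef_sin_mul (by fun_prop), h1, h1,
    show k + 1 - 1 = k by ring, show k + 1 + 1 = k + 2 by ring] at h2
  simp only [← legendreCoef.eq_1] at h2
  have hI := Complex.I_ne_zero
  field_simp at h2
  push_cast at h2
  have hI2 := Complex.I_sq
  linear_combination (-1) * h2 - ((k : ℂ) + 1) * (k * legendreCoef n 0 k -
    (k + 2) * legendreCoef n 0 (k + 2)) * hI2

/-- The half turn θ ↦ θ + π multiplies the function by (-1)^n and its k-th coefficient by (-1)^k. -/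
lemma legendreCoef_parity (n m : ℕ) {k : ℤ} (h : Odd ((n : ℤ) - k)) : legendreCoef n m k = 0 := by
  have hp : Function.Periodic (fun θ : ℝ => (trigLegendre n m θ : ℂ)) (2 * Real.pi) := fun θ => by
    simp only [periodic_trigLegendre n m θ]
  have h1 := fourierCoef_shift hp Real.pi k
  simp only [trigLegendre_add_pi, Complex.ofReal_mul] at h1
  rw [fourierCoef_const_mul] at h1
  have e : Complex.exp (Complex.I * k * Real.pi) = (-1) ^ k := by
    rw [show Complex.I * k * Real.pi = k * (Real.pi * Complex.I) by ring, Complex.exp_int_mul,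
      Complex.exp_pi_mul_I]
  rw [e] at h1
  have h2 : ((-1 : ℂ) ^ k) = - (-1) ^ n := by
    have h3 : ((-1 : ℂ) ^ ((n : ℤ) - k)) = -1 := h.neg_one_zpow
    rw [zpow_sub₀ (by norm_num), zpow_natCast, div_eq_iff (zpow_ne_zero _ (by norm_num))] at h3
    rw [h3]; ring
  rw [h2] at h1
  push_cast at h1
  have h4 : (2 * (-1 : ℂ) ^ n) * legendreCoef n m k = 0 := by
    unfold legendreCoef; linear_combination h1
  exact (mul_eq_zero.1 h4).resolve_left (by simp)

/-- In the recurrence the left factor n - k vanishes at k = n, which starts the induction. The right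
factor does not vanish for k ≥ n, which continues it. -/
lemma legendreCoef_add_even (n i : ℕ) : legendreCoef n 0 ((n : ℤ) + 2 + 2 * i) = 0 := by
  have key : ∀ i : ℕ, legendreCoef n 0 ((n : ℤ) + 2 * i) = 0 ∨ i = 0 →
      legendreCoef n 0 ((n : ℤ) + 2 + 2 * i) = 0 := by
    intro i hi
    have h := legendreCoef_recurrence n ((n : ℤ) + 2 * i)
    have hl : ((n : ℂ) - ((n : ℤ) + 2 * i : ℤ)) * (n + ((n : ℤ) + 2 * i : ℤ) + 1) *
        legendreCoef n 0 ((n : ℤ) + 2 * i) = 0 := by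
      rcases hi with hi | rfl
      · rw [hi, mul_zero]
      · simp
    rw [hl, show (n : ℤ) + 2 * i + 2 = (n : ℤ) + 2 + 2 * i by ring] at h
    refine (mul_eq_zero.1 h.symm).resolve_left ?_
    have : ((n : ℂ) - ((n : ℤ) + 2 * i : ℤ) - 1) * (n + ((n : ℤ) + 2 * i : ℤ) + 2) =
        ((-((2 * i + 1) * (2 * n + 2 * i + 2) : ℕ) : ℤ) : ℂ) := by push_cast; ring
    rw [this]
    norm_cast
  induction i with
  | zero => exact key 0 (Or.inr rfl)
  | succ i ih =>
    refine key (i + 1) (Or.inl ?_)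
    rw [← ih]; congr 1; push_cast; ring

lemma legendreCoef_eq_zero_of_lt (n : ℕ) {k : ℤ} (h : n < k.natAbs) : legendreCoef n 0 k = 0 := by
  have pos : ∀ k : ℤ, (n : ℤ) < k → legendreCoef n 0 k = 0 := by
    intro k hk
    rcases Int.even_or_odd ((n : ℤ) - k) with he | ho
    · obtain ⟨t, ht⟩ := he
      obtain ⟨i, hi⟩ : ∃ i : ℕ, k = (n : ℤ) + 2 + 2 * i := ⟨(-t - 1).toNat, by omega⟩
      rw [hi]; exact legendreCoef_add_even n i
    · exact legendreCoef_parity n 0 ho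
  rcases le_or_gt 0 k with hk | hk
  · exact pos k (by omega)
  · have := legendreCoef_neg n 0 (-k)
    rw [neg_neg, pos (-k) (by omega)] at this
    simpa using this

/-- The products of binomial ratios satisfy the same two-term recurrence in j. The top coefficient
is still an unknown constant here. -/
lemma legendreCoef_formula_aux (n j : ℕ) (hj : j ≤ n) :
    (binomRatio n : ℂ) * legendreCoef n 0 ((n : ℤ) - 2 * j) =
      legendreCoef n 0 n * (binomRatio j * binomRatio (n - j)) := by
  induction j with
  | zero => simp [binomRatio_zero]; ring
  | succ j ih =>
    have h := legendreCoef_recurrence n ((n : ℤ) - 2 * (j + 1 : ℕ))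
    have ih := ih (by omega)
    rw [show (n : ℤ) - 2 * (j + 1 : ℕ) + 2 = (n : ℤ) - 2 * j by push_cast; ring] at h
    obtain ⟨d, rfl⟩ : ∃ d, n = j + 1 + d := ⟨n - (j + 1), by omega⟩
    have b1 : (2 * (j : ℂ) + 2) * binomRatio (j + 1) = (2 * j + 1) * binomRatio j := by
      exact_mod_cast binomRatio_succ j
    have b2 : (2 * (d : ℂ) + 2) * binomRatio (d + 1) = (2 * d + 1) * binomRatio d := by
      exact_mod_cast binomRatio_succ d
    rw [show j + 1 + d - j = d + 1 by omega] at ih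
    rw [show j + 1 + d - (j + 1) = d by omega]
    push_cast at h ih ⊢
    have hne : (2 * (j : ℂ) + 2) * (2 * d + 1) ≠ 0 := by
      norm_cast
    apply mul_left_cancel₀ hne
    linear_combination (binomRatio (j + 1 + d) : ℂ) * h + (2 * (j : ℂ) + 1) * (2 * d + 2) * ih +
      legendreCoef (j + 1 + d) 0 (j + 1 + d) * ((2 * (j : ℂ) + 1) * binomRatio j * b2 -
       (2 * d + 1) * binomRatio d * b1)

lemma legendreCoef_support (n : ℕ) (k : ℤ)
    (hk : k ∉ (Finset.range (n + 1)).image fun j : ℕ => (n : ℤ) - 2 * j) :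
    legendreCoef n 0 k = 0 := by
  by_cases h : n < k.natAbs
  · exact legendreCoef_eq_zero_of_lt n h
  rcases Int.even_or_odd ((n : ℤ) - k) with he | ho
  · obtain ⟨t, ht⟩ := he
    refine absurd (Finset.mem_image.2 ⟨t.toNat, ?_, ?_⟩) hk
    · rw [Finset.mem_range]; omega
    · omega
  · exact legendreCoef_parity n 0 ho

/-- The Fourier coefficients of `P_n(cos θ)`. -/
theorem legendreCoef_formula (n j : ℕ) (hj : j ≤ n) :
    legendreCoef n 0 ((n : ℤ) - 2 * j) =
      ((binomRatio j * binomRatio (n - j) / binomRatioConv n : ℝ) : ℂ) := by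
  have hs : Summable (fourierCoef (fun θ => (trigLegendre n 0 θ : ℂ))) :=
    summable_of_ne_finset_zero (fun k hk => legendreCoef_support n k hk)
  have hp : Function.Periodic (fun θ : ℝ => (trigLegendre n 0 θ : ℂ)) (2 * Real.pi) := fun θ => by
    simp only [periodic_trigLegendre n 0 θ]
  -- At θ = 0 the finite Fourier series sums to P_n(1) = 1, which fixes the top coefficient.
  have h1 := hasSum_fourierCoef_of_continuous (continuous_ofReal_trigLegendre n 0) hp hs 0
  have h2 := hasSum_sum_of_ne_finset_zero (L := SummationFilter.unconditional ℤ) (f := fun k : ℤ =>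
    fourierCoef (fun θ => (trigLegendre n 0 θ : ℂ)) k * Complex.exp (Complex.I * k * (0 : ℝ)))
    (s := (Finset.range (n + 1)).image fun j : ℕ => (n : ℤ) - 2 * j)
    (fun k hk => by
      have := legendreCoef_support n k hk
      unfold legendreCoef at this
      rw [this, zero_mul])
  have h3 := h1.unique h2
  rw [Finset.sum_image (by intro a _ b _ h; simp only at h; omega)] at h3
  have h4 : trigLegendre n 0 0 = 1 := by simp [trigLegendre, legendreDeriv_zero_eval_one]
  simp only [h4, Complex.ofReal_zero, mul_zero, Complex.exp_zero, mul_one,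
    ← legendreCoef.eq_1, Complex.ofReal_one] at h3
  have hb : (binomRatio n : ℂ) ≠ 0 := by exact_mod_cast (binomRatio_pos n).ne'
  have h5 : (binomRatio n : ℂ) = legendreCoef n 0 n * binomRatioConv n := by
    calc (binomRatio n : ℂ) = ∑ j ∈ Finset.range (n + 1),
          (binomRatio n : ℂ) * legendreCoef n 0 ((n : ℤ) - 2 * j) := by
          rw [← Finset.mul_sum, ← h3, mul_one]
      _ = ∑ j ∈ Finset.range (n + 1),
          legendreCoef n 0 n * (binomRatio j * binomRatio (n - j) : ℂ) :=
          Finset.sum_congr rfl fun j hj => legendreCoef_formula_aux n j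
            (by simpa [Nat.lt_succ_iff] using hj)
      _ = _ := by rw [← Finset.mul_sum, binomRatioConv]; push_cast; rfl
  have hB : (binomRatioConv n : ℂ) ≠ 0 := by
    have := half_le_binomRatioConv n
    have h0 : binomRatioConv n ≠ 0 := by linarith
    exact_mod_cast h0
  have h6 := legendreCoef_formula_aux n j hj
  push_cast
  rw [eq_div_iff hB]
  apply mul_left_cancel₀ hb
  linear_combination (binomRatioConv n : ℂ) * h6 - (binomRatio j * binomRatio (n - j) : ℂ) * h5

/-- The Fourier coefficients of `P_n(cos θ)`, as real numbers. -/
def legendreCoefZero (n : ℕ) (k : ℤ) : ℝ := (legendreCoef n 0 k).re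

/-- For k = n - 2j the bounds on the binomial ratios combine through (2j + 1)(2(n - j) + 1) = (n +
1)² - k², and the 2 comes from the lower bound 1/2 of the convolution. For |k| > n the right side is
0 by the conventions for roots and division, and so is the coefficient. -/
lemma legendreCoefZero_spec (n : ℕ) (k : ℤ) :
    legendreCoef n 0 k = (legendreCoefZero n k : ℂ) ∧ 0 ≤ legendreCoefZero n k ∧
      legendreCoefZero n k ≤ 2 / Real.sqrt (((n : ℝ) + 1) ^ 2 - (k : ℝ) ^ 2) := by
  by_cases hk : k ∈ (Finset.range (n + 1)).image fun j : ℕ => (n : ℤ) - 2 * j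
  · obtain ⟨j, hj, rfl⟩ := Finset.mem_image.1 hk
    have hj' : j ≤ n := by simpa [Nat.lt_succ_iff] using hj
    rw [legendreCoefZero, legendreCoef_formula n j hj', Complex.ofReal_re]
    have p1 := binomRatio_pos j
    have p2 := binomRatio_pos (n - j)
    have pB := half_le_binomRatioConv n
    refine ⟨rfl, by positivity, ?_⟩
    have hc : ((n - j : ℕ) : ℝ) = n - j := by push_cast [hj']; ring
    have h1 := (binomRatio_sq_bounds j).2
    have h2 := (binomRatio_sq_bounds (n - j)).2
    rw [hc] at h2
    have hjn : (j : ℝ) ≤ n := by exact_mod_cast hj'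
    have hj0 : (0 : ℝ) ≤ j := Nat.cast_nonneg j
    have hpos : 0 < (2 * (j : ℝ) + 1) * (2 * (n - j) + 1) :=
      mul_pos (by positivity) (by linarith)
    have e : ((n : ℝ) + 1) ^ 2 - (((n : ℤ) - 2 * j : ℤ) : ℝ) ^ 2 =
        (2 * (j : ℝ) + 1) * (2 * (n - j) + 1) := by push_cast; ring
    rw [e]
    have h3 : binomRatio j * binomRatio (n - j) ≤
        1 / Real.sqrt ((2 * (j : ℝ) + 1) * (2 * (n - j) + 1)) := by
      refine le_of_sq_le_sq ?_ (by positivity)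
      rw [div_pow, Real.sq_sqrt hpos.le, mul_pow, one_pow, ← one_div_mul_one_div]
      have : 0 ≤ 1 / (2 * (j : ℝ) + 1) := by positivity
      gcongr
    rw [div_le_iff₀ (by linarith)]
    calc _ ≤ 1 / Real.sqrt ((2 * (j : ℝ) + 1) * (2 * (n - j) + 1)) := h3
      _ = 2 / Real.sqrt ((2 * (j : ℝ) + 1) * (2 * (n - j) + 1)) * (1 / 2) := by ring
      _ ≤ _ := by gcongr
  · simp [legendreCoefZero, legendreCoef_support n k hk]
    positivity

lemma legendreCoefZero_eq_zero_of_lt (n : ℕ) {k : ℤ} (h : n < k.natAbs) :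
    legendreCoefZero n k = 0 := by
  simp [legendreCoefZero, legendreCoef_eq_zero_of_lt n h]

/-! ### The addition formula on the Fourier side -/

/-- The Fourier coefficients of the addition formula. -/
theorem sum_legendreCoef_mul_conj (n : ℕ) (k l : ℤ) :
    ∑ m ∈ Finset.range (n + 1), (addWeight n m : ℂ) *
        ((starRingEnd ℂ) (legendreCoef n m l) * legendreCoef n m k) =
      if l = k then (legendreCoefZero n l : ℂ) else 0 := by
  have hc := continuous_ofReal_trigLegendre n
  have hp : Function.Periodic (fun θ : ℝ => (trigLegendre n 0 θ : ℂ)) (2 * Real.pi) := fun θ => by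
    simp only [periodic_trigLegendre n 0 θ]
  -- Coefficient of order k in x, with y fixed: the translation in P_n(cos(x - y)) becomes the
  -- factor exp(-iky).
  have h1 : ∀ y : ℝ, ∑ m ∈ Finset.range (n + 1),
      (addWeight n m * legendreCoef n m k) * (trigLegendre n m y : ℂ) =
      legendreCoef n 0 k * Complex.exp (Complex.I * ((-k : ℤ) : ℂ) * y) := by
    intro y
    have e1 := fourierCoef_finset_sum (Finset.range (n + 1))
      (fun m => (addWeight n m : ℂ) * (trigLegendre n m y : ℂ)) hc k
    have e2 : ∀ x : ℝ, ∑ m ∈ Finset.range (n + 1),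
        ((addWeight n m : ℂ) * (trigLegendre n m y : ℂ)) * (trigLegendre n m x : ℂ) =
        (trigLegendre n 0 (x + -y) : ℂ) := by
      intro x
      rw [← sub_eq_add_neg, ← legendre_addition]
      push_cast
      exact Finset.sum_congr rfl fun m _ => by ring
    simp only [e2] at e1
    rw [fourierCoef_shift hp] at e1
    simp only [← legendreCoef.eq_1] at e1
    calc _ = ∑ m ∈ Finset.range (n + 1),
          ((addWeight n m : ℂ) * (trigLegendre n m y : ℂ)) * legendreCoef n m k :=
          Finset.sum_congr rfl fun m _ => by ring
      _ = _ := by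
          rw [← e1, mul_comm]
          congr 2
          push_cast
          ring
  -- Coefficient of order -l in y; since the functions are real, it is a conjugate of the one of
  -- order l.
  have h2 := fourierCoef_finset_sum (Finset.range (n + 1))
    (fun m => (addWeight n m : ℂ) * legendreCoef n m k) hc (-l)
  simp only [h1] at h2
  rw [fourierCoef_const_mul, fourierCoef_exp] at h2
  simp only [← legendreCoef.eq_1, legendreCoef_neg] at h2
  calc _ = ∑ m ∈ Finset.range (n + 1),
        (addWeight n m : ℂ) * legendreCoef n m k * (starRingEnd ℂ) (legendreCoef n m l) :=
        Finset.sum_congr rfl fun m _ => by ring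
    _ = _ := by
        rw [← h2]
        by_cases h : l = k
        · subst h
          rw [if_pos rfl, if_pos rfl, mul_one, (legendreCoefZero_spec n l).1]
        · rw [if_neg h, if_neg (by omega), mul_zero]

/-- The rows of the matrix of normalized Fourier coefficients have length at most one. -/
theorem sum_sq_legendreCoef_div_le (n m : ℕ) (hm : m ≤ n) (K : Finset ℤ) :
    addWeight n m * ∑ k ∈ K, ‖legendreCoef n m k‖ ^ 2 / legendreCoefZero n k ≤ 1 := by
  -- The columns of the matrix, orthogonal with squared lengths p_n(k). Bessel's inequality for the
  -- m-th basis vector reads off row m.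
  let v : ℤ → EuclideanSpace ℂ (Fin (n + 1)) := fun k =>
    WithLp.toLp 2 fun i => (Real.sqrt (addWeight n i) : ℂ) * legendreCoef n i k
  have hw : ∀ i : ℕ, ((Real.sqrt (addWeight n i) : ℝ) : ℂ) * (Real.sqrt (addWeight n i) : ℝ) =
      (addWeight n i : ℂ) := fun i => by
    exact_mod_cast Real.mul_self_sqrt (addWeight_pos n i).le
  have hv : ∀ l k, inner ℂ (v l) (v k) = if l = k then (legendreCoefZero n l : ℂ) else 0 := by
    intro l k
    rw [← sum_legendreCoef_mul_conj, PiLp.inner_apply, Finset.sum_range]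
    refine Finset.sum_congr rfl fun i _ => ?_
    simp only [v, RCLike.inner_apply, map_mul, Complex.conj_ofReal]
    rw [← hw i]
    ring
  have h := bessel_of_orthogonal hv (EuclideanSpace.single (⟨m, by omega⟩ : Fin (n + 1)) (1 : ℂ)) K
  simp only [EuclideanSpace.inner_single_right, PiLp.norm_single, v] at h
  rw [Finset.mul_sum]
  refine le_trans (le_of_eq (Finset.sum_congr rfl fun k _ => ?_)) (h.trans (by simp))
  rw [one_mul, map_mul, Complex.conj_ofReal, norm_mul, RCLike.norm_conj, mul_pow,
    Complex.norm_real, Real.norm_eq_abs, sq_abs, Real.sq_sqrt (addWeight_pos n m).le]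
  ring

/-- A column of length zero vanishes. So the quotients by p_n(k) lose nothing where p_n(k) = 0. -/
lemma legendreCoef_eq_zero (n m : ℕ) (hm : m ≤ n) {k : ℤ} (h : legendreCoefZero n k = 0) :
    legendreCoef n m k = 0 := by
  have h1 := sum_legendreCoef_mul_conj n k k
  rw [if_pos rfl, h] at h1
  simp only [Complex.conj_mul'] at h1
  have h2 : ∑ m ∈ Finset.range (n + 1), addWeight n m * ‖legendreCoef n m k‖ ^ 2 = 0 := by
    exact_mod_cast h1
  rw [Finset.sum_eq_zero_iff_of_nonneg
    (fun i _ => mul_nonneg (addWeight_pos n i).le (sq_nonneg _))] at h2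
  have h3 := h2 m (by simpa [Nat.lt_succ_iff] using hm)
  simpa [(addWeight_pos n m).ne'] using h3

/-! ### Summation over the degree and the trace inequality for finite sums -/

/-- The weight `max(1, |k|^(2r))` of the periodic Sobolev space. -/
def sobolevWeight (r : ℝ) (k : ℤ) : ℝ := if k = 0 then 1 else |(k : ℝ)| ^ (2 * r)

lemma sobolevWeight_pos (r : ℝ) (k : ℤ) : 0 < sobolevWeight r k := by
  unfold sobolevWeight
  split_ifs with h
  · exact one_pos
  · have : (k : ℝ) ≠ 0 := by exact_mod_cast h
    positivity

lemma one_le_sobolevWeight {r : ℝ} (hr : 0 ≤ r) (k : ℤ) : 1 ≤ sobolevWeight r k := by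
  unfold sobolevWeight
  split_ifs with h
  · exact le_rfl
  · refine Real.one_le_rpow ?_ (by positivity)
    have := Int.one_le_abs h
    exact_mod_cast this

lemma periodicTerm_eq (r : ℝ) (f : ℝ → ℂ) (k : ℤ) :
    periodicTerm r f k = sobolevWeight r k * ‖fourierCoef f k‖ ^ 2 := by
  unfold periodicTerm sobolevWeight
  split_ifs with h
  · rw [h, one_mul]
  · rfl

lemma sum_inv_sqrt_le (K : ℕ) : ∑ i ∈ Finset.range K, 1 / Real.sqrt ((i : ℝ) + 1) ≤
    2 * Real.sqrt K := by
  induction K with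
  | zero => simp
  | succ K ih =>
    rw [Finset.sum_range_succ]
    have h0 : (0 : ℝ) ≤ K := Nat.cast_nonneg K
    have h1 := Real.sq_sqrt h0
    have h2 := Real.sq_sqrt (by positivity : (0 : ℝ) ≤ (K : ℝ) + 1)
    have h3 : 0 < Real.sqrt ((K : ℝ) + 1) := Real.sqrt_pos.2 (by positivity)
    have h4 : 1 / Real.sqrt ((K : ℝ) + 1) ≤ 2 * Real.sqrt ((K : ℝ) + 1) - 2 * Real.sqrt K := by
      rw [div_le_iff₀ h3]
      nlinarith [sq_nonneg (Real.sqrt ((K : ℝ) + 1) - Real.sqrt K)]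
    push_cast
    linarith

lemma sum_telescope_le {ψ : ℕ → ℝ} (hψ : Antitone ψ) (h0 : ∀ n, 0 ≤ ψ n) (a : ℕ) (I : Finset ℕ)
    (hI : ∀ n ∈ I, a ≤ n) : ∑ n ∈ I, (ψ n - ψ (n + 1)) ≤ ψ a := by
  let N := I.sup id + 1
  have hsub : I ⊆ Finset.Ico a (a + N) := by
    intro n hn
    rw [Finset.mem_Ico]
    have : n ≤ I.sup id := Finset.le_sup (f := id) hn
    exact ⟨hI n hn, by omega⟩
  calc _ ≤ ∑ n ∈ Finset.Ico a (a + N), (ψ n - ψ (n + 1)) :=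
        Finset.sum_le_sum_of_subset_of_nonneg hsub
          fun n _ _ => sub_nonneg.2 (hψ (Nat.le_succ n))
    _ = ψ a - ψ (a + N) := by
        rw [Finset.sum_Ico_eq_sum_range, Nat.add_sub_cancel_left]
        have := Finset.sum_range_sub' (fun i => ψ (a + i)) N
        simpa [add_assoc] using this
    _ ≤ ψ a := by linarith [h0 (a + N)]

/-- For x = n + 1 ≥ 1, the bounds log(1 + 1/x) ≥ 1/(2x) and exp(-t) ≤ 1/(1 + t) give 1 - (1 +
1/x)^(-2r) ≥ r/(x + r) ≥ r/((1 + r)x). A telescoping sum thus replaces the integral comparison for ∑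
x^(-2r-1). -/
lemma rpow_succ_le_telescope {r : ℝ} (hr : 0 < r) (n : ℕ) :
    ((n : ℝ) + 1) ^ (-(2 * r)) / (n + 1) ≤
      (1 + r) / r * (((n : ℝ) + 1) ^ (-(2 * r)) - ((n : ℝ) + 1 + 1) ^ (-(2 * r))) := by
  set x : ℝ := (n : ℝ) + 1 with hx
  have hx1 : 1 ≤ x := by rw [hx]; linarith [Nat.cast_nonneg (α := ℝ) n]
  have hx0 : 0 < x := by linarith
  have hu : x + 1 = x * ((x + 1) / x) := by field_simp
  have hu0 : 0 < (x + 1) / x := by positivity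
  have h1 : ((x + 1) / x) ^ (-(2 * r)) ≤ 1 / (1 + r / x) := by
    rw [Real.rpow_def_of_pos hu0]
    have hlog : 1 / (2 * x) ≤ Real.log ((x + 1) / x) := by
      have := Real.one_sub_inv_le_log_of_pos hu0
      refine le_trans ?_ this
      rw [inv_div]
      have : 1 - x / (x + 1) = 1 / (x + 1) := by field_simp; ring
      rw [this]
      exact one_div_le_one_div_of_le (by positivity) (by linarith)
    calc Real.exp (Real.log ((x + 1) / x) * -(2 * r)) ≤ Real.exp (-(r / x)) := by
          apply Real.exp_le_exp.2
          have : 1 / (2 * x) * (2 * r) ≤ Real.log ((x + 1) / x) * (2 * r) := by gcongr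
          have e : 1 / (2 * x) * (2 * r) = r / x := by field_simp
          linarith
      _ = 1 / Real.exp (r / x) := by rw [Real.exp_neg, one_div]
      _ ≤ _ := by
          apply one_div_le_one_div_of_le (by positivity)
          linarith [Real.add_one_le_exp (r / x)]
  rw [hu, Real.mul_rpow hx0.le hu0.le]
  have hp : 0 < x ^ (-(2 * r)) := by positivity
  have h2 : 1 / x ≤ (1 + r) / r * (1 - ((x + 1) / x) ^ (-(2 * r))) := by
    have h3 : 1 - 1 / (1 + r / x) = r / (x + r) := by field_simp; ring
    have h4 : r / ((1 + r) * x) ≤ r / (x + r) := by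
      gcongr
      nlinarith
    have h5 : 1 / x = (1 + r) / r * (r / ((1 + r) * x)) := by field_simp
    rw [h5]
    gcongr
    linarith
  calc x ^ (-(2 * r)) / x = x ^ (-(2 * r)) * (1 / x) := by ring
    _ ≤ x ^ (-(2 * r)) * ((1 + r) / r * (1 - ((x + 1) / x) ^ (-(2 * r)))) := by gcongr
    _ = _ := by ring

/-- Here (n + 1)² - k² = (n + 1 + |k|)(n + 1 - |k|), and the first factor is at least |k|. The
singularity at n = |k| is an inverse square root, whose sum up to 2|k| is compensated by 1/√|k|. -/
lemma legendreCoefZero_low_bound {r : ℝ} (hr : 0 < r) {n : ℕ} {k : ℤ} (h1 : k.natAbs ≤ n)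
    (h2 : n < 2 * k.natAbs) :
    ((n : ℝ) + 1 / 2) ^ (-(2 * r)) * legendreCoefZero n k ≤
      (sobolevWeight r k)⁻¹ * (2 / Real.sqrt k.natAbs) *
        (1 / Real.sqrt (((n - k.natAbs : ℕ) : ℝ) + 1)) := by
  have hk : k ≠ 0 := by rintro rfl; simp at h2
  have hK : (k.natAbs : ℝ) = |(k : ℝ)| := by rw [Nat.cast_natAbs, Int.cast_abs]
  have hK1 : (1 : ℝ) ≤ k.natAbs := by exact_mod_cast Int.natAbs_pos.2 hk
  obtain ⟨-, p0, p1⟩ := legendreCoefZero_spec n k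
  have hn : (k.natAbs : ℝ) ≤ n := by exact_mod_cast h1
  have e : ((n : ℝ) + 1) ^ 2 - (k : ℝ) ^ 2 =
      ((n : ℝ) + 1 + k.natAbs) * (((n - k.natAbs : ℕ) : ℝ) + 1) := by
    push_cast [h1]
    rw [hK, ← sq_abs (k : ℝ)]
    ring
  have hw : (sobolevWeight r k)⁻¹ = (k.natAbs : ℝ) ^ (-(2 * r)) := by
    rw [sobolevWeight, if_neg hk, ← hK, Real.rpow_neg (by positivity)]
  rw [hw, mul_assoc]
  refine mul_le_mul ?_ ?_ p0 (by positivity)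
  · exact Real.rpow_le_rpow_of_nonpos (by positivity) (by linarith) (by linarith)
  · refine p1.trans ?_
    rw [e, Real.sqrt_mul (by positivity), div_mul_div_comm, mul_one]
    gcongr
    linarith

/-- Away from the singularity, |k| ≤ n/2 makes the root at least (n + 1)/2. The factor 2^(2r) pays
for n + 1/2 ≥ (n + 1)/2. -/
lemma legendreCoefZero_high_bound {r : ℝ} (hr : 0 < r) {n : ℕ} {k : ℤ} (h2 : 2 * k.natAbs ≤ n) :
    ((n : ℝ) + 1 / 2) ^ (-(2 * r)) * legendreCoefZero n k ≤
      4 * 2 ^ (2 * r) * (((n : ℝ) + 1) ^ (-(2 * r)) / (n + 1)) := by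
  have hK : (k.natAbs : ℝ) = |(k : ℝ)| := by rw [Nat.cast_natAbs, Int.cast_abs]
  obtain ⟨-, p0, p1⟩ := legendreCoefZero_spec n k
  have hn : 2 * (k.natAbs : ℝ) ≤ n := by exact_mod_cast h2
  have hn0 : (0 : ℝ) ≤ n := Nat.cast_nonneg n
  have h3 : ((n : ℝ) + 1) / 2 ≤ Real.sqrt (((n : ℝ) + 1) ^ 2 - (k : ℝ) ^ 2) := by
    apply Real.le_sqrt_of_sq_le
    rw [← sq_abs (k : ℝ), ← hK]
    nlinarith [Nat.cast_nonneg (α := ℝ) k.natAbs]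
  have h4 : legendreCoefZero n k ≤ 4 / ((n : ℝ) + 1) := by
    refine p1.trans ?_
    calc _ ≤ 2 / (((n : ℝ) + 1) / 2) := by gcongr
      _ = _ := by field_simp; norm_num
  have h5 : ((n : ℝ) + 1 / 2) ^ (-(2 * r)) ≤ 2 ^ (2 * r) * ((n : ℝ) + 1) ^ (-(2 * r)) := by
    calc ((n : ℝ) + 1 / 2) ^ (-(2 * r)) ≤ (2⁻¹ * ((n : ℝ) + 1)) ^ (-(2 * r)) :=
          Real.rpow_le_rpow_of_nonpos (by positivity) (by linarith) (by linarith)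
      _ = _ := by
          rw [Real.mul_rpow (by norm_num) (by positivity), Real.inv_rpow (by norm_num),
            Real.rpow_neg (by norm_num), inv_inv]
  calc _ ≤ (2 ^ (2 * r) * ((n : ℝ) + 1) ^ (-(2 * r))) * (4 / ((n : ℝ) + 1)) := by gcongr
    _ = _ := by ring

/-- Uniform summability over the degree of the Fourier coefficients of the Legendre polynomials. -/
theorem exists_sum_legendreCoefZero_le {r : ℝ} (hr : 0 < r) :
    ∃ C : ℝ, 0 < C ∧ ∀ (k : ℤ) (I : Finset ℕ),
      ∑ n ∈ I, ((n : ℝ) + 1 / 2) ^ (-(2 * r)) * legendreCoefZero n k ≤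
        C * (sobolevWeight r k)⁻¹ := by
  -- The 4 comes from the degrees |k| ≤ n < 2|k|, the other summand from n ≥ 2|k|; degrees below |k|
  -- contribute nothing.
  refine ⟨4 + 4 * 2 ^ (2 * r) * ((1 + r) / r), by positivity, fun k I => ?_⟩
  have hw := sobolevWeight_pos r k
  set K := k.natAbs with hKdef
  let ψ : ℕ → ℝ := fun n => ((n : ℝ) + 1) ^ (-(2 * r))
  have hψ : Antitone ψ := fun a b hab => Real.rpow_le_rpow_of_nonpos (by positivity)
    (by have : (a : ℝ) ≤ b := by exact_mod_cast hab
        linarith) (by linarith)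
  have hψ0 : ∀ n, 0 ≤ ψ n := fun n => by positivity
  rw [← Finset.sum_filter_add_sum_filter_not I (fun n => 2 * K ≤ n),
    ← Finset.sum_filter_add_sum_filter_not (I.filter (fun n => ¬ 2 * K ≤ n)) (fun n => K ≤ n)]
  have hA : ∑ n ∈ (I.filter (fun n => ¬ 2 * K ≤ n)).filter (fun n => K ≤ n),
      ((n : ℝ) + 1 / 2) ^ (-(2 * r)) * legendreCoefZero n k ≤ 4 * (sobolevWeight r k)⁻¹ := by
    calc _ ≤ ∑ n ∈ (I.filter (fun n => ¬ 2 * K ≤ n)).filter (fun n => K ≤ n),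
          (sobolevWeight r k)⁻¹ * (2 / Real.sqrt K) * (1 / Real.sqrt (((n - K : ℕ) : ℝ) + 1)) := by
          refine Finset.sum_le_sum fun n hn => ?_
          simp only [Finset.mem_filter, not_le] at hn
          exact legendreCoefZero_low_bound hr hn.2 hn.1.2
      _ ≤ ∑ n ∈ Finset.Ico K (2 * K),
          (sobolevWeight r k)⁻¹ * (2 / Real.sqrt K) * (1 / Real.sqrt (((n - K : ℕ) : ℝ) + 1)) := by
          refine Finset.sum_le_sum_of_subset_of_nonneg ?_ fun n _ _ => by positivity
          intro n hn
          simp only [Finset.mem_filter, not_le] at hn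
          exact Finset.mem_Ico.2 ⟨hn.2, hn.1.2⟩
      _ = (sobolevWeight r k)⁻¹ * (2 / Real.sqrt K) *
          ∑ i ∈ Finset.range K, 1 / Real.sqrt ((i : ℝ) + 1) := by
          rw [← Finset.mul_sum, Finset.sum_Ico_eq_sum_range, show 2 * K - K = K by omega]
          simp only [Nat.add_sub_cancel_left]
      _ ≤ (sobolevWeight r k)⁻¹ * (2 / Real.sqrt K) * (2 * Real.sqrt K) := by
          gcongr
          exact sum_inv_sqrt_le K
      _ ≤ 4 * (sobolevWeight r k)⁻¹ := by
          have : Real.sqrt K / Real.sqrt K ≤ 1 := div_self_le_one _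
          calc _ = 4 * (sobolevWeight r k)⁻¹ * (Real.sqrt K / Real.sqrt K) := by ring
            _ ≤ 4 * (sobolevWeight r k)⁻¹ * 1 := by gcongr
            _ = _ := mul_one _
  have hZ : ∑ n ∈ (I.filter (fun n => ¬ 2 * K ≤ n)).filter (fun n => ¬ K ≤ n),
      ((n : ℝ) + 1 / 2) ^ (-(2 * r)) * legendreCoefZero n k = 0 := by
    refine Finset.sum_eq_zero fun n hn => ?_
    simp only [Finset.mem_filter, not_le] at hn
    rw [legendreCoefZero_eq_zero_of_lt n hn.2, mul_zero]
  have hψw : ψ (2 * K) ≤ (sobolevWeight r k)⁻¹ := by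
    simp only [ψ]
    unfold sobolevWeight
    split_ifs with h0
    · rw [inv_one]
      exact Real.rpow_le_one_of_one_le_of_nonpos (by push_cast; linarith [Nat.cast_nonneg (α := ℝ) K])
        (by linarith)
    · have hK : (K : ℝ) = |(k : ℝ)| := by rw [hKdef, Nat.cast_natAbs, Int.cast_abs]
      rw [← hK, ← Real.rpow_neg (by positivity)]
      have : (0 : ℝ) < K := by exact_mod_cast Int.natAbs_pos.2 h0
      exact Real.rpow_le_rpow_of_nonpos this (by push_cast; linarith) (by linarith)
  have hB : ∑ n ∈ I.filter (fun n => 2 * K ≤ n),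
      ((n : ℝ) + 1 / 2) ^ (-(2 * r)) * legendreCoefZero n k ≤
        4 * 2 ^ (2 * r) * ((1 + r) / r) * (sobolevWeight r k)⁻¹ := by
    calc _ ≤ ∑ n ∈ I.filter (fun n => 2 * K ≤ n),
          4 * 2 ^ (2 * r) * ((1 + r) / r) * (ψ n - ψ (n + 1)) := by
          refine Finset.sum_le_sum fun n hn => ?_
          simp only [Finset.mem_filter] at hn
          refine (legendreCoefZero_high_bound hr hn.2).trans ?_
          rw [mul_assoc _ ((1 + r) / r)]
          refine mul_le_mul_of_nonneg_left ?_ (by positivity)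
          have := rpow_succ_le_telescope hr n
          simpa [ψ] using this
      _ = 4 * 2 ^ (2 * r) * ((1 + r) / r) *
          ∑ n ∈ I.filter (fun n => 2 * K ≤ n), (ψ n - ψ (n + 1)) := by rw [Finset.mul_sum]
      _ ≤ 4 * 2 ^ (2 * r) * ((1 + r) / r) * ψ (2 * K) := by
          refine mul_le_mul_of_nonneg_left (sum_telescope_le hψ hψ0 _ _ ?_) (by positivity)
          intro n hn
          exact (Finset.mem_filter.1 hn).2
      _ ≤ _ := by gcongr
  rw [hZ]
  linarith

lemma fourierCoef_trigQ (n m : ℕ) (k : ℤ) :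
    fourierCoef (fun θ => (trigQ n m θ : ℂ)) k = legendreNorm n m * legendreCoef n m k := by
  simp only [trigQ, Complex.ofReal_mul]
  rw [fourierCoef_const_mul]
  rfl

lemma legendreNorm_sq_le (n m : ℕ) : legendreNorm n m ^ 2 ≤ ((n : ℝ) + 1 / 2) * addWeight n m := by
  rw [legendreNorm_sq, addWeight]
  have h : 0 ≤ ((n - m).factorial : ℝ) / ((n + m).factorial : ℝ) := by positivity
  have h2 : (2 * (n : ℝ) + 1) / 2 = (n : ℝ) + 1 / 2 := by ring
  rw [h2]
  gcongr
  split_ifs <;> linarith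

/-- The trace inequality for finite sums of spherical harmonics of order `m`, on a meridian. -/
theorem exists_trace_finite {r : ℝ} (hr : 0 < r) :
    ∃ C : ℝ, 0 < C ∧ ∀ (m : ℕ) (I : Finset ℕ), (∀ n ∈ I, m ≤ n) → ∀ (x : ℕ → ℂ) (K : Finset ℤ),
      ∑ k ∈ K, sobolevWeight r k *
          ‖∑ n ∈ I, x n * fourierCoef (fun θ => (trigQ n m θ : ℂ)) k‖ ^ 2 ≤
        C * ∑ n ∈ I, ((n : ℝ) + 1 / 2) ^ (2 * (r + 1 / 2)) * ‖x n‖ ^ 2 := by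
  obtain ⟨C, hC, hsum⟩ := exists_sum_legendreCoefZero_le hr
  refine ⟨C, hC, fun m I hI x K => ?_⟩
  -- One factor for Cauchy-Schwarz in n; the other is (n + 1/2)^(-2r) p_n(k). Summed over k, A is
  -- controlled by the row bound; the other factor, summed over n, by the uniform summability.
  let A : ℕ → ℤ → ℝ := fun n k => ((n : ℝ) + 1 / 2) ^ (2 * r) *
    (‖x n‖ ^ 2 * (((n : ℝ) + 1 / 2) * addWeight n m *
      (‖legendreCoef n m k‖ ^ 2 / legendreCoefZero n k)))
  have hA0 : ∀ n k, 0 ≤ A n k := fun n k => by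
    have h1 := (legendreCoefZero_spec n k).2.1
    have h2 := (addWeight_pos n m).le
    positivity
  have hcs : ∀ k, ‖∑ n ∈ I, x n * fourierCoef (fun θ => (trigQ n m θ : ℂ)) k‖ ^ 2 ≤
      (∑ n ∈ I, A n k) * (C * (sobolevWeight r k)⁻¹) := by
    intro k
    have h1 : ‖∑ n ∈ I, x n * fourierCoef (fun θ => (trigQ n m θ : ℂ)) k‖ ^ 2 ≤
        (∑ n ∈ I, ‖x n * fourierCoef (fun θ => (trigQ n m θ : ℂ)) k‖) ^ 2 := by
      gcongr
      exact norm_sum_le _ _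
    refine h1.trans ((Finset.sum_sq_le_sum_mul_sum_of_sq_le_mul I (fun n _ => hA0 n k)
      (g := fun n => ((n : ℝ) + 1 / 2) ^ (-(2 * r)) * legendreCoefZero n k)
      (fun n _ => ?_) (fun n hn => ?_)).trans ?_)
    · have := (legendreCoefZero_spec n k).2.1
      positivity
    · rw [fourierCoef_trigQ, norm_mul, norm_mul, mul_pow, mul_pow, Complex.norm_real,
        Real.norm_eq_abs, sq_abs]
      have hp := (legendreCoefZero_spec n k).2.1
      -- Where p_n(k) = 0 the quotient in A is a default value, but the coefficient itself vanishes.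
      rcases eq_or_lt_of_le hp with hp0 | hp0
      · rw [legendreCoef_eq_zero n m (hI n hn) hp0.symm]
        simp [← hp0]
      · have hb : ((n : ℝ) + 1 / 2) ^ (2 * r) * ((n : ℝ) + 1 / 2) ^ (-(2 * r)) = 1 := by
          rw [← Real.rpow_add (by positivity)]; simp
        have e : A n k * (((n : ℝ) + 1 / 2) ^ (-(2 * r)) * legendreCoefZero n k) =
            ‖x n‖ ^ 2 * ((((n : ℝ) + 1 / 2) * addWeight n m) * ‖legendreCoef n m k‖ ^ 2) := by
          simp only [A]
          have hd : ‖legendreCoef n m k‖ ^ 2 / legendreCoefZero n k * legendreCoefZero n k =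
              ‖legendreCoef n m k‖ ^ 2 := div_mul_cancel₀ _ hp0.ne'
          linear_combination (‖x n‖ ^ 2 * ((n : ℝ) + 1 / 2) * addWeight n m *
            (‖legendreCoef n m k‖ ^ 2 / legendreCoefZero n k * legendreCoefZero n k)) * hb +
            (‖x n‖ ^ 2 * ((n : ℝ) + 1 / 2) * addWeight n m) * hd
        rw [e]
        gcongr
        exact legendreNorm_sq_le n m
    · refine mul_le_mul_of_nonneg_left (hsum k I) (Finset.sum_nonneg fun n _ => hA0 n k)
  calc _ ≤ ∑ k ∈ K, sobolevWeight r k * ((∑ n ∈ I, A n k) * (C * (sobolevWeight r k)⁻¹)) := by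
        refine Finset.sum_le_sum fun k _ => ?_
        exact mul_le_mul_of_nonneg_left (hcs k) (sobolevWeight_pos r k).le
    _ = C * ∑ n ∈ I, ∑ k ∈ K, A n k := by
        rw [Finset.sum_comm, Finset.mul_sum]
        refine Finset.sum_congr rfl fun k _ => ?_
        have := (sobolevWeight_pos r k).ne'
        field_simp
    _ ≤ _ := by
        refine mul_le_mul_of_nonneg_left (Finset.sum_le_sum fun n hn => ?_) hC.le
        have h := sum_sq_legendreCoef_div_le n m (hI n hn) K
        have e : ∑ k ∈ K, A n k = ((n : ℝ) + 1 / 2) ^ (2 * r) * ((n : ℝ) + 1 / 2) * ‖x n‖ ^ 2 *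
            (addWeight n m * ∑ k ∈ K, ‖legendreCoef n m k‖ ^ 2 / legendreCoefZero n k) := by
          simp only [A, ← Finset.mul_sum]
          ring
        have e2 : ((n : ℝ) + 1 / 2) ^ (2 * (r + 1 / 2)) =
            ((n : ℝ) + 1 / 2) ^ (2 * r) * ((n : ℝ) + 1 / 2) := by
          rw [show 2 * (r + 1 / 2) = 2 * r + 1 by ring, Real.rpow_add (by positivity),
            Real.rpow_one]
        rw [e, e2]
        exact mul_le_of_le_one_right (by positivity) h

/-! ### Completeness of the associated Legendre functions -/

section Completeness
open Polynomial

lemma degree_iterate_derivative_eq {p : ℝ[X]} {d : ℕ} (hp : p.degree = d) {j : ℕ} (hj : j ≤ d) :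
    (derivative^[j] p).degree = ((d - j : ℕ) : WithBot ℕ) := by
  induction j with
  | zero => simpa using hp
  | succ j ih =>
    have h := ih (by omega)
    have hn := natDegree_eq_of_degree_eq_some h
    rw [Function.iterate_succ_apply', degree_derivative (by omega), hn]
    congr 1

lemma degree_legendreDeriv {n m : ℕ} (hm : m ≤ n) :
    (legendreDeriv n m).degree = ((n - m : ℕ) : WithBot ℕ) := by
  have h1 : ((X ^ 2 - 1 : ℝ[X]) ^ n).degree = ((2 * n : ℕ) : WithBot ℕ) := by
    rw [degree_pow, ← C_1, degree_X_pow_sub_C (by norm_num), nsmul_eq_mul]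
    push_cast
    rw [mul_comm]
  unfold legendreDeriv
  rw [degree_C_mul (by positivity), degree_iterate_derivative_eq h1 (by omega)]
  congr 1
  omega

/-- The derivatives of order `m` of the Legendre polynomials, as a sequence of polynomials. -/
def legendreDerivSequence (m : ℕ) : Polynomial.Sequence ℝ where
  elems' i := legendreDeriv (m + i) m
  degree_eq' i := by rw [degree_legendreDeriv (by omega), Nat.add_sub_cancel_left]

lemma span_legendreDeriv (m : ℕ) :
    Submodule.span ℝ (Set.range fun i => legendreDeriv (m + i) m) = ⊤ :=
  (legendreDerivSequence m).span fun i =>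
    (leadingCoeff_ne_zero.2 ((legendreDerivSequence m).ne_zero i)).isUnit

end Completeness

/-- Lebesgue measure on the meridian `(0, π]`. -/
abbrev meridian : Measure ℝ := volume.restrict (Set.Ioc 0 Real.pi)

lemma sin_pos_ae_meridian : ∀ᵐ θ ∂meridian, 0 < Real.sin θ := by
  have h : meridian = volume.restrict (Set.Ioo 0 Real.pi) :=
    (Measure.restrict_congr_set Ioo_ae_eq_Ioc).symm
  rw [h]
  filter_upwards [ae_restrict_mem measurableSet_Ioo] with θ hθ
  exact Real.sin_pos_of_pos_of_lt_pi hθ.1 hθ.2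

lemma integrable_mul_continuous {f : ℝ → ℂ} (hf : Integrable f meridian) {g : ℝ → ℂ}
    (hg : Continuous g) : Integrable (fun θ => f θ * g θ) meridian := by
  obtain ⟨C, hC⟩ := (isCompact_Icc (a := (0 : ℝ)) (b := Real.pi)).exists_bound_of_continuousOn
    hg.continuousOn
  refine hf.mul_bdd (c := C) hg.aestronglyMeasurable ?_
  filter_upwards [ae_restrict_mem measurableSet_Ioc] with x hx
  exact hC x (Set.Ioc_subset_Icc_self hx)

/-- Trigonometric polynomials in `cos θ` separate integrable functions on the meridian. -/
theorem ae_eq_zero_of_integral_polynomial_cos {H : ℝ → ℂ} (hH : Integrable H meridian)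
    (h : ∀ p : Polynomial ℝ, ∫ θ, H θ * ((p.eval (Real.cos θ) : ℝ) : ℂ) ∂meridian = 0) :
    ∀ᵐ θ ∂meridian, H θ = 0 := by
  refine ae_eq_zero_of_integral_contDiff_smul_eq_zero hH.locallyIntegrable fun g hg _ => ?_
  have hgc : Continuous g := hg.continuous
  rw [← norm_le_zero_iff]
  have hA : 0 ≤ ∫ θ, ‖H θ‖ ∂meridian := integral_nonneg fun _ => norm_nonneg _
  refine le_of_forall_pos_le_add fun ε hε => ?_
  set A := ∫ θ, ‖H θ‖ ∂meridian with hAdef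
  -- Weierstrass approximation in the variable x = cos θ, which is injective on the meridian. The
  -- denominator A + 1 stays positive when H = 0.
  obtain ⟨p, hp⟩ := exists_polynomial_near_of_continuousOn (-1) 1 (fun x => g (Real.arccos x))
    (hgc.comp Real.continuous_arccos).continuousOn (ε / (A + 1)) (by positivity)
  have hpc : Continuous fun θ : ℝ => ((p.eval (Real.cos θ) : ℝ) : ℂ) := by fun_prop
  have hgc' : Continuous fun θ : ℝ => ((g θ : ℝ) : ℂ) := by fun_prop
  have e : ∫ θ, g θ • H θ ∂meridian =
      ∫ θ, (H θ * (g θ : ℂ) - H θ * ((p.eval (Real.cos θ) : ℝ) : ℂ)) ∂meridian := by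
    rw [integral_sub (integrable_mul_continuous hH hgc') (integrable_mul_continuous hH hpc), h p,
      sub_zero]
    refine integral_congr_ae (ae_of_all _ fun θ => ?_)
    simp only [Complex.real_smul]
    ring
  rw [e, zero_add]
  calc _ ≤ ∫ θ, ‖H θ * (g θ : ℂ) - H θ * ((p.eval (Real.cos θ) : ℝ) : ℂ)‖ ∂meridian :=
        norm_integral_le_integral_norm _
    _ ≤ ∫ θ, ε / (A + 1) * ‖H θ‖ ∂meridian := by
        refine integral_mono_ae ((integrable_mul_continuous hH hgc').sub
          (integrable_mul_continuous hH hpc)).norm (hH.norm.const_mul _) ?_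
        filter_upwards [ae_restrict_mem measurableSet_Ioc] with θ hθ
        have h1 := hp (Real.cos θ) ⟨Real.neg_one_le_cos θ, Real.cos_le_one θ⟩
        rw [Real.arccos_cos hθ.1.le hθ.2] at h1
        rw [← mul_sub, norm_mul, mul_comm]
        refine mul_le_mul_of_nonneg_right ?_ (norm_nonneg _)
        rw [← Complex.ofReal_sub, Complex.norm_real, Real.norm_eq_abs, abs_sub_comm]
        exact h1.le
    _ = ε * (A / (A + 1)) := by rw [integral_const_mul]; ring
    _ ≤ ε * 1 := by
        refine mul_le_mul_of_nonneg_left ?_ hε.le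
        rw [div_le_one (by positivity)]
        linarith
    _ = ε := mul_one _

lemma continuous_sqrt_sin : Continuous fun θ : ℝ => (Real.sqrt (Real.sin θ) : ℂ) := by fun_prop

lemma legendreNorm_pos (n m : ℕ) : 0 < legendreNorm n m := Real.sqrt_pos.2 (by positivity)

/-- Completeness of the functions `√sin · trigQ n m`, `n ≥ m`, in `L²(0, π)`. -/
theorem ae_eq_zero_of_integral_trigQ (m : ℕ) {h : ℝ → ℂ} (hh : MemLp h 2 meridian)
    (h0 : ∀ i, ∫ θ, h θ * ((Real.sqrt (Real.sin θ) * trigQ (m + i) m θ : ℝ) : ℂ) ∂meridian = 0) :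
    ∀ᵐ θ ∂meridian, h θ = 0 := by
  have hi : Integrable h meridian := hh.integrable (by norm_num)
  have hwc : Continuous fun θ : ℝ => ((Real.sqrt (Real.sin θ) * Real.sin θ ^ m : ℝ) : ℂ) := by
    fun_prop
  have hH := integrable_mul_continuous hi hwc
  -- With √sin · sin^m absorbed into h, the test functions become the polynomials P_n^{(m)}(cos θ),
  -- which span all polynomials in cos θ because their degrees are 0, 1, 2, ….
  have key : ∀ p : Polynomial ℝ, ∫ θ, (h θ * ((Real.sqrt (Real.sin θ) * Real.sin θ ^ m : ℝ) : ℂ)) *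
      ((p.eval (Real.cos θ) : ℝ) : ℂ) ∂meridian = 0 := by
    intro p
    have hp : p ∈ Submodule.span ℝ (Set.range fun i => legendreDeriv (m + i) m) := by
      rw [span_legendreDeriv]; trivial
    induction hp using Submodule.span_induction with
    | mem p hp =>
      obtain ⟨i, rfl⟩ := hp
      have hN : (legendreNorm (m + i) m : ℂ) ≠ 0 := by
        exact_mod_cast (legendreNorm_pos _ _).ne'
      apply mul_left_cancel₀ hN
      rw [mul_zero, ← h0 i, ← integral_const_mul]
      refine integral_congr_ae (ae_of_all _ fun θ => ?_)
      simp only [trigQ, trigLegendre]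
      push_cast
      ring
    | zero => simp
    | add p q _ _ hp hq =>
      simp only [Polynomial.eval_add, Complex.ofReal_add, mul_add]
      rw [integral_add, hp, hq, add_zero] <;>
      exact integrable_mul_continuous hH (by fun_prop)
    | smul c p _ hp =>
      rw [← mul_zero (c : ℂ), ← hp, ← integral_const_mul]
      refine integral_congr_ae (ae_of_all _ fun θ => ?_)
      simp only [Polynomial.eval_smul, smul_eq_mul, Complex.ofReal_mul]
      ring
  filter_upwards [ae_eq_zero_of_integral_polynomial_cos hH key, sin_pos_ae_meridian] with θ h1 h2
  refine (mul_eq_zero.1 h1).resolve_right ?_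
  have := Real.sqrt_pos.2 h2
  have : Real.sqrt (Real.sin θ) * Real.sin θ ^ m ≠ 0 := by positivity
  exact_mod_cast this

/-! ### Orthogonal series in L² -/

section Hilbert

lemma inner_toLp {α : Type*} [MeasurableSpace α] {μ : Measure α} {u v : α → ℂ}
    (hu : MemLp u 2 μ) (hv : MemLp v 2 μ) :
    inner ℂ hu.toLp hv.toLp = ∫ a, v a * (starRingEnd ℂ) (u a) ∂μ := by
  rw [L2.inner_def]
  refine integral_congr_ae ?_
  filter_upwards [hu.coeFn_toLp, hv.coeFn_toLp] with a h1 h2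
  rw [h1, h2]
  simp [RCLike.inner_apply]

lemma norm_toLp_sq {α : Type*} [MeasurableSpace α] {μ : Measure α} {u : α → ℂ}
    (hu : MemLp u 2 μ) : ‖hu.toLp‖ ^ 2 = ∫ a, ‖u a‖ ^ 2 ∂μ := by
  have h := inner_self_eq_norm_sq_to_K (𝕜 := ℂ) hu.toLp
  rw [inner_toLp] at h
  simp only [Complex.mul_conj, Complex.normSq_eq_norm_sq] at h
  rw [integral_complex_ofReal] at h
  have h2 : ((∫ a, ‖u a‖ ^ 2 ∂μ : ℝ) : ℂ) = ((‖hu.toLp‖ ^ 2 : ℝ) : ℂ) := by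
    rw [h]; push_cast; rfl
  exact (Complex.ofReal_injective h2).symm

/-- The Cauchy criterion. No orthogonality is assumed, because the q_n are not orthogonal in
unweighted L²(0, π). -/
lemma summable_of_sq_norm_sum_le {E ι : Type*} [NormedAddCommGroup E] [CompleteSpace E]
    {x : ι → E} {t : ι → ℝ} (ht : Summable t)
    (h : ∀ I : Finset ι, ‖∑ i ∈ I, x i‖ ^ 2 ≤ ∑ i ∈ I, t i) : Summable x := by
  rw [summable_iff_vanishing_norm] at ht ⊢
  intro ε hε
  obtain ⟨s, hs⟩ := ht (ε ^ 2) (by positivity)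
  refine ⟨s, fun I hI => ?_⟩
  have h1 := (le_abs_self _).trans_lt (hs I hI)
  exact lt_of_pow_lt_pow_left₀ 2 hε.le ((h I).trans_lt h1)

lemma norm_sum_sq_of_orthogonal {E ι : Type*} [NormedAddCommGroup E] [InnerProductSpace ℂ E]
    [DecidableEq ι] {v : ι → E} {lam : ι → ℝ}
    (hv : ∀ i j, inner ℂ (v i) (v j) = if i = j then (lam i : ℂ) else 0) (c : ι → ℂ)
    (I : Finset ι) : ‖∑ i ∈ I, c i • v i‖ ^ 2 = ∑ i ∈ I, lam i * ‖c i‖ ^ 2 := by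
  have h := inner_self_eq_norm_sq_to_K (𝕜 := ℂ) (∑ i ∈ I, c i • v i)
  have h2 : inner ℂ (∑ i ∈ I, c i • v i) (∑ i ∈ I, c i • v i) =
      ((∑ i ∈ I, lam i * ‖c i‖ ^ 2 : ℝ) : ℂ) := by
    rw [sum_inner, Complex.ofReal_sum]
    refine Finset.sum_congr rfl fun i hi => ?_
    rw [inner_sum, Finset.sum_eq_single i]
    · rw [inner_smul_left, inner_smul_right, hv, if_pos rfl, ← mul_assoc, Complex.conj_mul']
      push_cast
      ring
    · intro j _ hj
      rw [inner_smul_left, inner_smul_right, hv, if_neg hj.symm, mul_zero, mul_zero]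
    · exact fun h => absurd hi h
  rw [h2] at h
  have h3 : ((∑ i ∈ I, lam i * ‖c i‖ ^ 2 : ℝ) : ℂ) =
      ((‖∑ i ∈ I, c i • v i‖ ^ 2 : ℝ) : ℂ) := by rw [h]; push_cast; rfl
  exact (Complex.ofReal_injective h3).symm

end Hilbert

/-! ### Identifying the sum of an expansion -/

/-- The coefficient `∫_0^π f · trigQ n m · sin`. -/
def meridianCoef (f : ℝ → ℂ) (n m : ℕ) : ℂ :=
  ∫ θ in (0 : ℝ)..Real.pi, f θ * ((trigQ n m θ * Real.sin θ : ℝ) : ℂ)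

lemma meridianCoef_eq (f : ℝ → ℂ) (n m : ℕ) :
    meridianCoef f n m = ∫ θ, ((Real.sqrt (Real.sin θ) : ℂ) * f θ) *
      ((Real.sqrt (Real.sin θ) * trigQ n m θ : ℝ) : ℂ) ∂meridian := by
  rw [meridianCoef, intervalIntegral.integral_of_le Real.pi_pos.le]
  refine integral_congr_ae ?_
  filter_upwards [sin_pos_ae_meridian] with θ hθ
  have h1 : ((Real.sqrt (Real.sin θ) : ℝ) : ℂ) * (Real.sqrt (Real.sin θ) : ℝ) =
      (Real.sin θ : ℝ) := by
    exact_mod_cast Real.mul_self_sqrt hθ.le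
  rw [Complex.ofReal_mul, ← h1]
  push_cast
  ring

lemma memLp_meridian_of_continuous {f : ℝ → ℂ} (hf : Continuous f) : MemLp f 2 meridian :=
  Continuous.memLp_two_restrict hf 0 Real.pi

lemma memLp_continuous_mul {f g : ℝ → ℂ} (hf : MemLp f 2 meridian) (hg : Continuous g) :
    MemLp (fun θ => g θ * f θ) 2 meridian := by
  obtain ⟨C, hC⟩ := (isCompact_Icc (a := (0 : ℝ)) (b := Real.pi)).exists_bound_of_continuousOn
    hg.continuousOn
  refine MemLp.of_le_mul (c := C) hf (hg.aestronglyMeasurable.mul hf.1) ?_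
  filter_upwards [ae_restrict_mem measurableSet_Ioc] with x hx
  rw [norm_mul]
  exact mul_le_mul_of_nonneg_right (hC x (Set.Ioc_subset_Icc_self hx)) (norm_nonneg _)

lemma continuous_sqrt_sin_mul_trigQ (n m : ℕ) :
    Continuous fun θ : ℝ => ((Real.sqrt (Real.sin θ) * trigQ n m θ : ℝ) : ℂ) := by
  have := continuous_trigQ n m
  fun_prop

/-- If the expansion of `f` converges in `L²(0, π)` after division by a continuous weight, then its
sum is the corresponding multiple of `f`. -/
theorem ae_eq_of_hasSum_meridian {m : ℕ} {f : ℝ → ℂ}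
    (hf : MemLp (fun θ => (Real.sqrt (Real.sin θ) : ℂ) * f θ) 2 meridian)
    {y : ℕ → ℝ → ℂ} (hy : ∀ i, MemLp (y i) 2 meridian) {b : ℝ → ℝ} (hb : Continuous b)
    (hby : ∀ i, ∀ᵐ θ ∂meridian,
      (b θ : ℂ) * y i θ = ((Real.sqrt (Real.sin θ) * trigQ (m + i) m θ : ℝ) : ℂ))
    {g : Lp ℂ 2 meridian}
    (hg : HasSum (fun i => meridianCoef f (m + i) m • (hy i).toLp) g) :
    ∀ᵐ θ ∂meridian, (b θ : ℂ) * g θ = (Real.sqrt (Real.sin θ) : ℂ) * f θ := by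
  have hbc : Continuous fun θ => (b θ : ℂ) := by fun_prop
  have hbg := memLp_continuous_mul (Lp.memLp g) hbc
  -- By completeness it suffices that b g and √sin f have the same integrals against every √sin q_n.
  have h := ae_eq_zero_of_integral_trigQ m (hbg.sub hf) ?_
  · filter_upwards [h] with θ hθ
    exact sub_eq_zero.1 hθ
  intro i
  have hq := continuous_sqrt_sin_mul_trigQ (m + i) m
  have hbq : Continuous fun θ : ℝ =>
      (b θ : ℂ) * ((Real.sqrt (Real.sin θ) * trigQ (m + i) m θ : ℝ) : ℂ) := by fun_prop
  have hL := memLp_meridian_of_continuous hbq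
  simp only [Pi.sub_apply, sub_mul]
  rw [integral_sub (integrable_mul_continuous (hbg.integrable (by norm_num)) hq)
    (integrable_mul_continuous (hf.integrable (by norm_num)) hq), ← meridianCoef_eq, sub_eq_zero]
  -- The inner product with b √sin q_n is applied term by term. The real factor b passes to y_j and
  -- turns it into √sin q_j, so orthonormality leaves a single term.
  have h1 := hg.mapL (innerSL ℂ hL.toLp)
  have h2 : ∀ j, innerSL ℂ hL.toLp (meridianCoef f (m + j) m • (hy j).toLp) =
      if j = i then meridianCoef f (m + i) m else 0 := by
    intro j
    rw [innerSL_apply_apply, inner_smul_right, inner_toLp]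
    have e : ∫ θ, y j θ * (starRingEnd ℂ) ((b θ : ℂ) *
        ((Real.sqrt (Real.sin θ) * trigQ (m + i) m θ : ℝ) : ℂ)) ∂meridian =
        ((∫ θ in (0 : ℝ)..Real.pi, trigQ (m + j) m θ * trigQ (m + i) m θ * Real.sin θ : ℝ) : ℂ) := by
      rw [intervalIntegral.integral_of_le Real.pi_pos.le, ← integral_complex_ofReal]
      refine integral_congr_ae ?_
      filter_upwards [hby j, sin_pos_ae_meridian] with θ h3 h4
      have h5 : ((Real.sqrt (Real.sin θ) : ℝ) : ℂ) * (Real.sqrt (Real.sin θ) : ℝ) =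
          (Real.sin θ : ℝ) := by
        exact_mod_cast Real.mul_self_sqrt h4.le
      rw [map_mul, Complex.conj_ofReal, Complex.conj_ofReal]
      push_cast at h3 h5 ⊢
      linear_combination ((Real.sqrt (Real.sin θ) : ℂ) * trigQ (m + i) m θ) * h3 +
        ((trigQ (m + j) m θ : ℂ) * trigQ (m + i) m θ) * h5
    rw [e, integral_trigQ_mul (by omega)]
    by_cases hji : j = i
    · simp [hji]
    · simp [hji]
  simp only [h2] at h1
  have h3 := h1.unique (hasSum_ite_eq i (meridianCoef f (m + i) m))
  rw [← h3, innerSL_apply_apply]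
  have h4 : g = (Lp.memLp g).toLp := (Lp.toLp_coeFn g (Lp.memLp g)).symm
  conv_rhs => rw [h4]
  rw [inner_toLp]
  refine integral_congr_ae (ae_of_all _ fun θ => ?_)
  simp only [map_mul, Complex.conj_ofReal]
  ring

/-! ### Symmetries, and reduction from the sphere to the meridian -/

lemma e_ne_zero (m : ℤ) (φ : ℝ) : e m φ ≠ 0 := by
  have : Real.sqrt (2 * Real.pi) ≠ 0 := (Real.sqrt_pos.2 Real.two_pi_pos).ne'
  refine mul_ne_zero (one_div_ne_zero ?_) (Complex.exp_ne_zero _)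
  exact_mod_cast this

lemma e_eq (m : ℤ) (φ : ℝ) :
    e m φ = ((1 / Real.sqrt (2 * Real.pi) : ℝ) : ℂ) * Complex.exp ((m * φ : ℝ) * Complex.I) := by
  unfold e
  push_cast
  congr 2
  ring

lemma norm_e_sq (m : ℤ) (φ : ℝ) : ‖e m φ‖ ^ 2 = 1 / (2 * Real.pi) := by
  rw [e_eq, norm_mul, Complex.norm_exp_ofReal_mul_I, mul_one, Complex.norm_real, Real.norm_eq_abs,
    sq_abs, div_pow, one_pow, Real.sq_sqrt Real.two_pi_pos.le]

lemma continuous_e (m : ℤ) : Continuous (e m) := by unfold e; fun_prop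

lemma e_add_pi (m : ℤ) (φ : ℝ) : e m (φ + Real.pi) = (-1) ^ m.natAbs * e m φ := by
  have h : Complex.exp (m * (Real.pi * Complex.I)) = (-1) ^ m.natAbs := by
    rw [Complex.exp_int_mul, Complex.exp_pi_mul_I]
    rcases Int.natAbs_eq m with h | h
    · conv_lhs => rw [h]
      rw [zpow_natCast]
    · conv_lhs => rw [h]
      rw [zpow_neg, zpow_natCast]
      rcases neg_one_pow_eq_or ℂ m.natAbs with h | h <;> simp [h]
  unfold e
  rw [← h, mul_left_comm, ← Complex.exp_add]
  congr 2
  push_cast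
  ring

/-- `f` is `2π`-periodic with `f(-θ) = (-1)^m f(θ)`, almost everywhere. -/
def MeridianSymm (m : ℕ) (f : ℝ → ℂ) : Prop :=
  (∀ᵐ θ : ℝ, f (θ + 2 * Real.pi) = f θ) ∧ ∀ᵐ θ : ℝ, f (-θ) = (-1) ^ m * f θ

/-- By Fubini, for almost every θ the symmetries hold at some φ, where the nonzero factor e_m(φ) can
be cancelled. The shift by π in φ leaves the sign (-1)^m. -/
lemma SphereSymm.meridianSymm {m : ℤ} {f : ℝ → ℂ} (h : SphereSymm (tensorE f m)) :
    MeridianSymm m.natAbs f := by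
  unfold SphereSymm at h
  rw [Measure.volume_eq_prod] at h
  have h2 := Measure.ae_ae_of_ae_prod h
  constructor
  · filter_upwards [h2] with θ hθ
    obtain ⟨φ, h1, -, -⟩ := hθ.exists
    simp only [tensorE] at h1
    exact (mul_right_cancel₀ (e_ne_zero m φ) h1).symm
  · filter_upwards [h2] with θ hθ
    obtain ⟨φ, -, -, h1⟩ := hθ.exists
    simp only [tensorE] at h1
    rw [e_add_pi] at h1
    have h3 : f θ = f (-θ) * (-1) ^ m.natAbs :=
      mul_right_cancel₀ (e_ne_zero m φ) (by rw [h1]; ring)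
    have h4 : ((-1 : ℂ) ^ m.natAbs) * (-1) ^ m.natAbs = 1 := by rw [← mul_pow]; simp
    rw [h3]
    linear_combination (-f (-θ)) * h4

lemma MeridianSymm.two_pi_sub {m : ℕ} {f : ℝ → ℂ} (h : MeridianSymm m f) :
    ∀ᵐ θ : ℝ, f (2 * Real.pi - θ) = (-1) ^ m * f θ := by
  have h1 := (Measure.measurePreserving_neg (volume : Measure ℝ)).quasiMeasurePreserving.ae h.1
  filter_upwards [h.2, h1] with θ h2 h3
  rw [← h2, ← h3]
  congr 1
  ring

lemma ae_forall_periodic {f : ℝ → ℂ} {T : ℝ} (h : ∀ᵐ θ : ℝ, f (θ + T) = f θ) :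
    ∀ᵐ θ : ℝ, ∀ j : ℤ, f (θ + j * T) = f θ := by
  have h1 : ∀ᵐ θ : ℝ, ∀ j : ℤ, f (θ + j * T + T) = f (θ + j * T) :=
    ae_all_iff.2 fun j =>
      (measurePreserving_add_right (volume : Measure ℝ) (j * T)).quasiMeasurePreserving.ae h
  filter_upwards [h1] with θ hθ j
  induction j using Int.induction_on with
  | zero => simp
  | succ i ih =>
    rw [← ih, ← hθ i]
    congr 1
    push_cast
    ring
  | pred i ih =>
    rw [← ih]
    have := hθ (-i - 1)
    rw [← this]
    congr 1
    push_cast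
    ring

/-- Periodicity holds only almost everywhere, so f is first replaced by the genuinely periodic
extension of its restriction to one period. -/
lemma locallyIntegrable_of_periodic {f : ℝ → ℂ}
    (hf : IntegrableOn f (Set.Ioc 0 (2 * Real.pi)) volume)
    (h : ∀ᵐ θ : ℝ, f (θ + 2 * Real.pi) = f θ) : LocallyIntegrable f volume := by
  let g : ℝ → ℂ := fun θ => f (toIocMod Real.two_pi_pos 0 θ)
  have hgp : Function.Periodic g (2 * Real.pi) := fun θ => by
    simp only [g, toIocMod_add_right]
  have hfg : g =ᵐ[volume] f := by
    filter_upwards [ae_forall_periodic h] with θ hθ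
    simp only [g]
    rw [← self_sub_toIocDiv_zsmul]
    have := hθ (-toIocDiv Real.two_pi_pos 0 θ)
    rw [← this]
    congr 1
    simp [sub_eq_add_neg]
  have hg0 : IntervalIntegrable g volume 0 (0 + 2 * Real.pi) := by
    rw [zero_add, intervalIntegrable_iff_integrableOn_Ioc_of_le Real.two_pi_pos.le]
    exact hf.congr (ae_restrict_of_ae hfg.symm)
  have hg := hgp.intervalIntegrable Real.two_pi_pos.ne' hg0
  rw [locallyIntegrable_iff]
  intro K hK
  obtain ⟨R, hR⟩ := hK.isBounded.subset_closedBall 0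
  have h1 : IntegrableOn g (Set.Icc (-|R|) |R|) volume :=
    (intervalIntegrable_iff_integrableOn_Icc_of_le (by linarith [abs_nonneg R])).1 (hg _ _)
  have h2 : IntegrableOn f (Set.Icc (-|R|) |R|) volume := h1.congr (ae_restrict_of_ae hfg)
  refine h2.mono_set (hR.trans ?_)
  rw [Real.closedBall_eq_Icc]
  exact Set.Icc_subset_Icc (by linarith [le_abs_self R]) (by linarith [le_abs_self R])

/-- The interval (π, 2π) is reflected back onto (0, π). Two functions are allowed so that both |f|²
and the integrand of a Fourier coefficient are covered. -/
lemma integral_two_pi_eq {E : Type*} [NormedAddCommGroup E] [NormedSpace ℝ E] {h h' : ℝ → E}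
    (hs : ∀ᵐ θ : ℝ, h (2 * Real.pi - θ) = h' θ)
    (hh : IntervalIntegrable h volume 0 Real.pi) (hh' : IntervalIntegrable h' volume 0 Real.pi) :
    IntervalIntegrable h volume 0 (2 * Real.pi) ∧
      ∫ θ in (0 : ℝ)..(2 * Real.pi), h θ =
        (∫ θ in (0 : ℝ)..Real.pi, h θ) + ∫ θ in (0 : ℝ)..Real.pi, h' θ := by
  have h1 : IntervalIntegrable (fun θ => h (2 * Real.pi - θ)) volume 0 Real.pi :=
    hh'.congr_ae (ae_restrict_of_ae (hs.mono fun θ hθ => hθ.symm))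
  have h2 : IntervalIntegrable h volume Real.pi (2 * Real.pi) := by
    have := (h1.comp_sub_left (2 * Real.pi)).symm
    simpa [show 2 * Real.pi - Real.pi = Real.pi by ring] using this
  refine ⟨hh.trans h2, ?_⟩
  rw [← intervalIntegral.integral_add_adjacent_intervals hh h2]
  congr 1
  rw [← intervalIntegral.integral_congr_ae (hs.mono fun θ hθ _ => hθ),
    intervalIntegral.integral_comp_sub_left]
  congr 1 <;> ring

lemma MeridianSymm.integral_norm_sq {m : ℕ} {f : ℝ → ℂ} (h : MeridianSymm m f)
    (hf : MemLp f 2 meridian) :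
    IntervalIntegrable (fun θ => ‖f θ‖ ^ 2) volume 0 (2 * Real.pi) ∧
    ∫ θ in (0 : ℝ)..(2 * Real.pi), ‖f θ‖ ^ 2 = 2 * ∫ θ in (0 : ℝ)..Real.pi, ‖f θ‖ ^ 2 := by
  have hi : IntervalIntegrable (fun θ => ‖f θ‖ ^ 2) volume 0 Real.pi := by
    rw [intervalIntegrable_iff_integrableOn_Ioc_of_le Real.pi_pos.le]
    exact (memLp_two_iff_integrable_sq_norm hf.1).1 hf
  have h1 := integral_two_pi_eq (h := fun θ => ‖f θ‖ ^ 2) (h' := fun θ => ‖f θ‖ ^ 2)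
    (h.two_pi_sub.mono fun θ hθ => by rw [hθ]; simp) hi hi
  refine ⟨h1.1, ?_⟩
  rw [h1.2]
  ring

lemma MeridianSymm.memLp_two_pi {m : ℕ} {f : ℝ → ℂ} (h : MeridianSymm m f)
    (hm : AEStronglyMeasurable f volume) (hf : MemLp f 2 meridian) :
    MemLp f 2 (volume.restrict (Set.Ioc 0 (2 * Real.pi))) := by
  rw [memLp_two_iff_integrable_sq_norm hm.restrict]
  exact (intervalIntegrable_iff_integrableOn_Ioc_of_le Real.two_pi_pos.le).1
    (h.integral_norm_sq hf).1

/-- The kernel computing Fourier coefficients of symmetric functions from the meridian. -/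
def meridianKernel (m : ℕ) (k : ℤ) (θ : ℝ) : ℂ :=
  1 / (2 * (Real.pi : ℂ)) * (Complex.exp (-(Complex.I * (k : ℂ) * (θ : ℂ))) +
    (-1) ^ m * Complex.exp (Complex.I * (k : ℂ) * (θ : ℂ)))

lemma continuous_meridianKernel (m : ℕ) (k : ℤ) : Continuous (meridianKernel m k) := by
  unfold meridianKernel; fun_prop

/-- This makes each Fourier coefficient a continuous functional on L²(0, π), applicable term by term
to expansions that converge there. -/
lemma MeridianSymm.fourierCoef_eq {m : ℕ} {f : ℝ → ℂ} (h : MeridianSymm m f)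
    (hf : MemLp f 2 meridian) (k : ℤ) :
    fourierCoef f k = ∫ θ, f θ * meridianKernel m k θ ∂meridian := by
  have hi : Integrable f meridian := hf.integrable (by norm_num)
  have i1 := integrable_mul_continuous hi
    (g := fun θ : ℝ => Complex.exp (-(Complex.I * (k : ℂ) * (θ : ℂ)))) (by fun_prop)
  have i2 := integrable_mul_continuous hi
    (g := fun θ : ℝ => (-1) ^ m * Complex.exp (Complex.I * (k : ℂ) * (θ : ℂ))) (by fun_prop)
  have h1 := integral_two_pi_eq
    (h := fun θ : ℝ => f θ * Complex.exp (-(Complex.I * (k : ℂ) * (θ : ℂ))))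
    (h' := fun θ : ℝ => f θ * ((-1) ^ m * Complex.exp (Complex.I * (k : ℂ) * (θ : ℂ))))
    (h.two_pi_sub.mono fun θ hθ => by
      have e := exp_neg_int_two_pi k
      have e2 : Complex.exp (-(Complex.I * (k : ℂ) * ((2 * Real.pi - θ : ℝ) : ℂ))) =
          Complex.exp (Complex.I * (k : ℂ) * (θ : ℂ)) := by
        rw [← one_mul (Complex.exp (Complex.I * (k : ℂ) * (θ : ℂ))), ← e, ← Complex.exp_add]
        congr 1
        push_cast
        ring
      rw [hθ, e2]
      ring)
    ((intervalIntegrable_iff_integrableOn_Ioc_of_le Real.pi_pos.le).2 i1)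
    ((intervalIntegrable_iff_integrableOn_Ioc_of_le Real.pi_pos.le).2 i2)
  rw [fourierCoef, h1.2, intervalIntegral.integral_of_le Real.pi_pos.le,
    intervalIntegral.integral_of_le Real.pi_pos.le, ← integral_add i1 i2, ← integral_const_mul]
  refine integral_congr_ae (ae_of_all _ fun θ => ?_)
  simp only [meridianKernel]
  ring

lemma meridianSymm_trigQ (n m : ℕ) : MeridianSymm m (fun θ => (trigQ n m θ : ℂ)) := by
  constructor
  · refine ae_of_all _ fun θ => ?_
    simp only [trigQ, periodic_trigLegendre n m θ]
  · refine ae_of_all _ fun θ => ?_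
    simp only [trigQ, trigLegendre_neg]
    push_cast
    ring

lemma meridianSymm_sum {ι : Type*} (I : Finset ι) {m : ℕ} (c : ι → ℂ) {f : ι → ℝ → ℂ}
    (h : ∀ i ∈ I, MeridianSymm m (f i)) : MeridianSymm m (fun θ => ∑ i ∈ I, c i * f i θ) := by
  constructor
  · have h1 : ∀ᵐ θ : ℝ, ∀ i ∈ I, f i (θ + 2 * Real.pi) = f i θ :=
      (Finset.eventually_all I).2 fun i hi => (h i hi).1
    filter_upwards [h1] with θ hθ
    exact Finset.sum_congr rfl fun i hi => by rw [hθ i hi]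
  · have h1 : ∀ᵐ θ : ℝ, ∀ i ∈ I, f i (-θ) = (-1) ^ m * f i θ :=
      (Finset.eventually_all I).2 fun i hi => (h i hi).2
    filter_upwards [h1] with θ hθ
    rw [Finset.mul_sum]
    exact Finset.sum_congr rfl fun i hi => by rw [hθ i hi]; ring

lemma integral_e_mul_conj (m m' : ℤ) :
    ∫ φ in (0 : ℝ)..(2 * Real.pi), e m φ * (starRingEnd ℂ) (e m' φ) = if m = m' then 1 else 0 := by
  rw [← fourierCoef_exp m m', fourierCoef, ← intervalIntegral.integral_const_mul]
  refine intervalIntegral.integral_congr fun φ _ => ?_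
  have h : ((1 / Real.sqrt (2 * Real.pi) : ℝ) : ℂ) * (1 / Real.sqrt (2 * Real.pi) : ℝ) =
      1 / (2 * (Real.pi : ℂ)) := by
    rw [← Complex.ofReal_mul, div_mul_div_comm, Real.mul_self_sqrt Real.two_pi_pos.le]
    push_cast
    ring
  simp only [e_eq, map_mul, Complex.conj_ofReal, ← Complex.exp_conj, Complex.conj_I]
  rw [← h]
  have e1 : ((m * φ : ℝ) : ℂ) * Complex.I = Complex.I * m * φ := by push_cast; ring
  have e2 : ((m' * φ : ℝ) : ℂ) * -Complex.I = -(Complex.I * m' * φ) := by push_cast; ring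
  rw [e1, e2]
  ring

/-- Orthogonality in φ removes every order but m. The signs have modulus one and disappear from all
norms. -/
lemma sphereCoeff_tensorE (f : ℝ → ℂ) (m : ℤ) (n : ℕ) (m' : ℤ) :
    sphereCoeff (tensorE f m) n m' =
      (if m = m' then 1 else 0) * ((-1) ^ ((m' + |m'|) / 2) * ((-1) ^ m'.natAbs *
        meridianCoef f n m'.natAbs)) := by
  have hs : ∀ j : ℤ, (starRingEnd ℂ) ((-1 : ℂ) ^ j) = (-1) ^ j := fun j => by
    rw [map_zpow₀, map_neg, map_one]
  have h1 : ∀ θ : ℝ, (∫ φ in (0 : ℝ)..(2 * Real.pi),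
      tensorE f m (θ, φ) * (starRingEnd ℂ) (Y n m' θ φ) * (Real.sin θ : ℂ)) =
      (f θ * (-1) ^ ((m' + |m'|) / 2) * (Q n m' θ : ℂ) * (Real.sin θ : ℂ)) *
        (if m = m' then 1 else 0) := by
    intro θ
    rw [← integral_e_mul_conj, ← intervalIntegral.integral_const_mul]
    refine intervalIntegral.integral_congr fun φ _ => ?_
    simp only [tensorE, Y, map_mul, Complex.conj_ofReal, hs]
    ring
  rw [sphereCoeff, meridianCoef]
  simp only [h1]
  rw [intervalIntegral.integral_mul_const, mul_comm]
  congr 1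
  rw [← intervalIntegral.integral_const_mul, ← intervalIntegral.integral_const_mul]
  refine intervalIntegral.integral_congr fun θ hθ => ?_
  rw [Set.uIcc_of_le Real.pi_pos.le] at hθ
  simp only [Q_eq_trigQ n m' hθ]
  push_cast
  ring

/-- The terms of the squared norm of `W_m^s`, indexed by `n - |m|`. -/
def meridianTerm (s : ℝ) (f : ℝ → ℂ) (m i : ℕ) : ℝ :=
  (((m + i : ℕ) : ℝ) + 1 / 2) ^ (2 * s) * ‖meridianCoef f (m + i) m‖ ^ 2

lemma meridianTerm_nonneg (s : ℝ) (f : ℝ → ℂ) (m i : ℕ) : 0 ≤ meridianTerm s f m i := by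
  unfold meridianTerm; positivity

lemma sphereTerm_tensorE (s : ℝ) (f : ℝ → ℂ) (m : ℤ) (i : ℕ) :
    sphereTerm s (tensorE f m) (m, m.natAbs + i) = meridianTerm s f m.natAbs i := by
  unfold sphereTerm meridianTerm
  rw [if_pos (by simp), sphereCoeff_tensorE]
  simp only [if_true, one_mul, norm_mul, norm_pow, norm_neg, norm_one, one_pow, norm_zpow,
    one_zpow]

lemma sphereTerm_tensorE_support (s : ℝ) (f : ℝ → ℂ) (m : ℤ) (p : ℤ × ℕ)
    (hp : p ∉ Set.range fun i : ℕ => (m, m.natAbs + i)) : sphereTerm s (tensorE f m) p = 0 := by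
  unfold sphereTerm
  split_ifs with h
  · by_cases hm : m = p.1
    · refine absurd ⟨p.2 - m.natAbs, ?_⟩ hp
      subst hm
      ext
      · rfl
      · simp only; omega
    · rw [sphereCoeff_tensorE, if_neg hm, zero_mul, norm_zero]
      simp
  · rfl

lemma injective_meridian_index (m : ℤ) :
    Function.Injective fun i : ℕ => ((m, m.natAbs + i) : ℤ × ℕ) := by
  intro a b h
  simpa using h

lemma summable_sphereTerm_iff (s : ℝ) (f : ℝ → ℂ) (m : ℤ) :
    Summable (sphereTerm s (tensorE f m)) ↔ Summable (meridianTerm s f m.natAbs) := by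
  rw [← (injective_meridian_index m).summable_iff (sphereTerm_tensorE_support s f m)]
  exact iff_of_eq (congrArg Summable (funext fun i => sphereTerm_tensorE s f m i))

lemma normW_eq (m : ℤ) (s : ℝ) (f : ℝ → ℂ) :
    normW m s f = Real.sqrt (∑' i, meridianTerm s f m.natAbs i) := by
  unfold normW normHSphere
  congr 1
  rw [← (injective_meridian_index m).tsum_eq]
  · exact tsum_congr fun i => sphereTerm_tensorE s f m i
  · intro p hp
    by_contra h
    exact hp (sphereTerm_tensorE_support s f m p h)

lemma normH_eq (r : ℝ) (f : ℝ → ℂ) :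
    normH r f = Real.sqrt (∑' k, sobolevWeight r k * ‖fourierCoef f k‖ ^ 2) := by
  unfold normH
  simp only [periodicTerm_eq]

lemma norm_tensorE_sq (f : ℝ → ℂ) (m : ℤ) (p : ℝ × ℝ) :
    ‖tensorE f m p‖ ^ 2 * Real.sin p.1 = (‖f p.1‖ ^ 2 * Real.sin p.1) * (1 / (2 * Real.pi)) := by
  rw [tensorE, norm_mul, mul_pow, norm_e_sq]
  ring

lemma restrict_prod_eq : (volume : Measure (ℝ × ℝ)).restrict
      (Set.Icc 0 Real.pi ×ˢ Set.Icc 0 (2 * Real.pi)) =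
    (volume.restrict (Set.Icc 0 Real.pi)).prod (volume.restrict (Set.Icc 0 (2 * Real.pi))) := by
  rw [Measure.volume_eq_prod, Measure.prod_restrict]

lemma restrict_Icc_two_pi_ne_zero :
    (volume : Measure ℝ).restrict (Set.Icc 0 (2 * Real.pi)) ≠ 0 := by
  rw [Ne, Measure.restrict_eq_zero, Real.volume_Icc]
  simp [Real.pi_pos]

lemma integrableOn_tensorE_iff (f : ℝ → ℂ) (m : ℤ) :
    IntegrableOn (fun p : ℝ × ℝ => ‖tensorE f m p‖ ^ 2 * Real.sin p.1)
      (Set.Icc 0 Real.pi ×ˢ Set.Icc 0 (2 * Real.pi)) volume ↔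
    Integrable (fun θ => ‖f θ‖ ^ 2 * Real.sin θ) meridian := by
  unfold IntegrableOn
  simp only [norm_tensorE_sq]
  rw [restrict_prod_eq, integrable_mul_const_iff (by simp [Real.pi_ne_zero]),
    Integrable.comp_fst_iff restrict_Icc_two_pi_ne_zero
      (f := fun θ => ‖f θ‖ ^ 2 * Real.sin θ)]
  have : meridian = volume.restrict (Set.Icc 0 Real.pi) :=
    Measure.restrict_congr_set Ioc_ae_eq_Icc
  rw [this]

lemma memLp_sqrt_sin_mul_iff {f : ℝ → ℂ} (hf : AEStronglyMeasurable f meridian) :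
    MemLp (fun θ => (Real.sqrt (Real.sin θ) : ℂ) * f θ) 2 meridian ↔
      Integrable (fun θ => ‖f θ‖ ^ 2 * Real.sin θ) meridian := by
  have h : AEStronglyMeasurable (fun θ => (Real.sqrt (Real.sin θ) : ℂ) * f θ) meridian :=
    continuous_sqrt_sin.aestronglyMeasurable.mul hf
  rw [memLp_two_iff_integrable_sq_norm h]
  refine integrable_congr ?_
  filter_upwards [sin_pos_ae_meridian] with θ hθ
  rw [norm_mul, mul_pow, Complex.norm_real, Real.norm_eq_abs, sq_abs, Real.sq_sqrt hθ.le]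
  ring

/-- What membership in `W_m^s` says on the meridian. -/
theorem memW_iff (m : ℤ) (s : ℝ) (f : ℝ → ℂ) :
    MemW m s f ↔ LocallyIntegrable f volume ∧ SphereSymm (tensorE f m) ∧
      MemLp (fun θ => (Real.sqrt (Real.sin θ) : ℂ) * f θ) 2 meridian ∧
      Summable (meridianTerm s f m.natAbs) := by
  unfold MemW MemHSphere MemL2Sphere
  rw [summable_sphereTerm_iff, integrableOn_tensorE_iff]
  constructor
  · rintro ⟨h1, ⟨-, h3, h4⟩, h5⟩
    exact ⟨h1, h3, (memLp_sqrt_sin_mul_iff h1.aestronglyMeasurable.restrict).2 h4, h5⟩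
  · rintro ⟨h1, h3, h4, h5⟩
    refine ⟨h1, ⟨?_, h3, (memLp_sqrt_sin_mul_iff h1.aestronglyMeasurable.restrict).1 h4⟩, h5⟩
    rw [Measure.volume_eq_prod]
    exact h1.aestronglyMeasurable.comp_fst.mul
      ((continuous_e m).comp continuous_snd).aestronglyMeasurable

lemma inner_sqrt_sin_mul_trigQ (m i j : ℕ) :
    inner ℂ (memLp_meridian_of_continuous (continuous_sqrt_sin_mul_trigQ (m + i) m)).toLp
      (memLp_meridian_of_continuous (continuous_sqrt_sin_mul_trigQ (m + j) m)).toLp =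
      if i = j then ((1 : ℝ) : ℂ) else 0 := by
  rw [inner_toLp]
  have e : ∫ θ, ((Real.sqrt (Real.sin θ) * trigQ (m + j) m θ : ℝ) : ℂ) * (starRingEnd ℂ)
      ((Real.sqrt (Real.sin θ) * trigQ (m + i) m θ : ℝ) : ℂ) ∂meridian =
      ((∫ θ in (0 : ℝ)..Real.pi, trigQ (m + i) m θ * trigQ (m + j) m θ * Real.sin θ : ℝ) : ℂ) := by
    rw [intervalIntegral.integral_of_le Real.pi_pos.le, ← integral_complex_ofReal]
    refine integral_congr_ae ?_
    filter_upwards [sin_pos_ae_meridian] with θ h4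
    rw [Complex.conj_ofReal, ← Complex.ofReal_mul]
    congr 1
    have h5 := Real.mul_self_sqrt h4.le
    linear_combination (trigQ (m + i) m θ * trigQ (m + j) m θ) * h5
  rw [e, integral_trigQ_mul (by omega)]
  by_cases h : i = j
  · simp [h]
  · simp [h]

lemma inner_sqrt_sin_mul_trigQ_eq_meridianCoef {m : ℕ} {f : ℝ → ℂ}
    (hf : MemLp (fun θ => (Real.sqrt (Real.sin θ) : ℂ) * f θ) 2 meridian) (i : ℕ) :
    inner ℂ (memLp_meridian_of_continuous (continuous_sqrt_sin_mul_trigQ (m + i) m)).toLp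
      hf.toLp = meridianCoef f (m + i) m := by
  rw [inner_toLp, meridianCoef_eq]
  simp only [Complex.conj_ofReal]

/-! ### Bessel and Parseval on the meridian; the embedding of order zero -/

/-- Bessel's inequality for the expansion in `trigQ`. -/
theorem sum_sq_meridianCoef_le {m : ℕ} {f : ℝ → ℂ} (hf : MemLp f 2 meridian) (I : Finset ℕ) :
    ∑ i ∈ I, ‖meridianCoef f (m + i) m‖ ^ 2 ≤ ∫ θ in (0 : ℝ)..Real.pi, ‖f θ‖ ^ 2 := by
  have hf' := memLp_continuous_mul hf continuous_sqrt_sin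
  have h := bessel_of_orthogonal (inner_sqrt_sin_mul_trigQ m) hf'.toLp I
  simp only [inner_sqrt_sin_mul_trigQ_eq_meridianCoef, div_one] at h
  refine h.trans ?_
  rw [norm_toLp_sq, intervalIntegral.integral_of_le Real.pi_pos.le]
  refine integral_mono_ae ((memLp_two_iff_integrable_sq_norm hf'.1).1 hf')
    ((memLp_two_iff_integrable_sq_norm hf.1).1 hf) ?_
  filter_upwards [sin_pos_ae_meridian] with θ hθ
  rw [norm_mul, mul_pow, Complex.norm_real, Real.norm_eq_abs, sq_abs, Real.sq_sqrt hθ.le]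
  exact mul_le_of_le_one_left (sq_nonneg _) (Real.sin_le_one θ)

/-- Parseval's identity for symmetric functions, on the meridian. -/
lemma MeridianSymm.hasSum_sq_fourierCoef {m : ℕ} {f : ℝ → ℂ} (h : MeridianSymm m f)
    (hf : MemLp f 2 meridian)
    (hf2 : MemLp f 2 (volume.restrict (Set.Ioc 0 (2 * Real.pi)))) :
    HasSum (fun k => ‖fourierCoef f k‖ ^ 2)
      (Real.pi⁻¹ * ∫ θ in (0 : ℝ)..Real.pi, ‖f θ‖ ^ 2) := by
  have h1 := SphereSobolev.hasSum_sq_fourierCoef hf2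
  rw [(h.integral_norm_sq hf).2] at h1
  have e : (2 * Real.pi)⁻¹ * (2 * ∫ θ in (0 : ℝ)..Real.pi, ‖f θ‖ ^ 2) =
      Real.pi⁻¹ * ∫ θ in (0 : ℝ)..Real.pi, ‖f θ‖ ^ 2 := by
    have := Real.pi_ne_zero
    field_simp
  rwa [e] at h1

lemma memLp_meridian_of_memLp {f : ℝ → ℂ}
    (hf2 : MemLp f 2 (volume.restrict (Set.Ioc 0 (2 * Real.pi)))) : MemLp f 2 meridian :=
  hf2.mono_measure (Measure.restrict_mono
    (Set.Ioc_subset_Ioc_right (by linarith [Real.pi_pos])) le_rfl)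

lemma sobolevWeight_zero (k : ℤ) : sobolevWeight 0 k = 1 := by simp [sobolevWeight]

/-- The embedding of `H^0_#` into `W_m^0`. -/
theorem memW_zero_of_memH_zero (m : ℤ) (f : ℝ → ℂ) (hs : SphereSymm (tensorE f m))
    (hf : MemH 0 f) : MemW m 0 f ∧ normW m 0 f ≤ Real.sqrt Real.pi * normH 0 f := by
  obtain ⟨h2, hper, -⟩ := hf
  have hsym := hs.meridianSymm
  have hm := memLp_meridian_of_memLp h2
  have hP := hsym.hasSum_sq_fourierCoef hm h2
  have hb := sum_sq_meridianCoef_le (m := m.natAbs) hm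
  have ht : ∀ i, meridianTerm 0 f m.natAbs i = ‖meridianCoef f (m.natAbs + i) m.natAbs‖ ^ 2 := by
    intro i; simp [meridianTerm]
  have hsum : Summable (meridianTerm 0 f m.natAbs) :=
    summable_of_sum_le (meridianTerm_nonneg _ _ _) fun I => by simpa only [ht] using hb I
  refine ⟨(memW_iff m 0 f).2 ⟨locallyIntegrable_of_periodic (h2.integrable (by norm_num)) hper, hs,
    memLp_continuous_mul hm continuous_sqrt_sin, hsum⟩, ?_⟩
  rw [normW_eq, normH_eq, ← Real.sqrt_mul Real.pi_pos.le]
  refine Real.sqrt_le_sqrt ?_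
  simp only [sobolevWeight_zero, one_mul]
  -- The constant π is that of Parseval's identity on the half circle.
  rw [hP.tsum_eq, mul_inv_cancel_left₀ Real.pi_ne_zero]
  exact hsum.tsum_le_of_sum_le fun I => by simpa only [ht] using hb I

/-! ### The trace theorem -/

/-- The trace inequality for finite sums, indexed by `n - m`. -/
lemma exists_trace_finite_shift {r : ℝ} (hr : 0 < r) :
    ∃ C : ℝ, 0 < C ∧ ∀ (m : ℕ) (f : ℝ → ℂ) (J : Finset ℕ) (K : Finset ℤ),
      ∑ k ∈ K, sobolevWeight r k * ‖∑ i ∈ J, meridianCoef f (m + i) m *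
          fourierCoef (fun θ => (trigQ (m + i) m θ : ℂ)) k‖ ^ 2 ≤
        C * ∑ i ∈ J, meridianTerm (r + 1 / 2) f m i := by
  obtain ⟨C, hC, h⟩ := exists_trace_finite hr
  refine ⟨C, hC, fun m f J K => ?_⟩
  have h1 := h m (J.map (addLeftEmbedding m)) (by
    intro n hn
    obtain ⟨i, -, rfl⟩ := Finset.mem_map.1 hn
    simp) (fun n => meridianCoef f n m) K
  simpa only [Finset.sum_map, addLeftEmbedding_apply, meridianTerm] using h1

lemma memLp_ofReal_trigQ (n m : ℕ) : MemLp (fun θ => (trigQ n m θ : ℂ)) 2 meridian :=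
  memLp_meridian_of_continuous (Complex.continuous_ofReal.comp (continuous_trigQ n m))

lemma norm_sum_smul_toLp_sq {α : Type*} [MeasurableSpace α] {μ : Measure α} {y : ℕ → α → ℂ}
    (hy : ∀ i, MemLp (y i) 2 μ) (c : ℕ → ℂ) (J : Finset ℕ) :
    ‖∑ i ∈ J, c i • (hy i).toLp‖ ^ 2 = ∫ a, ‖∑ i ∈ J, c i * y i a‖ ^ 2 ∂μ := by
  have hS : MemLp (fun a => ∑ i ∈ J, c i * y i a) 2 μ :=
    memLp_finsetSum J fun i _ => (hy i).const_mul (c i)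
  rw [← norm_toLp_sq hS]
  congr 2
  refine Lp.ext ?_
  have h1 : ∀ᵐ a ∂μ, ∀ i ∈ J, (c i • (hy i).toLp : Lp ℂ 2 μ) a = c i * y i a := by
    refine (Finset.eventually_all J).2 fun i _ => ?_
    filter_upwards [Lp.coeFn_smul (c i) (hy i).toLp, (hy i).coeFn_toLp] with a h2 h3
    rw [h2, Pi.smul_apply, h3, smul_eq_mul]
  filter_upwards [hS.coeFn_toLp, Lp.coeFn_finsetSum J fun i => c i • (hy i).toLp, h1]
    with a h2 h3 h4
  rw [h2, h3, Finset.sum_apply]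
  exact Finset.sum_congr rfl h4

/-- The expansion of a function of `W_m^{r+1/2}` converges in `L²(0, π)`. -/
theorem exists_hasSum_toLp_trigQ {r : ℝ} (hr : 0 < r) {m : ℕ} {f : ℝ → ℂ}
    (hf : MemLp (fun θ => (Real.sqrt (Real.sin θ) : ℂ) * f θ) 2 meridian)
    (hs : Summable (meridianTerm (r + 1 / 2) f m)) :
    -- Square integrability of f without the weight sin is itself a conclusion, needed before the
    -- limit can be named.
    ∃ hm : AEStronglyMeasurable f meridian → MemLp f 2 meridian,
      ∀ hfm : AEStronglyMeasurable f meridian,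
      HasSum (fun i => meridianCoef f (m + i) m • (memLp_ofReal_trigQ (m + i) m).toLp)
        (hm hfm).toLp := by
  obtain ⟨C, hC, hfin⟩ := exists_trace_finite_shift hr
  have hx : Summable (fun i => meridianCoef f (m + i) m • (memLp_ofReal_trigQ (m + i) m).toLp) := by
    -- The L² norm of a finite sum is computed by Parseval, with the factor π, and the Sobolev
    -- weights are at least 1, so the finite trace inequality applies.
    refine summable_of_sq_norm_sum_le (hs.mul_left (Real.pi * C)) fun J => ?_
    rw [norm_sum_smul_toLp_sq, ← Finset.mul_sum]
    have hc : ∀ i, Continuous fun θ : ℝ => (trigQ (m + i) m θ : ℂ) := fun i =>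
      Complex.continuous_ofReal.comp (continuous_trigQ _ m)
    have hSc : Continuous fun θ : ℝ =>
        ∑ i ∈ J, meridianCoef f (m + i) m * (trigQ (m + i) m θ : ℂ) :=
      continuous_finsetSum _ fun i _ => continuous_const.mul (hc i)
    have hP := (meridianSymm_sum J (fun i => meridianCoef f (m + i) m)
      (fun i _ => meridianSymm_trigQ (m + i) m)).hasSum_sq_fourierCoef
      (memLp_meridian_of_continuous hSc) (Continuous.memLp_two_restrict hSc _ _)
    have hle : Real.pi⁻¹ * ∫ θ in (0 : ℝ)..Real.pi,
        ‖∑ i ∈ J, meridianCoef f (m + i) m * (trigQ (m + i) m θ : ℂ)‖ ^ 2 ≤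
        C * ∑ i ∈ J, meridianTerm (r + 1 / 2) f m i := by
      refine hasSum_le_of_sum_le hP fun K => ?_
      refine le_trans (Finset.sum_le_sum fun k _ => ?_) (hfin m f J K)
      rw [fourierCoef_finset_sum J _ hc]
      exact le_mul_of_one_le_left (sq_nonneg _) (one_le_sobolevWeight hr.le k)
    rw [intervalIntegral.integral_of_le Real.pi_pos.le, inv_mul_le_iff₀ Real.pi_pos] at hle
    rwa [mul_assoc]
  obtain ⟨g, hg⟩ := hx
  have hgf := ae_eq_of_hasSum_meridian hf (fun i => memLp_ofReal_trigQ (m + i) m)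
    (b := fun θ => Real.sqrt (Real.sin θ)) (by fun_prop)
    (fun i => ae_of_all _ fun θ => by push_cast; rfl) hg
  have hgf' : (g : ℝ → ℂ) =ᵐ[meridian] f := by
    filter_upwards [hgf, sin_pos_ae_meridian] with θ h1 h2
    refine mul_left_cancel₀ ?_ h1
    exact_mod_cast (Real.sqrt_pos.2 h2).ne'
  refine ⟨fun _ => (Lp.memLp g).ae_eq hgf', fun hfm => ?_⟩
  convert hg using 1
  refine Lp.ext ?_
  filter_upwards [((Lp.memLp g).ae_eq hgf').coeFn_toLp, hgf'] with θ h1 h2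
  rw [h1, h2]

/-- The trace theorem: the embedding of `W_m^{r+1/2}` into `H^r_#`, uniformly in `m`. -/
theorem exists_memH_of_memW {r : ℝ} (hr : 0 < r) : ∃ C : ℝ, 0 < C ∧ ∀ (m : ℤ) (f : ℝ → ℂ),
    MemW m (r + 1 / 2) f → MemH r f ∧ normH r f ≤ C * normW m (r + 1 / 2) f := by
  obtain ⟨C, hC, hfin⟩ := exists_trace_finite_shift hr
  refine ⟨Real.sqrt C, Real.sqrt_pos.2 hC, fun m f hf => ?_⟩
  obtain ⟨hloc, hsph, hL2, hs⟩ := (memW_iff _ _ _).1 hf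
  have hsym := hsph.meridianSymm
  set M := m.natAbs
  obtain ⟨hm, hsum⟩ := exists_hasSum_toLp_trigQ hr hL2 hs
  have hfm : MemLp f 2 meridian := hm hloc.aestronglyMeasurable.restrict
  have hexp := hsum hloc.aestronglyMeasurable.restrict
  have hcoef : ∀ k, HasSum (fun i => meridianCoef f (M + i) M *
      fourierCoef (fun θ => (trigQ (M + i) M θ : ℂ)) k) (fourierCoef f k) := by
    intro k
    -- The kernel is conjugated because the inner product is conjugate-linear in its first argument.
    have hL := memLp_meridian_of_continuous
      (Complex.continuous_conj.comp (continuous_meridianKernel M k))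
    have h1 := hexp.mapL (innerSL ℂ hL.toLp)
    simp only [innerSL_apply_apply, inner_smul_right, inner_toLp, Function.comp_apply,
      Complex.conj_conj] at h1
    rw [← hsym.fourierCoef_eq hfm] at h1
    simp only [← (meridianSymm_trigQ _ M).fourierCoef_eq (memLp_ofReal_trigQ _ M)] at h1
    exact h1
  have hbound : ∀ K : Finset ℤ, ∑ k ∈ K, sobolevWeight r k * ‖fourierCoef f k‖ ^ 2 ≤
      C * ∑' i, meridianTerm (r + 1 / 2) f M i := by
    intro K
    -- For a finite set K of frequencies only convergence of each coefficient is needed; the bound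
    -- is uniform in N and in K.
    have hlim : Filter.Tendsto (fun N => ∑ k ∈ K, sobolevWeight r k *
        ‖∑ i ∈ Finset.range N, meridianCoef f (M + i) M *
          fourierCoef (fun θ => (trigQ (M + i) M θ : ℂ)) k‖ ^ 2) Filter.atTop
        (nhds (∑ k ∈ K, sobolevWeight r k * ‖fourierCoef f k‖ ^ 2)) :=
      tendsto_finsetSum _ fun k _ =>
        (((hcoef k).tendsto_sum_nat).norm.pow 2).const_mul _
    refine le_of_tendsto' hlim fun N => (hfin M f _ K).trans ?_
    exact mul_le_mul_of_nonneg_left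
      (hs.sum_le_tsum _ fun i _ => meridianTerm_nonneg _ _ _ i) hC.le
  have hterm : ∀ k, 0 ≤ sobolevWeight r k * ‖fourierCoef f k‖ ^ 2 := fun k =>
    mul_nonneg (sobolevWeight_pos r k).le (sq_nonneg _)
  have hsumH := summable_of_sum_le hterm hbound
  refine ⟨⟨hsym.memLp_two_pi hloc.aestronglyMeasurable hfm, hsym.1, ?_⟩, ?_⟩
  · rwa [show periodicTerm r f = fun k => sobolevWeight r k * ‖fourierCoef f k‖ ^ 2 from
      funext fun k => periodicTerm_eq r f k]
  · rw [normH_eq, normW_eq, ← Real.sqrt_mul hC.le]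
    exact Real.sqrt_le_sqrt (hsumH.tsum_le_of_sum_le hbound)

/-! ### A pointwise Hardy inequality -/

section Hardy

/-- The variance of h about its mean c is nonnegative. -/
lemma sq_integral_le_mul_integral_sq {h : ℝ → ℝ} (hh : Continuous h) {a b : ℝ} (hab : a ≤ b) :
    (∫ t in a..b, h t) ^ 2 ≤ (b - a) * ∫ t in a..b, h t ^ 2 := by
  rcases eq_or_lt_of_le hab with rfl | hlt
  · simp
  set c : ℝ := (∫ t in a..b, h t) / (b - a) with hc
  have hba : 0 < b - a := sub_pos.2 hlt
  have h0 : 0 ≤ ∫ t in a..b, (h t - c) ^ 2 :=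
    intervalIntegral.integral_nonneg hab fun t _ => sq_nonneg _
  have e : ∀ t, (h t - c) ^ 2 = h t ^ 2 - 2 * c * h t + c ^ 2 := fun t => by ring
  simp only [e] at h0
  rw [intervalIntegral.integral_add (Continuous.intervalIntegrable (by fun_prop) _ _)
    (Continuous.intervalIntegrable (by fun_prop) _ _),
    intervalIntegral.integral_sub (Continuous.intervalIntegrable (by fun_prop) _ _)
    (Continuous.intervalIntegrable (by fun_prop) _ _), intervalIntegral.integral_const_mul,
    intervalIntegral.integral_const, smul_eq_mul] at h0
  have h1 : ∫ t in a..b, h t = c * (b - a) := by rw [hc]; field_simp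
  rw [h1] at h0 ⊢
  nlinarith

/-- Writing g as the integral of g' from the pole, Cauchy-Schwarz yields |g(θ)|² ≤ θ ∫ |g'|², and
Jordan's inequality bounds θ by (π/2) sin θ. -/
lemma norm_sq_le_of_eq_zero {g g' : ℝ → ℂ} (hg : ∀ θ, HasDerivAt g (g' θ) θ)
    (hg' : Continuous g') (h0 : g 0 = 0) {θ : ℝ} (h1 : 0 ≤ θ) (h2 : θ ≤ Real.pi / 2) :
    ‖g θ‖ ^ 2 ≤ Real.pi / 2 * Real.sin θ * ∫ t in (0 : ℝ)..Real.pi, ‖g' t‖ ^ 2 := by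
  have hpi := Real.pi_pos
  have hA : 0 ≤ ∫ t in (0 : ℝ)..Real.pi, ‖g' t‖ ^ 2 :=
    intervalIntegral.integral_nonneg hpi.le fun t _ => sq_nonneg _
  have e : g θ = ∫ t in (0 : ℝ)..θ, g' t := by
    rw [intervalIntegral.integral_eq_sub_of_hasDerivAt (fun t _ => hg t)
      (hg'.intervalIntegrable _ _), h0, sub_zero]
  have hs : θ ≤ Real.pi / 2 * Real.sin θ := by
    have := Real.mul_le_sin h1 h2
    calc θ = Real.pi / 2 * (2 / Real.pi * θ) := by field_simp
      _ ≤ _ := by gcongr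
  calc ‖g θ‖ ^ 2 ≤ (∫ t in (0 : ℝ)..θ, ‖g' t‖) ^ 2 := by
        rw [e]
        gcongr
        exact intervalIntegral.norm_integral_le_integral_norm h1
    _ ≤ (θ - 0) * ∫ t in (0 : ℝ)..θ, ‖g' t‖ ^ 2 := sq_integral_le_mul_integral_sq hg'.norm h1
    _ ≤ θ * ∫ t in (0 : ℝ)..Real.pi, ‖g' t‖ ^ 2 := by
        rw [sub_zero]
        refine mul_le_mul_of_nonneg_left ?_ h1
        refine intervalIntegral.integral_mono_interval le_rfl h1 (by linarith)
          (ae_of_all _ fun t => sq_nonneg _) (Continuous.intervalIntegrable (by fun_prop) _ _)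
    _ ≤ _ := by gcongr

/-- A pointwise Hardy inequality for functions vanishing at both poles. -/
lemma norm_sq_le_sin_mul {g g' : ℝ → ℂ} (hg : ∀ θ, HasDerivAt g (g' θ) θ)
    (hg' : Continuous g') (h0 : g 0 = 0) (hp : g Real.pi = 0) {θ : ℝ}
    (hθ : θ ∈ Set.Icc 0 Real.pi) :
    ‖g θ‖ ^ 2 ≤ Real.pi / 2 * Real.sin θ * ∫ t in (0 : ℝ)..Real.pi, ‖g' t‖ ^ 2 := by
  rcases le_total θ (Real.pi / 2) with h | h
  · exact norm_sq_le_of_eq_zero hg hg' h0 hθ.1 h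
  · have h1 := norm_sq_le_of_eq_zero (g := fun t => g (Real.pi - t))
      (g' := fun t => -g' (Real.pi - t)) (θ := Real.pi - θ)
      (fun t => (hg (Real.pi - t)).comp_const_sub Real.pi t)
      (by fun_prop) (by simpa using hp) (by linarith [hθ.2]) (by linarith)
    simp only [sub_sub_cancel, Real.sin_pi_sub, norm_neg] at h1
    rwa [intervalIntegral.integral_comp_sub_left (fun t => ‖g' t‖ ^ 2), sub_self, sub_zero] at h1

end Hardy

/-! ### The Dirichlet form bound for smooth functions -/

lemma memLp_factorQ (ε : ℝ) (n m : ℕ) : MemLp (fun θ => (factorQ ε n m θ : ℂ)) 2 meridian :=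
  memLp_meridian_of_continuous (Complex.continuous_ofReal.comp (continuous_factorQ ε n m))

lemma inner_factorQ {ε : ℝ} (hε : ε ^ 2 = 1) (m i j : ℕ) :
    inner ℂ (memLp_factorQ ε (m + i) m).toLp (memLp_factorQ ε (m + j) m).toLp =
      if i = j then (((((m + i : ℕ) : ℝ) * ((m + i : ℕ) + 1)) : ℝ) : ℂ) else 0 := by
  rw [inner_toLp]
  have e : ∫ θ, (factorQ ε (m + j) m θ : ℂ) * (starRingEnd ℂ) (factorQ ε (m + i) m θ : ℂ)
      ∂meridian =
      ((∫ θ in (0 : ℝ)..Real.pi, factorQ ε (m + i) m θ * factorQ ε (m + j) m θ : ℝ) : ℂ) := by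
    rw [intervalIntegral.integral_of_le Real.pi_pos.le, ← integral_complex_ofReal]
    refine integral_congr_ae (ae_of_all _ fun θ => ?_)
    simp only [Complex.conj_ofReal]
    push_cast
    ring
  rw [e, integral_factorQ_mul (by omega) hε]
  by_cases h : i = j
  · simp [h]
  · simp [h]

/-- The Dirichlet form controls the coefficients of a smooth function. -/
theorem sum_eigenvalue_mul_sq_meridianCoef_le {m : ℕ} {g g' : ℝ → ℂ}
    (hg : ∀ θ, HasDerivAt g (g' θ) θ) (hg' : Continuous g')
    (h0 : m = 0 ∨ (g 0 = 0 ∧ g Real.pi = 0)) (J : Finset ℕ) :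
    ∑ i ∈ J, (((m + i : ℕ) : ℝ) * ((m + i : ℕ) + 1)) * ‖meridianCoef g (m + i) m‖ ^ 2 ≤
      (2 + Real.pi ^ 2 * m ^ 2) * ∫ θ in (0 : ℝ)..Real.pi, ‖g' θ‖ ^ 2 := by
  have hpi := Real.pi_pos
  have hgc : Continuous g := continuous_iff_continuousAt.2 fun θ => (hg θ).continuousAt
  set A := ∫ θ in (0 : ℝ)..Real.pi, ‖g' θ‖ ^ 2 with hAdef
  have hA : 0 ≤ A := intervalIntegral.integral_nonneg hpi.le fun t _ => sq_nonneg _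
  -- √sin times the image of g under d/dθ + m / sin θ; either sign ε would do.
  let u : ℝ → ℂ := fun θ => (Real.sqrt (Real.sin θ) : ℂ) * g' θ +
    ((1 : ℝ) : ℂ) * m * (g θ / (Real.sqrt (Real.sin θ) : ℂ))
  have hum : AEStronglyMeasurable u meridian := by
    have h1 : Measurable fun θ : ℝ => (Real.sqrt (Real.sin θ) : ℂ) := by fun_prop
    exact ((h1.mul hg'.measurable).add
      (measurable_const.mul (hgc.measurable.div h1))).aestronglyMeasurable
  -- Hardy's inequality makes |g|²/sin bounded by (π/2)A, so the singular term is even bounded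
  -- pointwise.
  have hbd : ∀ᵐ θ ∂meridian, ‖u θ‖ ^ 2 ≤ 2 * ‖g' θ‖ ^ 2 + m ^ 2 * (Real.pi * A) := by
    filter_upwards [ae_restrict_mem measurableSet_Ioc, sin_pos_ae_meridian] with θ hθ hs
    have hq : (m : ℝ) ^ 2 * (‖g θ‖ ^ 2 / Real.sin θ) ≤ m ^ 2 * (Real.pi / 2 * A) := by
      rcases h0 with rfl | ⟨h0, h1⟩
      · simp
      · refine mul_le_mul_of_nonneg_left ?_ (sq_nonneg _)
        rw [div_le_iff₀ hs]
        have := norm_sq_le_sin_mul hg hg' h0 h1 (Set.Ioc_subset_Icc_self hθ)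
        linarith
    have h1 : ‖(Real.sqrt (Real.sin θ) : ℂ) * g' θ‖ ^ 2 ≤ ‖g' θ‖ ^ 2 := by
      rw [norm_mul, mul_pow, Complex.norm_real, Real.norm_eq_abs, sq_abs, Real.sq_sqrt hs.le]
      exact mul_le_of_le_one_left (sq_nonneg _) (Real.sin_le_one θ)
    have h2 : ‖((1 : ℝ) : ℂ) * m * (g θ / (Real.sqrt (Real.sin θ) : ℂ))‖ ^ 2 =
        m ^ 2 * (‖g θ‖ ^ 2 / Real.sin θ) := by
      rw [norm_mul, norm_mul, norm_div, mul_pow, mul_pow, div_pow, Complex.norm_real,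
        Complex.norm_real, Complex.norm_natCast, Real.norm_eq_abs, Real.norm_eq_abs, sq_abs,
        sq_abs, Real.sq_sqrt hs.le]
      ring
    calc ‖u θ‖ ^ 2 ≤ (‖(Real.sqrt (Real.sin θ) : ℂ) * g' θ‖ +
          ‖((1 : ℝ) : ℂ) * m * (g θ / (Real.sqrt (Real.sin θ) : ℂ))‖) ^ 2 := by
          gcongr
          exact norm_add_le _ _
      _ ≤ 2 * (‖(Real.sqrt (Real.sin θ) : ℂ) * g' θ‖ ^ 2 +
          ‖((1 : ℝ) : ℂ) * m * (g θ / (Real.sqrt (Real.sin θ) : ℂ))‖ ^ 2) := add_sq_le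
      _ ≤ _ := by rw [h2]; linarith
  have hrc : Continuous fun θ => 2 * ‖g' θ‖ ^ 2 + m ^ 2 * (Real.pi * A) := by fun_prop
  have hri : Integrable (fun θ => 2 * ‖g' θ‖ ^ 2 + m ^ 2 * (Real.pi * A)) meridian :=
    (intervalIntegrable_iff_integrableOn_Ioc_of_le hpi.le).1 (hrc.intervalIntegrable _ _)
  have hu2 : Integrable (fun θ => ‖u θ‖ ^ 2) meridian := by
    refine hri.mono' (hum.norm.pow 2) ?_
    filter_upwards [hbd] with θ hθ
    rwa [Real.norm_of_nonneg (sq_nonneg _)]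
  have hu : MemLp u 2 meridian := (memLp_two_iff_integrable_sq_norm hum).2 hu2
  -- By Green's formula the inner products are λ c with λ = n(n + 1), and the family has squared
  -- norms λ; Bessel therefore bounds the sum of λ |c|². The case λ = 0 is trivial.
  have hB := bessel_of_orthogonal (inner_factorQ (ε := 1) (by norm_num) m) hu.toLp J
  have hin : ∀ i, inner ℂ (memLp_factorQ 1 (m + i) m).toLp hu.toLp =
      ((((m + i : ℕ) : ℝ) * ((m + i : ℕ) + 1) : ℝ) : ℂ) * meridianCoef g (m + i) m := by
    intro i
    rw [inner_toLp, meridianCoef]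
    simp only [Complex.conj_ofReal]
    have h := integral_pairing_factorQ (m + i) m (ε := 1) (by norm_num) hg hg' h0
    rw [intervalIntegral.integral_of_le hpi.le] at h
    refine h.trans ?_
    push_cast
    ring
  simp only [hin] at hB
  calc _ = ∑ i ∈ J, ‖((((m + i : ℕ) : ℝ) * ((m + i : ℕ) + 1) : ℝ) : ℂ) *
        meridianCoef g (m + i) m‖ ^ 2 / (((m + i : ℕ) : ℝ) * ((m + i : ℕ) + 1)) := by
        refine Finset.sum_congr rfl fun i _ => ?_
        rw [norm_mul, mul_pow, Complex.norm_real, Real.norm_eq_abs, sq_abs]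
        by_cases hl : ((m + i : ℕ) : ℝ) * ((m + i : ℕ) + 1) = 0
        · rw [hl]; simp
        · field_simp
    _ ≤ ‖hu.toLp‖ ^ 2 := hB
    _ = ∫ θ, ‖u θ‖ ^ 2 ∂meridian := norm_toLp_sq hu
    _ ≤ ∫ θ, (2 * ‖g' θ‖ ^ 2 + m ^ 2 * (Real.pi * A)) ∂meridian := integral_mono_ae hu2 hri hbd
    _ = _ := by
        rw [← intervalIntegral.integral_of_le hpi.le, intervalIntegral.integral_add
          (Continuous.intervalIntegrable (by fun_prop) _ _)
          (Continuous.intervalIntegrable (by fun_prop) _ _),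
          intervalIntegral.integral_const_mul, intervalIntegral.integral_const, smul_eq_mul,
          ← hAdef]
        ring

/-! ### Approximation by Fourier partial sums -/

section TrigPolynomial

lemma continuous_exp_int (k : ℤ) : Continuous fun θ : ℝ => Complex.exp (Complex.I * k * θ) := by
  fun_prop

lemma norm_exp_int (k : ℤ) (θ : ℝ) : ‖Complex.exp (Complex.I * k * θ)‖ = 1 := by
  rw [show Complex.I * (k : ℂ) * (θ : ℂ) = ((k * θ : ℝ) : ℂ) * Complex.I by push_cast; ring,
    Complex.norm_exp_ofReal_mul_I]

/-- A trigonometric polynomial. -/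
def trigPoly (K : Finset ℤ) (c : ℤ → ℂ) (θ : ℝ) : ℂ :=
  ∑ k ∈ K, c k * Complex.exp (Complex.I * k * θ)

lemma continuous_trigPoly (K : Finset ℤ) (c : ℤ → ℂ) : Continuous (trigPoly K c) :=
  continuous_finsetSum _ fun k _ => continuous_const.mul (continuous_exp_int k)

lemma hasDerivAt_trigPoly (K : Finset ℤ) (c : ℤ → ℂ) (θ : ℝ) :
    HasDerivAt (trigPoly K c) (trigPoly K (fun k => c k * (Complex.I * k)) θ) θ := by
  unfold trigPoly
  refine (HasDerivAt.fun_sum fun (k : ℤ) _ =>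
    (hasDerivAt_exp_int (Complex.I * (k : ℂ)) θ).const_mul (c k)).congr_deriv ?_
  exact Finset.sum_congr rfl fun k _ => by ring

lemma fourierCoef_trigPoly (K : Finset ℤ) (c : ℤ → ℂ) (j : ℤ) :
    fourierCoef (trigPoly K c) j = if j ∈ K then c j else 0 := by
  have h := fourierCoef_finset_sum K c continuous_exp_int j
  rw [show trigPoly K c = fun θ : ℝ => ∑ k ∈ K, c k * Complex.exp (Complex.I * k * θ)
    from rfl, h]
  simp only [fourierCoef_exp, mul_ite, mul_one, mul_zero, Finset.sum_ite_eq']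

lemma integral_norm_sq_trigPoly (K : Finset ℤ) (c : ℤ → ℂ) :
    ∫ θ in (0 : ℝ)..(2 * Real.pi), ‖trigPoly K c θ‖ ^ 2 =
      2 * Real.pi * ∑ k ∈ K, ‖c k‖ ^ 2 := by
  have h := hasSum_sq_fourierCoef (Continuous.memLp_two_restrict (continuous_trigPoly K c) 0 _)
  have h2 : HasSum (fun k => ‖fourierCoef (trigPoly K c) k‖ ^ 2)
      (∑ k ∈ K, ‖fourierCoef (trigPoly K c) k‖ ^ 2) :=
    hasSum_sum_of_ne_finset_zero fun k hk => by rw [fourierCoef_trigPoly, if_neg hk]; simp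
  have h3 := h.unique h2
  rw [inv_mul_eq_iff_eq_mul₀ Real.two_pi_pos.ne'] at h3
  rw [h3]
  congr 1
  exact Finset.sum_congr rfl fun k hk => by rw [fourierCoef_trigPoly, if_pos hk]

lemma intervalIntegrable_of_memLp {f : ℝ → ℂ}
    (hf : MemLp f 2 (volume.restrict (Set.Ioc 0 (2 * Real.pi)))) :
    IntervalIntegrable f volume 0 (2 * Real.pi) :=
  (intervalIntegrable_iff_integrableOn_Ioc_of_le Real.two_pi_pos.le).2
    (hf.integrable (by norm_num))

lemma fourierCoef_sub {f g : ℝ → ℂ}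
    (hf : MemLp f 2 (volume.restrict (Set.Ioc 0 (2 * Real.pi)))) (hg : Continuous g) (k : ℤ) :
    fourierCoef (fun θ => f θ - g θ) k = fourierCoef f k - fourierCoef g k := by
  simp only [fourierCoef, sub_mul]
  rw [intervalIntegral.integral_sub, mul_sub]
  · exact (intervalIntegrable_of_memLp hf).mul_continuousOn (by fun_prop)
  · exact Continuous.intervalIntegrable (by fun_prop) _ _

/-- Fourier series converge in square mean. -/
lemma tendsto_integral_norm_sq_sub_trigPoly {f : ℝ → ℂ}
    (hf : MemLp f 2 (volume.restrict (Set.Ioc 0 (2 * Real.pi)))) :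
    Filter.Tendsto (fun K : Finset ℤ =>
      ∫ θ in (0 : ℝ)..(2 * Real.pi), ‖f θ - trigPoly K (fourierCoef f) θ‖ ^ 2)
      Filter.atTop (nhds 0) := by
  have h0 := (tendsto_tsum_compl_atTop_zero (fun k => ‖fourierCoef f k‖ ^ 2)).const_mul
    (2 * Real.pi)
  rw [mul_zero] at h0
  refine h0.congr fun K => ?_
  have hd : MemLp (fun θ => f θ - trigPoly K (fourierCoef f) θ) 2
      (volume.restrict (Set.Ioc 0 (2 * Real.pi))) :=
    hf.sub (Continuous.memLp_two_restrict (continuous_trigPoly K _) 0 _)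
  have h1 := (hasSum_sq_fourierCoef hd).tsum_eq
  rw [eq_inv_mul_iff_mul_eq₀ Real.two_pi_pos.ne'] at h1
  rw [← h1]
  congr 1
  rw [show (∑' b : { x // x ∉ K }, ‖fourierCoef f b‖ ^ 2) =
    ∑' b : ({x | x ∉ K} : Set ℤ), ‖fourierCoef f b‖ ^ 2 from rfl,
    tsum_subtype {x | x ∉ K} (fun k => ‖fourierCoef f k‖ ^ 2)]
  refine tsum_congr fun k => ?_
  rw [fourierCoef_sub hf (continuous_trigPoly K _), fourierCoef_trigPoly, Set.indicator_apply]
  by_cases hk : k ∈ K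
  · simp [hk]
  · simp [hk]

lemma intervalIntegral_meridian_le {f : ℝ → ℂ}
    (hf : MemLp f 2 (volume.restrict (Set.Ioc 0 (2 * Real.pi)))) :
    ∫ θ in (0 : ℝ)..Real.pi, ‖f θ‖ ^ 2 ≤ ∫ θ in (0 : ℝ)..(2 * Real.pi), ‖f θ‖ ^ 2 :=
  intervalIntegral.integral_mono_interval le_rfl Real.pi_pos.le (by linarith [Real.pi_pos])
    (ae_of_all _ fun t => sq_nonneg _)
    ((intervalIntegrable_iff_integrableOn_Ioc_of_le Real.two_pi_pos.le).2
      ((memLp_two_iff_integrable_sq_norm hf.1).1 hf))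

lemma tendsto_meridian_norm_sq_sub_trigPoly {f : ℝ → ℂ}
    (hf : MemLp f 2 (volume.restrict (Set.Ioc 0 (2 * Real.pi)))) :
    Filter.Tendsto (fun K : Finset ℤ =>
      ∫ θ in (0 : ℝ)..Real.pi, ‖f θ - trigPoly K (fourierCoef f) θ‖ ^ 2)
      Filter.atTop (nhds 0) := by
  refine squeeze_zero (fun K => intervalIntegral.integral_nonneg Real.pi_pos.le
    fun _ _ => sq_nonneg _) (fun K => ?_) (tendsto_integral_norm_sq_sub_trigPoly hf)
  exact intervalIntegral_meridian_le
    (hf.sub (Continuous.memLp_two_restrict (continuous_trigPoly K _) 0 _))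

end TrigPolynomial

section MeridianCoef

lemma meridianCoef_sub {f g : ℝ → ℂ} (hf : MemLp f 2 meridian) (hg : MemLp g 2 meridian)
    (n m : ℕ) : meridianCoef (fun θ => f θ - g θ) n m = meridianCoef f n m - meridianCoef g n m := by
  have hq : Continuous fun θ : ℝ => ((trigQ n m θ * Real.sin θ : ℝ) : ℂ) := by
    have := continuous_trigQ n m
    fun_prop
  simp only [meridianCoef, sub_mul]
  exact intervalIntegral.integral_sub
    ((intervalIntegrable_iff_integrableOn_Ioc_of_le Real.pi_pos.le).2
      (integrable_mul_continuous (hf.integrable (by norm_num)) hq))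
    ((intervalIntegrable_iff_integrableOn_Ioc_of_le Real.pi_pos.le).2
      (integrable_mul_continuous (hg.integrable (by norm_num)) hq))

lemma meridianCoef_const_mul (c : ℂ) (f : ℝ → ℂ) (n m : ℕ) :
    meridianCoef (fun θ => c * f θ) n m = c * meridianCoef f n m := by
  simp only [meridianCoef, mul_assoc]
  exact intervalIntegral.integral_const_mul _ _

/-- Bessel's inequality for a single index bounds a coefficient by the L² norm, so convergence in
mean suffices. -/
lemma tendsto_meridianCoef_trigPoly {f : ℝ → ℂ}
    (hf : MemLp f 2 (volume.restrict (Set.Ioc 0 (2 * Real.pi)))) (m i : ℕ) :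
    Filter.Tendsto (fun K : Finset ℤ => meridianCoef (trigPoly K (fourierCoef f)) (m + i) m)
      Filter.atTop (nhds (meridianCoef f (m + i) m)) := by
  have hm := memLp_meridian_of_memLp hf
  rw [tendsto_iff_norm_sub_tendsto_zero]
  have h1 := (Real.continuous_sqrt.tendsto 0).comp (tendsto_meridian_norm_sq_sub_trigPoly hf)
  rw [Real.sqrt_zero] at h1
  refine squeeze_zero (fun K => norm_nonneg _) (fun K => ?_) h1
  have hT := memLp_meridian_of_continuous (continuous_trigPoly K (fourierCoef f))
  have h2 := sum_sq_meridianCoef_le (m := m) (hm.sub hT) {i}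
  rw [Finset.sum_singleton] at h2
  rw [norm_sub_rev, Function.comp_apply]
  refine Real.le_sqrt_of_sq_le ?_
  rw [← meridianCoef_sub hm hT]
  exact h2

end MeridianCoef

/-! ### The continuous representative of a function of order one -/

section ContinuousRepresentative

variable {f : ℝ → ℂ}

/-- The mean inequality gives x ≤ 1/w + w x², and the inverse weights are summable like 1/k². -/
lemma summable_norm_fourierCoef (hs : Summable fun k => sobolevWeight 1 k * ‖fourierCoef f k‖ ^ 2) :
    Summable fun k => ‖fourierCoef f k‖ := by
  have h1 : Summable fun k : ℤ => (if k = 0 then (1 : ℝ) else 0) :=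
    (hasSum_ite_eq (0 : ℤ) (1 : ℝ)).summable
  have h2 : Summable fun k : ℤ => 1 / (k : ℝ) ^ 2 :=
    Real.summable_one_div_int_pow.2 (by norm_num)
  refine Summable.of_nonneg_of_le (fun _ => norm_nonneg _) (fun k => ?_) ((h1.add h2).add hs)
  have hw := sobolevWeight_pos 1 k
  have h3 : 1 / sobolevWeight 1 k ≤ (if k = 0 then (1 : ℝ) else 0) + 1 / (k : ℝ) ^ 2 := by
    unfold sobolevWeight
    split_ifs with h
    · simp [h]
    · rw [mul_one, zero_add, Real.rpow_two, sq_abs]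
  have h4 : ‖fourierCoef f k‖ ≤ 1 / sobolevWeight 1 k + sobolevWeight 1 k * ‖fourierCoef f k‖ ^ 2 := by
    set x := ‖fourierCoef f k‖
    set w := sobolevWeight 1 k
    have h5 : 0 ≤ (w * x - 1) ^ 2 / w := by positivity
    have h6 : (w * x - 1) ^ 2 / w = w * x ^ 2 - 2 * x + 1 / w := by field_simp; ring
    have h7 : 0 ≤ x := norm_nonneg _
    linarith
  linarith

/-- The sum of the Fourier series of `f`. -/
def fourierSum (f : ℝ → ℂ) (θ : ℝ) : ℂ := ∑' k : ℤ, fourierCoef f k * Complex.exp (Complex.I * k * θ)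

lemma norm_fourier_term (k : ℤ) (θ : ℝ) :
    ‖fourierCoef f k * Complex.exp (Complex.I * k * θ)‖ = ‖fourierCoef f k‖ := by
  rw [norm_mul, norm_exp_int, mul_one]

lemma continuous_fourierSum (hs : Summable fun k => ‖fourierCoef f k‖) :
    Continuous (fourierSum f) :=
  continuous_tsum (fun k => continuous_const.mul (continuous_exp_int k)) hs
    fun k θ => (norm_fourier_term k θ).le

lemma tendsto_trigPoly_fourierSum (hs : Summable fun k => ‖fourierCoef f k‖) (θ : ℝ) :
    Filter.Tendsto (fun K : Finset ℤ => trigPoly K (fourierCoef f) θ) Filter.atTop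
      (nhds (fourierSum f θ)) := by
  have h : Summable fun k : ℤ => fourierCoef f k * Complex.exp (Complex.I * k * θ) :=
    Summable.of_norm (by simpa only [norm_fourier_term] using hs)
  exact h.hasSum

lemma norm_fourierSum_sub_le (hs : Summable fun k => ‖fourierCoef f k‖) (K : Finset ℤ) (θ : ℝ) :
    ‖trigPoly K (fourierCoef f) θ - fourierSum f θ‖ ≤
      ∑' k : { x // x ∉ K }, ‖fourierCoef f k‖ := by
  have hn : Summable fun k : ℤ => ‖fourierCoef f k * Complex.exp (Complex.I * k * θ)‖ := by
    simpa only [norm_fourier_term] using hs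
  have h := hn.of_norm.sum_add_tsum_subtype_compl K
  rw [fourierSum, ← h, trigPoly, sub_add_cancel_left, norm_neg]
  have hn' := hn.subtype {x | x ∉ K}
  refine (norm_tsum_le_tsum_norm hn').trans (le_of_eq ?_)
  exact tsum_congr fun k => norm_fourier_term _ _

/-- A function with absolutely summable Fourier coefficients is the sum of its Fourier series. -/
lemma ae_eq_fourierSum (hf : MemLp f 2 (volume.restrict (Set.Ioc 0 (2 * Real.pi))))
    (hs : Summable fun k => ‖fourierCoef f k‖) : ∀ᵐ θ ∂meridian, f θ = fourierSum f θ := by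
  have hm := memLp_meridian_of_memLp hf
  have hFc := continuous_fourierSum hs
  have hD := hm.sub (memLp_meridian_of_continuous hFc)
  have hDi := (memLp_two_iff_integrable_sq_norm hD.1).1 hD
  -- The partial sums converge to f in mean and to the sum of the series uniformly, so the two
  -- limits agree.
  have hle : ∫ θ, ‖(f - fourierSum f) θ‖ ^ 2 ∂meridian ≤ 0 := by
    have h1 := (tendsto_meridian_norm_sq_sub_trigPoly hf).const_mul 2
    have h2 := ((tendsto_tsum_compl_atTop_zero fun k => ‖fourierCoef f k‖).pow 2).const_mul
      (2 * Real.pi)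
    have h3 := h1.add h2
    simp only [mul_zero, ne_eq, OfNat.ofNat_ne_zero, not_false_eq_true, zero_pow, add_zero] at h3
    refine ge_of_tendsto' h3 fun K => ?_
    have hT := hm.sub (memLp_meridian_of_continuous (continuous_trigPoly K (fourierCoef f)))
    have hTi := (memLp_two_iff_integrable_sq_norm hT.1).1 hT
    set b := ∑' k : { x // x ∉ K }, ‖fourierCoef f k‖
    calc ∫ θ, ‖(f - fourierSum f) θ‖ ^ 2 ∂meridian ≤
          ∫ θ, (2 * ‖(f - trigPoly K (fourierCoef f)) θ‖ ^ 2 + 2 * b ^ 2) ∂meridian := by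
          refine integral_mono hDi ((hTi.const_mul 2).add (integrable_const _)) fun θ => ?_
          have hb := norm_fourierSum_sub_le hs K θ
          have e : (f - fourierSum f) θ = (f - trigPoly K (fourierCoef f)) θ +
              (trigPoly K (fourierCoef f) θ - fourierSum f θ) := by
            simp only [Pi.sub_apply]; ring
          calc ‖(f - fourierSum f) θ‖ ^ 2 ≤ (‖(f - trigPoly K (fourierCoef f)) θ‖ + b) ^ 2 := by
                rw [e]
                gcongr
                exact (norm_add_le _ _).trans (by gcongr)
            _ ≤ 2 * (‖(f - trigPoly K (fourierCoef f)) θ‖ ^ 2 + b ^ 2) := add_sq_le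
            _ = _ := by ring
      _ = _ := by
          rw [integral_add (hTi.const_mul 2) (integrable_const _), integral_const_mul,
            integral_const, intervalIntegral.integral_of_le Real.pi_pos.le]
          simp only [Pi.sub_apply, smul_eq_mul, measureReal_restrict_apply MeasurableSet.univ,
            Set.univ_inter, Real.volume_real_Ioc_of_le Real.pi_pos.le, sub_zero]
          ring
  have h0 : ∫ θ, ‖(f - fourierSum f) θ‖ ^ 2 ∂meridian = 0 :=
    le_antisymm hle (integral_nonneg fun _ => sq_nonneg _)
  rw [integral_eq_zero_iff_of_nonneg (fun _ => sq_nonneg _) hDi] at h0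
  filter_upwards [h0] with θ hθ
  have h4 : ‖(f - fourierSum f) θ‖ ^ 2 = 0 := hθ
  simpa [sub_eq_zero] using h4

end ContinuousRepresentative

/-! ### Vanishing at the poles -/

section Vanishing

/-- A continuous function that is square integrable against `1 / sin` vanishes at `0`. -/
lemma eq_zero_of_integrable_div_sin {G : ℝ → ℂ} (hG : Continuous G)
    (hi : IntervalIntegrable (fun θ => ‖G θ‖ ^ 2 / Real.sin θ) volume 0 Real.pi) : G 0 = 0 := by
  by_contra h
  have hpos : 0 < ‖G 0‖ ^ 2 / 2 := by positivity
  have hev : ∀ᶠ θ in nhds (0 : ℝ), ‖G 0‖ ^ 2 / 2 < ‖G θ‖ ^ 2 :=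
    (by fun_prop : Continuous fun θ => ‖G θ‖ ^ 2).continuousAt.eventually_const_lt
      (by linarith)
  obtain ⟨δ, hδ, hball⟩ := Metric.eventually_nhds_iff.1 hev
  set d := min (δ / 2) (Real.pi / 2) with hd
  have hpi := Real.pi_pos
  have hd0 : 0 < d := lt_min (by positivity) (by positivity)
  have hdpi : d ≤ Real.pi := (min_le_right _ _).trans (by linarith)
  have hsub : IntervalIntegrable (fun θ => ‖G θ‖ ^ 2 / Real.sin θ) volume 0 d :=
    hi.mono_set (by
      rw [Set.uIcc_of_le hd0.le, Set.uIcc_of_le hpi.le]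
      exact Set.Icc_subset_Icc_right hdpi)
  -- If G(0) ≠ 0, then |G|²/sin dominates a multiple of 1/θ near 0, which would make 1/θ integrable.
  have hinv : IntervalIntegrable (fun θ : ℝ => θ⁻¹) volume 0 d := by
    refine (hsub.const_mul (‖G 0‖ ^ 2 / 2)⁻¹).mono_fun (by fun_prop) ?_
    rw [Set.uIoc_of_le hd0.le]
    filter_upwards [ae_restrict_mem measurableSet_Ioc] with θ hθ
    have hs : 0 < Real.sin θ := Real.sin_pos_of_pos_of_lt_pi hθ.1
      (lt_of_le_of_lt (hθ.2.trans (min_le_right _ _)) (by linarith))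
    have h1 : ‖G 0‖ ^ 2 / 2 < ‖G θ‖ ^ 2 := by
      apply hball
      rw [Real.dist_eq, sub_zero, abs_of_pos hθ.1]
      exact lt_of_le_of_lt (hθ.2.trans (min_le_left _ _)) (by linarith)
    rw [Real.norm_of_nonneg (inv_nonneg.2 hθ.1.le), Real.norm_of_nonneg (by positivity)]
    calc θ⁻¹ ≤ (Real.sin θ)⁻¹ := inv_anti₀ hs (Real.sin_lt hθ.1).le
      _ = (‖G 0‖ ^ 2 / 2)⁻¹ * ((‖G 0‖ ^ 2 / 2) / Real.sin θ) := by field_simp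
      _ ≤ _ := by gcongr
  rw [intervalIntegrable_inv_iff] at hinv
  rcases hinv with h1 | h1
  · exact hd0.ne h1
  · exact h1 Set.left_mem_uIcc

/-- Functions of `W_m^1`, `m ≠ 0`, are square integrable against `1 / sin`. -/
theorem integrable_norm_sq_div_sin {m : ℕ} (hm : m ≠ 0) {f : ℝ → ℂ}
    (hf : MemLp (fun θ => (Real.sqrt (Real.sin θ) : ℂ) * f θ) 2 meridian)
    (hs : Summable (meridianTerm 1 f m)) :
    Integrable (fun θ => ‖f θ‖ ^ 2 / Real.sin θ) meridian := by
  -- The factorized family has squared norms n(n + 1) ≤ (n + 1/2)², so the norm of W_m^1 controls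
  -- both series.
  have hsum : ∀ ε : ℝ, ε ^ 2 = 1 →
      Summable fun i => meridianCoef f (m + i) m • (memLp_factorQ ε (m + i) m).toLp := by
    intro ε hε
    refine summable_of_sq_norm_sum_le hs fun J => ?_
    rw [norm_sum_sq_of_orthogonal (inner_factorQ hε m)]
    refine Finset.sum_le_sum fun i _ => ?_
    unfold meridianTerm
    rw [mul_one, Real.rpow_two]
    gcongr
    nlinarith
  -- The derivatives cancel in the difference, leaving 2m / sin times √sin q_n. Its sum is therefore
  -- 2m f / √sin, which lies in L².
  have hd := (hsum 1 (by norm_num)).sub (hsum (-1) (by norm_num))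
  obtain ⟨g, hg⟩ := hd
  let y : ℕ → ℝ → ℂ := fun i =>
    (fun θ => (factorQ 1 (m + i) m θ : ℂ)) - fun θ => (factorQ (-1) (m + i) m θ : ℂ)
  have hy : ∀ i, MemLp (y i) 2 meridian := fun i =>
    (memLp_factorQ 1 (m + i) m).sub (memLp_factorQ (-1) (m + i) m)
  have hg' : HasSum (fun i => meridianCoef f (m + i) m • (hy i).toLp) g := by
    refine hg.congr_fun ?_
    intro i
    rw [← smul_sub, ← MemLp.toLp_sub]
  have hm' : (m : ℝ) ≠ 0 := by exact_mod_cast hm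
  have hae := ae_eq_of_hasSum_meridian hf hy (b := fun θ => Real.sin θ / (2 * m)) (by fun_prop)
    (fun i => by
      filter_upwards [sin_pos_ae_meridian] with θ hθ
      simp only [y, Pi.sub_apply]
      rw [← Complex.ofReal_sub, ← Complex.ofReal_mul]
      congr 1
      have hq := sin_mul_trigLegendreQuot (m + i) m θ
      simp only [factorQ, trigQ]
      field_simp
      linear_combination (2 * legendreNorm (m + i) m) * hq) hg'
  have hgi := (memLp_two_iff_integrable_sq_norm (Lp.memLp g).1).1 (Lp.memLp g)
  refine (hgi.const_mul (1 / (2 * m) ^ 2)).congr ?_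
  filter_upwards [hae, sin_pos_ae_meridian] with θ h1 h2
  have h3 := congrArg (fun z : ℂ => ‖z‖ ^ 2) h1
  simp only [norm_mul, mul_pow, Complex.norm_real, Real.norm_eq_abs, sq_abs,
    Real.sq_sqrt h2.le] at h3
  rw [eq_div_iff h2.ne']
  field_simp at h3 ⊢
  linear_combination h3

end Vanishing

/-! ### Correction at the poles and the estimate of order one -/

section Endpoints

/-- The continuous representative of a function of `W_m^1`, `m ≠ 0`, vanishes at the poles. -/
lemma fourierSum_poles_eq_zero {m : ℕ} (hm : m ≠ 0) {f : ℝ → ℂ}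
    (hf : MemLp f 2 (volume.restrict (Set.Ioc 0 (2 * Real.pi))))
    (hF : Summable fun k => ‖fourierCoef f k‖)
    (hL2 : MemLp (fun θ => (Real.sqrt (Real.sin θ) : ℂ) * f θ) 2 meridian)
    (hs : Summable (meridianTerm 1 f m)) : fourierSum f 0 = 0 ∧ fourierSum f Real.pi = 0 := by
  have hc := continuous_fourierSum hF
  have hi : IntervalIntegrable (fun θ => ‖fourierSum f θ‖ ^ 2 / Real.sin θ) volume 0 Real.pi := by
    refine (intervalIntegrable_iff_integrableOn_Ioc_of_le Real.pi_pos.le).2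
      ((integrable_norm_sq_div_sin hm hL2 hs).congr ?_)
    filter_upwards [ae_eq_fourierSum hf hF] with θ hθ
    rw [hθ]
  refine ⟨eq_zero_of_integrable_div_sin hc hi, ?_⟩
  have hi' := (hi.comp_sub_left Real.pi).symm
  simp only [Real.sin_pi_sub, sub_self, sub_zero] at hi'
  have h := eq_zero_of_integrable_div_sin (G := fun θ => fourierSum f (Real.pi - θ))
    (by fun_prop) hi'
  simpa using h

/-- The affine function of `cos θ` with values `a` and `b` at the poles. -/
def poleInterpolant (a b : ℂ) (θ : ℝ) : ℂ :=
  a * (((1 + Real.cos θ) / 2 : ℝ) : ℂ) + b * (((1 - Real.cos θ) / 2 : ℝ) : ℂ)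

lemma hasDerivAt_poleInterpolant (a b : ℂ) (θ : ℝ) :
    HasDerivAt (poleInterpolant a b) ((b - a) * ((Real.sin θ / 2 : ℝ) : ℂ)) θ := by
  have h1 : HasDerivAt (fun θ : ℝ => (((1 + Real.cos θ) / 2 : ℝ) : ℂ))
      ((-Real.sin θ / 2 : ℝ) : ℂ) θ :=
    (((Real.hasDerivAt_cos θ).const_add 1).div_const 2).ofReal_comp
  have h2 : HasDerivAt (fun θ : ℝ => (((1 - Real.cos θ) / 2 : ℝ) : ℂ))
      ((-(-Real.sin θ) / 2 : ℝ) : ℂ) θ :=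
    (((Real.hasDerivAt_cos θ).const_sub 1).div_const 2).ofReal_comp
  refine ((h1.const_mul a).add (h2.const_mul b)).congr_deriv ?_
  push_cast
  ring

/-- The interpolant is linear in its pole values, so its coefficients vanish in the limit. -/
lemma tendsto_meridianCoef_sub_poleInterpolant {f : ℝ → ℂ} {a b : Finset ℤ → ℂ}
    (hf : MemLp f 2 (volume.restrict (Set.Ioc 0 (2 * Real.pi))))
    (ha : Filter.Tendsto a Filter.atTop (nhds 0)) (hb : Filter.Tendsto b Filter.atTop (nhds 0))
    (m i : ℕ) :
    Filter.Tendsto (fun K : Finset ℤ => meridianCoef (fun θ =>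
      trigPoly K (fourierCoef f) θ - poleInterpolant (a K) (b K) θ) (m + i) m)
      Filter.atTop (nhds (meridianCoef f (m + i) m)) := by
  set p : ℝ → ℂ := fun θ => (((1 + Real.cos θ) / 2 : ℝ) : ℂ)
  set q : ℝ → ℂ := fun θ => (((1 - Real.cos θ) / 2 : ℝ) : ℂ)
  have hp : Continuous p := by fun_prop
  have hq : Continuous q := by fun_prop
  have h1 := ((tendsto_meridianCoef_trigPoly hf m i).sub
    (ha.mul_const (meridianCoef p (m + i) m))).sub (hb.mul_const (meridianCoef q (m + i) m))
  simp only [zero_mul, sub_zero] at h1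
  refine h1.congr fun K => ?_
  have hT := continuous_trigPoly K (fourierCoef f)
  have hp' : Continuous fun θ => a K * p θ := continuous_const.mul hp
  have hq' : Continuous fun θ => b K * q θ := continuous_const.mul hq
  have hTp : Continuous fun θ => trigPoly K (fourierCoef f) θ - a K * p θ := hT.sub hp'
  rw [← meridianCoef_const_mul, ← meridianCoef_const_mul,
    ← meridianCoef_sub (memLp_meridian_of_continuous hT)
      (memLp_meridian_of_continuous hp'),
    ← meridianCoef_sub (memLp_meridian_of_continuous hTp) (memLp_meridian_of_continuous hq')]
  congr 1
  funext θ
  simp only [poleInterpolant, p, q]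
  ring

lemma sq_le_sobolevWeight_one (k : ℤ) : (k : ℝ) ^ 2 ≤ sobolevWeight 1 k := by
  unfold sobolevWeight
  split_ifs with h
  · simp [h]
  · rw [mul_one, Real.rpow_two, sq_abs]

lemma integral_norm_sq_deriv_trigPoly_le {f : ℝ → ℂ}
    (hs : Summable fun k => sobolevWeight 1 k * ‖fourierCoef f k‖ ^ 2) (K : Finset ℤ) :
    ∫ θ in (0 : ℝ)..Real.pi, ‖trigPoly K (fun k => fourierCoef f k * (Complex.I * k)) θ‖ ^ 2 ≤
      2 * Real.pi * ∑' k, sobolevWeight 1 k * ‖fourierCoef f k‖ ^ 2 := by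
  refine (intervalIntegral_meridian_le
    (Continuous.memLp_two_restrict (continuous_trigPoly K _) 0 _)).trans ?_
  rw [integral_norm_sq_trigPoly]
  refine mul_le_mul_of_nonneg_left (le_trans (Finset.sum_le_sum fun k _ => ?_)
    (hs.sum_le_tsum K fun k _ => mul_nonneg (sobolevWeight_pos 1 k).le (sq_nonneg _)))
    Real.two_pi_pos.le
  rw [norm_mul, norm_mul, Complex.norm_I, one_mul, mul_pow, mul_comm, Complex.norm_intCast, sq_abs]
  exact mul_le_mul_of_nonneg_right (sq_le_sobolevWeight_one k) (sq_nonneg _)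

/-- Subtracting the interpolant makes the partial sum vanish at the poles when m ≠ 0, so the
Dirichlet form bound applies. The price in the derivative is governed by |b - a|, which tends to
zero along the partial sums. -/
lemma sum_eigenvalue_mul_sq_sub_poleInterpolant_le {f : ℝ → ℂ} {m : ℕ} (K : Finset ℤ) {a b : ℂ}
    (hs : Summable fun k => sobolevWeight 1 k * ‖fourierCoef f k‖ ^ 2)
    (h0 : m = 0 ∨ (trigPoly K (fourierCoef f) 0 = a ∧ trigPoly K (fourierCoef f) Real.pi = b))
    (J : Finset ℕ) :
    ∑ i ∈ J, (((m + i : ℕ) : ℝ) * ((m + i : ℕ) + 1)) * ‖meridianCoef (fun θ =>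
        trigPoly K (fourierCoef f) θ - poleInterpolant a b θ) (m + i) m‖ ^ 2 ≤
      (2 + Real.pi ^ 2 * m ^ 2) * (4 * Real.pi *
        ∑' k, sobolevWeight 1 k * ‖fourierCoef f k‖ ^ 2 + 2 * Real.pi * ‖b - a‖ ^ 2) := by
  set c : ℤ → ℂ := fun k => fourierCoef f k * (Complex.I * k)
  have hT := continuous_trigPoly K c
  refine (sum_eigenvalue_mul_sq_meridianCoef_le (fun θ =>
    (hasDerivAt_trigPoly K (fourierCoef f) θ).sub (hasDerivAt_poleInterpolant a b θ))
    (by fun_prop) ?_ J).trans ?_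
  · refine h0.imp_right fun h => ?_
    simp only [Pi.sub_apply]
    simp [poleInterpolant, h.1, h.2]
  refine mul_le_mul_of_nonneg_left ?_ (by positivity)
  have h1 := integral_norm_sq_deriv_trigPoly_le hs K
  calc ∫ θ in (0 : ℝ)..Real.pi, ‖trigPoly K c θ - (b - a) * ((Real.sin θ / 2 : ℝ) : ℂ)‖ ^ 2 ≤
        ∫ θ in (0 : ℝ)..Real.pi, (2 * ‖trigPoly K c θ‖ ^ 2 + 2 * ‖b - a‖ ^ 2) := by
        refine intervalIntegral.integral_mono_on Real.pi_pos.le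
          (Continuous.intervalIntegrable (by fun_prop) _ _)
          (Continuous.intervalIntegrable (by fun_prop) _ _) fun θ _ => ?_
        have hsin : ‖((Real.sin θ / 2 : ℝ) : ℂ)‖ ≤ 1 := by
          rw [Complex.norm_real, Real.norm_eq_abs, abs_div, abs_two]
          linarith [Real.abs_sin_le_one θ]
        calc ‖trigPoly K c θ - (b - a) * ((Real.sin θ / 2 : ℝ) : ℂ)‖ ^ 2 ≤
              (‖trigPoly K c θ‖ + ‖b - a‖) ^ 2 := by
              gcongr
              refine (norm_sub_le _ _).trans ?_
              rw [norm_mul]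
              gcongr
              exact mul_le_of_le_one_right (norm_nonneg _) hsin
          _ ≤ 2 * (‖trigPoly K c θ‖ ^ 2 + ‖b - a‖ ^ 2) := add_sq_le
          _ = _ := by ring
    _ = 2 * (∫ θ in (0 : ℝ)..Real.pi, ‖trigPoly K c θ‖ ^ 2) + 2 * Real.pi * ‖b - a‖ ^ 2 := by
        rw [intervalIntegral.integral_add (Continuous.intervalIntegrable (by fun_prop) _ _)
          (Continuous.intervalIntegrable (by fun_prop) _ _), intervalIntegral.integral_const_mul,
          intervalIntegral.integral_const, smul_eq_mul]
        ring
    _ ≤ _ := by linarith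

/-- The spectral form of `‖f ⊗ e_m‖_{𝓗^1} ≤ C (1 + |m|) ‖f‖_{H^1_#}`. -/
theorem sum_eigenvalue_mul_sq_le_of_memW {m : ℕ} {f : ℝ → ℂ}
    (hf : MemLp f 2 (volume.restrict (Set.Ioc 0 (2 * Real.pi))))
    (hF : Summable fun k => sobolevWeight 1 k * ‖fourierCoef f k‖ ^ 2)
    (hL2 : MemLp (fun θ => (Real.sqrt (Real.sin θ) : ℂ) * f θ) 2 meridian)
    (hs : Summable (meridianTerm 1 f m)) (J : Finset ℕ) :
    ∑ i ∈ J, (((m + i : ℕ) : ℝ) * ((m + i : ℕ) + 1)) * ‖meridianCoef f (m + i) m‖ ^ 2 ≤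
      (2 + Real.pi ^ 2 * m ^ 2) * (4 * Real.pi *
        ∑' k, sobolevWeight 1 k * ‖fourierCoef f k‖ ^ 2) := by
  have hF1 := summable_norm_fourierCoef hF
  obtain ⟨a, b, ha, hb, h0⟩ : ∃ a b : Finset ℤ → ℂ, Filter.Tendsto a Filter.atTop (nhds 0) ∧
      Filter.Tendsto b Filter.atTop (nhds 0) ∧ ∀ K, m = 0 ∨
        (trigPoly K (fourierCoef f) 0 = a K ∧ trigPoly K (fourierCoef f) Real.pi = b K) := by
    -- For m = 0 no boundary condition is needed and no correction is made. Otherwise a and b are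
    -- the pole values of the partial sums, which tend to those of the continuous representative,
    -- namely 0.
    by_cases hm : m = 0
    · exact ⟨fun _ => 0, fun _ => 0, tendsto_const_nhds, tendsto_const_nhds, fun _ => Or.inl hm⟩
    · obtain ⟨h1, h2⟩ := fourierSum_poles_eq_zero hm hf hF1 hL2 hs
      exact ⟨_, _, h1 ▸ tendsto_trigPoly_fourierSum hF1 0,
        h2 ▸ tendsto_trigPoly_fourierSum hF1 Real.pi, fun _ => Or.inr ⟨rfl, rfl⟩⟩
  have hleft := tendsto_finsetSum J fun i _ =>
    (((tendsto_meridianCoef_sub_poleInterpolant hf ha hb m i).norm.pow 2).const_mul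
      (((m + i : ℕ) : ℝ) * ((m + i : ℕ) + 1)))
  have hright := ((((hb.sub ha).norm.pow 2).const_mul (2 * Real.pi)).const_add (4 * Real.pi *
    ∑' k, sobolevWeight 1 k * ‖fourierCoef f k‖ ^ 2)).const_mul (2 + Real.pi ^ 2 * (m : ℝ) ^ 2)
  simp only [sub_zero, norm_zero, ne_eq, OfNat.ofNat_ne_zero, not_false_eq_true, zero_pow,
    mul_zero, add_zero] at hright
  exact le_of_tendsto_of_tendsto' hleft hright fun K =>
    sum_eigenvalue_mul_sq_sub_poleInterpolant_le K hF (h0 K) J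

/-- The embedding of `W_m^1 ∩ H^1_#` with the norm of `H^1_#` into `W_m^1`. -/
theorem exists_normW_one_le : ∃ C : ℝ, 0 < C ∧ ∀ (m : ℤ) (f : ℝ → ℂ), MemW m 1 f → MemH 1 f →
    normW m 1 f ≤ C * (1 + |(m : ℝ)|) * normH 1 f := by
  have hpi := Real.pi_pos
  -- The Dirichlet form contributes 8π + 4π³m² and the remaining quarter of the L² part π/2;
  -- together they are at most (9π + 4π³)(1 + |m|)².
  refine ⟨Real.sqrt (9 * Real.pi + 4 * Real.pi ^ 3), Real.sqrt_pos.2 (by positivity),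
    fun m f hW hH => ?_⟩
  obtain ⟨-, -, hL2, hs⟩ := (memW_iff _ _ _).1 hW
  obtain ⟨hf, -, hF⟩ := hH
  replace hF : Summable fun k => sobolevWeight 1 k * ‖fourierCoef f k‖ ^ 2 := by
    simpa only [← periodicTerm_eq] using hF
  rw [normW_eq, normH_eq]
  set M := m.natAbs with hM
  set N := ∑' k, sobolevWeight 1 k * ‖fourierCoef f k‖ ^ 2 with hN
  have hN0 : 0 ≤ N := tsum_nonneg fun k => mul_nonneg (sobolevWeight_pos 1 k).le (sq_nonneg _)
  have hMm : |(m : ℝ)| = M := by rw [hM, Nat.cast_natAbs, Int.cast_abs]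
  have hL : ∫ θ in (0 : ℝ)..Real.pi, ‖f θ‖ ^ 2 ≤ 2 * Real.pi * N := by
    have hP := hasSum_sq_fourierCoef hf
    have h1 : (2 * Real.pi)⁻¹ * (∫ θ in (0 : ℝ)..(2 * Real.pi), ‖f θ‖ ^ 2) ≤ N := by
      rw [← hP.tsum_eq]
      exact hP.summable.tsum_le_tsum (fun k =>
        le_mul_of_one_le_left (sq_nonneg _) (one_le_sobolevWeight zero_le_one k)) hF
    exact (intervalIntegral_meridian_le hf).trans ((inv_mul_le_iff₀ Real.two_pi_pos).1 h1)
  have hsum : ∑' i, meridianTerm 1 f M i ≤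
      (9 * Real.pi + 4 * Real.pi ^ 3) * (1 + (M : ℝ)) ^ 2 * N := by
    refine hs.tsum_le_of_sum_le fun J => ?_
    have h1 := sum_eigenvalue_mul_sq_le_of_memW hf hF hL2 hs J
    have h2 := (sum_sq_meridianCoef_le (m := M) (memLp_meridian_of_memLp hf) J).trans hL
    -- The weight splits as (n + 1/2)² = n(n + 1) + 1/4.
    have h3 : ∑ i ∈ J, meridianTerm 1 f M i =
        ∑ i ∈ J, (((M + i : ℕ) : ℝ) * ((M + i : ℕ) + 1)) * ‖meridianCoef f (M + i) M‖ ^ 2 +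
          1 / 4 * ∑ i ∈ J, ‖meridianCoef f (M + i) M‖ ^ 2 := by
      rw [Finset.mul_sum, ← Finset.sum_add_distrib]
      refine Finset.sum_congr rfl fun i _ => ?_
      rw [meridianTerm, mul_one, Real.rpow_two]
      ring
    -- The exact surplus of the final bound over the sum of the two contributions, written with
    -- nonnegative terms.
    have h4 : 0 ≤ (Real.pi * M ^ 0 * N / 2 + (2 * (9 * Real.pi + 4 * Real.pi ^ 3)) * M * N +
        9 * Real.pi * M ^ 2 * N + 4 * Real.pi ^ 3 * N) := by positivity
    rw [h3]
    calc _ ≤ (2 + Real.pi ^ 2 * M ^ 2) * (4 * Real.pi * N) + 1 / 4 * (2 * Real.pi * N) := by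
          linarith
      _ ≤ _ := by linarith
  rw [hMm]
  calc Real.sqrt (∑' i, meridianTerm 1 f M i) ≤
        Real.sqrt ((9 * Real.pi + 4 * Real.pi ^ 3) * (1 + (M : ℝ)) ^ 2 * N) :=
        Real.sqrt_le_sqrt hsum
    _ = _ := by
        rw [Real.sqrt_mul (by positivity), Real.sqrt_mul (by positivity),
          Real.sqrt_sq (by positivity)]

end Endpoints

end SphereSobolev

end

theorem proposition3p2 :
    (∀ r : ℝ, 0 < r → ∃ C : ℝ, 0 < C ∧ ∀ (m : ℤ) (f : ℝ → ℂ),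
      SphereSobolev.MemW m (r + 1 / 2) f →
        SphereSobolev.MemH r f ∧
          SphereSobolev.normH r f ≤ C * SphereSobolev.normW m (r + 1 / 2) f) ∧
    (∀ (m : ℤ) (f : ℝ → ℂ),
      SphereSobolev.SphereSymm (SphereSobolev.tensorE f m) → SphereSobolev.MemH 0 f →
        SphereSobolev.MemW m 0 f ∧
          SphereSobolev.normW m 0 f ≤ Real.sqrt Real.pi * SphereSobolev.normH 0 f) ∧
    (∃ C : ℝ, 0 < C ∧ ∀ (m : ℤ) (f : ℝ → ℂ),
      SphereSobolev.MemW m 1 f → SphereSobolev.MemH 1 f →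
        SphereSobolev.normW m 1 f ≤ C * (1 + |(m : ℝ)|) * SphereSobolev.normH 1 f) :=
  ⟨fun _ hr => SphereSobolev.exists_memH_of_memW hr, SphereSobolev.memW_zero_of_memH_zero,
    SphereSobolev.exists_normW_one_le⟩
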